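/- Conventions. $\mathrm{ZFC}^-$ is $\mathrm{ZFC}$ without the power set axiom, with the collection scheme in place of replacement and the well-ordering principle in place of choice. Let $\kappa$ be a cardinal. A weak $\kappa$-model is a transitive set $M\models\mathrm{ZFC}^-$ of size $\kappa$ with $\kappa\in M$; it is a $\kappa$-model if moreover every sequence of length less than $\kappa$ of elements of $M$ is an element of $M$. A weak $\kappa$-model $M$ is $\alpha$-special if it is the union of a continuous elementary chain $\langle X_\xi\mid\xi<\alpha\rangle$ of (not necessarily transitive) elementary submodels of $M$ such that each $X_\xi$ is an element of $M$ which has size $\kappa$ in $M$, and every sequence in $M$ of length less than $\kappa$ of elements of $X_{\xi+1}$ is an element of $X_{\xi+1}$ (for $\xi+1<\alpha$). An $M$-ultrafilter on $\kappa$ is a set $U\subseteq P(\kappa)\cap M$ such that $\langle M,\in,U\rangle$ satisfies that $U$ is a normal ultrafilter on $\kappa$ containing all tails $\kappa\setminus\xi$, $\xi<\kappa$. It is weakly amenable if $X\cap U\in M$ for every $X\in M$ that has size $\kappa$ in $M$. The ultrapower of $M$ by $U$ is formed from the functions $f:\kappa\to M$ with $f\in M$; if it is well-founded, it is identified with its transitive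 collapse $N$, and the ultrapower map $j:M\to N$ sends $a$ to $[c_a]_U$, where $c_a$ is the function on $\kappa$ with constant value $a$. The cardinal $\kappa$ is strongly Ramsey if every $A\subseteq\kappa$ is an element of a $\kappa$-model $M$ for which there exists a weakly amenable $M$-ultrafilter on $\kappa$. Lemma. Suppose $\kappa$ is strongly Ramsey. Then for every $A\subseteq\kappa$ there are a $\kappa$-special $\kappa$-model $M$ with $A\in M$ and a weakly amenable $M$-ultrafilter $U$ on $\kappa$ such that the ultrapower of $M$ by $U$ is well-founded and the ultrapower map $j:M\to N$ satisfies $M=V_{j(\kappa)}^N$; moreover $M\models\mathrm{ZFC}$ and $M\in N$. -/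

import Mathlib

open FirstOrder
open scoped ZFSet

universe u

namespace StrongRamsey

/-! ### The language of set theory; models `⟨M, ∈⟩` that are sets -/

/-- The relation symbols of the language of set theory: one binary symbol. -/
inductive SetRel : ℕ → Type
  | mem : SetRel 2

/-- The first-order language of set theory. -/
def setLang : FirstOrder.Language.{0, 0} := ⟨fun _ => Empty, SetRel⟩

/-- Every set is a structure for the language of set theory, the symbol being interpreted by the
true membership relation. -/
instance memStructure (M : ZFSet.{u}) : setLang.Structure M where
  funMap := fun f => nomatch f
  RelMap := fun r => match r with
    | SetRel.mem => fun x => (x 0 : ZFSet.{u}) ∈ (x 1 : ZFSet.{u})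

/-- `X ≺ M`: `X` is a subset of `M` and the inclusion of `⟨X, ∈⟩` into `⟨M, ∈⟩` is an elementary
embedding. -/
def IsElementarySubmodel (X M : ZFSet.{u}) : Prop :=
  ∃ i : X ↪ₑ[setLang] M, ∀ x : X, (i x : ZFSet.{u}) = x

/-- The axioms common to `ZFC⁻` and `ZFC`, each one relativised to the transitive set `M`.
Instances of schemes are given by the relations on `M` that are first-order definable over
`⟨M, ∈⟩` with parameters from `M`. -/
structure ModelsBase (M : ZFSet.{u}) : Prop where
  nonempty : ∃ x, x ∈ M
  extensionality : ∀ a b : M, (∀ x : M, x.1 ∈ a.1 ↔ x.1 ∈ b.1) → a = b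
  foundation : ∀ a : M, (∃ x : M, x.1 ∈ a.1) →
    ∃ x : M, x.1 ∈ a.1 ∧ ∀ y : M, y.1 ∈ a.1 → y.1 ∉ x.1
  pairing : ∀ a b : M, ∃ c : M, ∀ x : M, x.1 ∈ c.1 ↔ x = a ∨ x = b
  union : ∀ a : M, ∃ c : M, ∀ x : M, x.1 ∈ c.1 ↔ ∃ y : M, y.1 ∈ a.1 ∧ x.1 ∈ y.1
  infinity : ∃ w : M, (∃ e : M, e.1 ∈ w.1 ∧ ∀ z : M, z.1 ∉ e.1) ∧
    ∀ n : M, n.1 ∈ w.1 → ∃ s : M, s.1 ∈ w.1 ∧ ∀ z : M, z.1 ∈ s.1 ↔ z.1 ∈ n.1 ∨ z = n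
  separation : ∀ D : Set M, (Set.univ : Set M).Definable₁ setLang D →
    ∀ a : M, ∃ c : M, ∀ x : M, x.1 ∈ c.1 ↔ x.1 ∈ a.1 ∧ x ∈ D

/-- `M ⊨ ZFC⁻`, for a transitive set `M`: no power set axiom, the collection scheme in place of
replacement, the well-ordering principle in place of choice. -/
structure ModelsZFCMinus (M : ZFSet.{u}) : Prop extends ModelsBase M where
  collection : ∀ R : Set (M × M), (Set.univ : Set M).Definable₂ setLang R →
    ∀ a : M, (∀ x : M, x.1 ∈ a.1 → ∃ y : M, (x, y) ∈ R) →
      ∃ c : M, ∀ x : M, x.1 ∈ a.1 → ∃ y : M, y.1 ∈ c.1 ∧ (x, y) ∈ R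
  /-- Every `a` carries a strict linear order `r` for which every nonempty subset of `a` has a
  least element. -/
  wellOrdering : ∀ a : M, ∃ r : M,
    (∀ x : M, x.1 ∈ a.1 → ZFSet.pair x.1 x.1 ∉ r.1) ∧
    (∀ x y z : M, x.1 ∈ a.1 → y.1 ∈ a.1 → z.1 ∈ a.1 →
      ZFSet.pair x.1 y.1 ∈ r.1 → ZFSet.pair y.1 z.1 ∈ r.1 → ZFSet.pair x.1 z.1 ∈ r.1) ∧
    (∀ x y : M, x.1 ∈ a.1 → y.1 ∈ a.1 →
      ZFSet.pair x.1 y.1 ∈ r.1 ∨ x = y ∨ ZFSet.pair y.1 x.1 ∈ r.1) ∧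
    (∀ b : M, (∀ x : M, x.1 ∈ b.1 → x.1 ∈ a.1) → (∃ x : M, x.1 ∈ b.1) →
      ∃ m : M, m.1 ∈ b.1 ∧ ∀ x : M, x.1 ∈ b.1 → x ≠ m → ZFSet.pair m.1 x.1 ∈ r.1)

/-- `M ⊨ ZFC`, for a transitive set `M`. -/
structure ModelsZFC (M : ZFSet.{u}) : Prop extends ModelsBase M where
  powerset : ∀ a : M, ∃ c : M, ∀ x : M, x.1 ∈ c.1 ↔ ∀ y : M, y.1 ∈ x.1 → y.1 ∈ a.1
  replacement : ∀ R : Set (M × M), (Set.univ : Set M).Definable₂ setLang R →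
    ∀ a : M, (∀ x y z : M, x.1 ∈ a.1 → (x, y) ∈ R → (x, z) ∈ R → y = z) →
      ∃ c : M, ∀ y : M, y.1 ∈ c.1 ↔ ∃ x : M, x.1 ∈ a.1 ∧ (x, y) ∈ R
  /-- Every family of nonempty, pairwise disjoint sets has a transversal. -/
  choice : ∀ a : M, (∀ x : M, x.1 ∈ a.1 → ∃ y : M, y.1 ∈ x.1) →
    (∀ x y z : M, x.1 ∈ a.1 → y.1 ∈ a.1 → z.1 ∈ x.1 → z.1 ∈ y.1 → x = y) →
      ∃ c : M, ∀ x : M, x.1 ∈ a.1 → ∃! y : M, y.1 ∈ x.1 ∧ y.1 ∈ c.1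

/-! ### (Weak) `κ`-models and `α`-special models -/

/-- The cardinal `κ` as a von Neumann (initial) ordinal. -/
noncomputable abbrev ordSet (κ : Cardinal.{u}) : ZFSet.{u} := κ.ord.toZFSet

/-- A weak `κ`-model: a transitive set of size `κ` that has `κ` as an element and satisfies
`ZFC⁻`. -/
structure IsWeakModel (κ : Cardinal.{u}) (M : ZFSet.{u}) : Prop where
  transitive : M.IsTransitive
  card_eq : M.card = κ
  mem : ordSet κ ∈ M
  models : ModelsZFCMinus M

/-- A `κ`-model: a weak `κ`-model closed under sequences of length less than `κ`. -/
structure IsModel (κ : Cardinal.{u}) (M : ZFSet.{u}) : Prop extends IsWeakModel κ M where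
  closed : ∀ δ < κ.ord, ∀ s : ZFSet.{u}, ZFSet.IsFunc δ.toZFSet M s → s ∈ M

/-- `X` is a set of size `κ` in `M`: `X` is an element of `M`, and `M` contains a bijection from
`κ` onto `X`. -/
def HasSizeIn (κ : Cardinal.{u}) (M X : ZFSet.{u}) : Prop :=
  X ∈ M ∧ ∃ f ∈ M, ZFSet.IsFunc (ordSet κ) X f ∧
    ∀ y ∈ X, ∃! x, ZFSet.pair x y ∈ f

/-- `M` is `α`-special (for weak `κ`-models `M`), as witnessed by `⟨X ξ | ξ < α⟩`; the values of
`X` at ordinals `≥ α` play no role. -/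
structure IsSpecialSeq (κ : Cardinal.{u}) (α : Ordinal.{u}) (M : ZFSet.{u})
    (X : Ordinal.{u} → ZFSet.{u}) : Prop where
  elementary : ∀ ξ < α, IsElementarySubmodel (X ξ) M
  chain : ∀ ξ η, ξ ≤ η → η < α → IsElementarySubmodel (X ξ) (X η)
  continuous : ∀ l < α, Order.IsSuccLimit l → ∀ x, x ∈ X l ↔ ∃ ξ < l, x ∈ X ξ
  union : ∀ x, x ∈ M ↔ ∃ ξ < α, x ∈ X ξ
  size : ∀ ξ < α, HasSizeIn κ M (X ξ)
  closed : ∀ ξ, ξ + 1 < α → ∀ δ < κ.ord, ∀ s ∈ M,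
    ZFSet.IsFunc δ.toZFSet (X (ξ + 1)) s → s ∈ X (ξ + 1)

/-- The weak `κ`-model `M` is `α`-special. -/
def IsSpecial (κ : Cardinal.{u}) (α : Ordinal.{u}) (M : ZFSet.{u}) : Prop :=
  IsWeakModel κ M ∧ ∃ X : Ordinal.{u} → ZFSet.{u}, IsSpecialSeq κ α M X

/-! ### `M`-ultrafilters and strongly Ramsey cardinals -/

/-- `U` is an `M`-ultrafilter on `κ`: `U ⊆ P(κ) ∩ M` and `⟨M, ∈, U⟩` satisfies that `U` is a
normal ultrafilter on `κ` that contains the tail sets. -/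
structure IsMUltrafilter (κ : Cardinal.{u}) (M U : ZFSet.{u}) : Prop where
  subset : ∀ B ∈ U, B ∈ M ∧ B ⊆ ordSet κ
  univ_mem : ordSet κ ∈ U
  empty_notMem : ∅ ∉ U
  superset : ∀ B ∈ U, ∀ C ∈ M, B ⊆ C → C ⊆ ordSet κ → C ∈ U
  inter : ∀ B ∈ U, ∀ C ∈ U, B ∩ C ∈ U
  ultra : ∀ B ∈ M, B ⊆ ordSet κ → B ∈ U ∨ ordSet κ \ B ∈ U
  tail : ∀ ξ ∈ ordSet κ, ordSet κ \ ξ ∈ U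
  /-- Closure under diagonal intersections of sequences `f = ⟨f ξ | ξ < κ⟩ ∈ M` of elements
  of `U`. -/
  normal : ∀ f ∈ M, ZFSet.IsFunc (ordSet κ) U f →
    ZFSet.sep (fun β => ∀ ξ ∈ β, ∀ B, ZFSet.pair ξ B ∈ f → β ∈ B) (ordSet κ) ∈ U

/-- `U` is weakly amenable to `M`: the intersection of `U` with any set of size `κ` in `M` is an
element of `M`. -/
def IsWeaklyAmenable (κ : Cardinal.{u}) (M U : ZFSet.{u}) : Prop :=
  ∀ X, HasSizeIn κ M X → X ∩ U ∈ M

/-- The cardinal `κ` is strongly Ramsey. -/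
def IsStronglyRamsey (κ : Cardinal.{u}) : Prop :=
  ∀ A : ZFSet.{u}, A ⊆ ordSet κ →
    ∃ M, A ∈ M ∧ IsModel κ M ∧ ∃ U, IsMUltrafilter κ M U ∧ IsWeaklyAmenable κ M U

/-! ### Ultrapowers -/

/-- `f` is an element of `M` that is a function from `κ` to `M`. -/
def IsUltFun (κ : Cardinal.{u}) (M f : ZFSet.{u}) : Prop :=
  f ∈ M ∧ ZFSet.IsFunc (ordSet κ) M f

/-- `f =_U g`, that is, `{ξ < κ | f ξ = g ξ} ∈ U`. -/
def UltEq (κ : Cardinal.{u}) (U f g : ZFSet.{u}) : Prop :=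
  ZFSet.sep (fun ξ => ∃ y, ZFSet.pair ξ y ∈ f ∧ ZFSet.pair ξ y ∈ g) (ordSet κ) ∈ U

/-- `f ∈_U g`, that is, `{ξ < κ | f ξ ∈ g ξ} ∈ U`. -/
def UltMem (κ : Cardinal.{u}) (U f g : ZFSet.{u}) : Prop :=
  ZFSet.sep (fun ξ => ∃ y z, ZFSet.pair ξ y ∈ f ∧ ZFSet.pair ξ z ∈ g ∧ y ∈ z) (ordSet κ) ∈ U

/-- The ultrapower of `M` by `U` is well-founded, with transitive collapse `N`, and `j : M → N` is
the ultrapower map. Here `p f` is the element of `N` to which the class `[f]_U` of a function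
`f : κ → M` in `M` collapses, and `j a = [c_a]_U` where `c_a = κ × {a}` is the function on `κ` that
is constantly `a`. The values of `j` outside `M`, and of `p` outside these functions, play no
role. -/
def IsUltrapowerMap (κ : Cardinal.{u}) (M U N : ZFSet.{u}) (j : ZFSet.{u} → ZFSet.{u}) : Prop :=
  N.IsTransitive ∧ ∃ p : ZFSet.{u} → ZFSet.{u},
    (∀ x, x ∈ N ↔ ∃ f, IsUltFun κ M f ∧ p f = x) ∧
    (∀ f g, IsUltFun κ M f → IsUltFun κ M g → (p f = p g ↔ UltEq κ U f g)) ∧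
    (∀ f g, IsUltFun κ M f → IsUltFun κ M g → (p f ∈ p g ↔ UltMem κ U f g)) ∧
    (∀ a ∈ M, IsUltFun κ M (ZFSet.prod (ordSet κ) {a}) ∧ j a = p (ZFSet.prod (ordSet κ) {a}))

/-- `V_a^N`, for a transitive set `N` and a von Neumann ordinal `a ∈ N`: the elements of `N` of
rank less than `a`. (An ordinal is its own rank.) -/
noncomputable def vonNeumannIn (N a : ZFSet.{u}) : ZFSet.{u} := V_ (ZFSet.rank a) ∩ N

end StrongRamsey

-- Fix a κ-model W containing A and a weakly amenable W-ultrafilter U, and let p send functions to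
-- their classes in the collapsed ultrapower of W by U. The cardinal κ is inaccessible: completeness
-- and normality of U make it regular and uncountable, and `IsStronglyRamsey.isStrongLimit` treats
-- powers by coding subsets of a smaller cardinal into one subset of κ. Hence V_κ is an element of
-- W, and the required model is M = `imageV κ p`, the image of V_κ under the ultrapower map. Its
-- elements are the classes of functions κ → V_κ in W. By Łoś's theorem (`IsCollapse.sat_iff`) M
-- satisfies ZFC because V_κ does; completeness makes M closed under short sequences (`apply_lam`),
-- and normality makes the identity represent κ (`apply_id`).
--
-- M and W have the same subsets of V_κ. A set B in W is represented by its intersections with the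
-- initial segments of an enumeration of V_κ (`subset_V_mem`). Conversely, a subset p(F) of V_κ is
-- decoded by asking which of the sets {ξ | x ∈ F(ξ)} lie in U, and weak amenability lets W answer
-- this (`mem_of_subset_V`). So U is also a weakly amenable M-ultrafilter. Functions κ → V_κ are
-- subsets of V_κ, so M and W have the same ones, and the ultrapower of M by U again sends V_κ to M
-- (`imageV_congr`). As the image of V_κ, M is an element of that ultrapower N and equals its
-- V_{j(κ)} (`imageV_eq`).
--
-- For κ-specialness, call X small if X = p(F) with |F(ξ)| ≤ |ξ| for almost all ξ. Since the
-- identity represents κ, a small set that includes κ has size κ in M (`hasSizeIn_of_isSmall`).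
-- Almost every ξ is regular and has at most |ξ| shorter sequences of its elements, so F(ξ) can be
-- closed off to an elementary submodel of V_κ of size at most |ξ| that contains all its sequences
-- of length less than ξ (`exists_hull`). The class of the result is a small elementary submodel of
-- M closed under all sequences of length less than κ (`isSmall_hull`). Iterating κ times along an
-- enumeration of M, with unions at limits, gives the chain.

universe v

namespace StrongRamsey


/-! ### Definability over a transitive model -/

/-- The predicate `P` of finitely many elements of `W` is first-order definable over `⟨W, ∈⟩`
with parameters. -/
class Dfn {W : ZFSet.{u}} {β : Type} (P : (β → W) → Prop) : Prop where
  out : (Set.univ : Set W).Definable setLang {v | P v}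

/-- The operation `t` on finitely many elements of `W` takes values in `W` and is first-order
definable over `⟨W, ∈⟩` with parameters. -/
class Tm {W : ZFSet.{u}} {β : Type} (t : (β → W) → ZFSet.{u}) : Prop where
  mem : ∀ v, t v ∈ W
  graph : Dfn (fun w : Option β → W => (w none : ZFSet.{u}) = t (fun i => w (some i)))

/-- `W` is a transitive model of `ZFC⁻`. -/
class IsTransModel (W : ZFSet.{u}) : Prop where
  transitive : W.IsTransitive
  models : ModelsZFCMinus W

section Dfn

variable {W : ZFSet.{u}} {β γ : Type}

theorem Dfn.congr {P Q : (β → W) → Prop} (h : Dfn P) (e : ∀ v, Q v ↔ P v) : Dfn Q := by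
  have : Q = P := funext fun v => propext (e v)
  rwa [this]

theorem Dfn.comp {P : (γ → W) → Prop} (h : Dfn P) (f : γ → β) :
    Dfn (fun v : β → W => P (fun i => v (f i))) :=
  ⟨h.out.preimage_comp f⟩

theorem Dfn.swap {P : ZFSet.{u} → ZFSet.{u} → Prop}
    (h : Dfn (fun w : Option (Option Empty) → W => P (w none) (w (some none)))) :
    Dfn (fun w : Option (Option Empty) → W => P (w (some none)) (w none)) :=
  h.comp (fun o => o.elim (some none) (fun _ => none))

/-- Some tuple consists of the values of the terms and satisfies `P`; this is definable because the
graphs are, and finitely many variables can be quantified away. -/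
theorem Dfn.subst [Finite γ] {P : (γ → W) → Prop} (h : Dfn P)
    (t : γ → (β → W) → ZFSet.{u}) [ht : ∀ i, Tm (t i)] :
    Dfn (fun v : β → W => P (fun i => ⟨t i v, (ht i).mem v⟩)) := by
  have h1 : (Set.univ : Set W).Definable setLang
      {w : β ⊕ γ → W | P (fun i => w (Sum.inr i)) ∧
        ∀ i, (w (Sum.inr i) : ZFSet.{u}) = t i (fun j => w (Sum.inl j))} := by
    have := Set.definable_iInter_of_finite (ι := γ) (f := fun i => {w : β ⊕ γ → W |
      (w (Sum.inr i) : ZFSet.{u}) = t i (fun j => w (Sum.inl j))}) (fun i =>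
        ((ht i).graph.comp (β := β ⊕ γ) (fun o => o.elim (Sum.inr i) Sum.inl)).out)
    have h2 : (Set.univ : Set W).Definable setLang {w : β ⊕ γ → W | ∀ i, (w (Sum.inr i) : ZFSet.{u}) = t i (fun j => w (Sum.inl j))} := by
      convert this using 1
      ext w
      simp
    exact (h.comp Sum.inr).out.inter h2
  refine ⟨?_⟩
  convert h1.exists_of_finite using 1
  ext v
  simp only [Set.mem_ofPred_eq, Sum.elim_inr, Sum.elim_inl]
  constructor
  · intro hv
    exact ⟨_, hv, fun i => rfl⟩
  · rintro ⟨u, hu, hi⟩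
    have : u = fun i => ⟨t i v, (ht i).mem v⟩ := funext fun i => Subtype.ext (hi i)
    rwa [this] at hu

instance Tm.var (i : β) : Tm (fun v : β → W => (v i : ZFSet.{u})) where
  mem v := (v i).2
  graph := ⟨⟨(FirstOrder.Language.Term.var none).equal (FirstOrder.Language.Term.var (some i)), by
    ext w
    exact Subtype.ext_iff.symm⟩⟩

instance Tm.const (c : ZFSet.{u}) [hc : Fact (c ∈ W)] : Tm (fun _ : β → W => c) where
  mem _ := hc.out
  graph := ⟨⟨(FirstOrder.Language.Term.var none).equal
    (FirstOrder.Language.Constants.term (setLang.con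
      (⟨⟨c, hc.out⟩, Set.mem_univ _⟩ : (Set.univ : Set W)))), by
    ext w
    rw [Set.mem_ofPred_eq, Set.mem_ofPred_eq, FirstOrder.Language.Formula.realize_equal,
      FirstOrder.Language.Term.realize_constants, FirstOrder.Language.coe_con]
    exact ⟨fun h => Subtype.ext h, fun h => congrArg Subtype.val h⟩⟩⟩

theorem dfn_mem_var : Dfn (fun v : Bool → W => (v false : ZFSet.{u}) ∈ (v true : ZFSet.{u})) := by
  refine ⟨?_⟩
  have : (∅ : Set W).Definable setLang
      {v : Bool → W | (v false : ZFSet.{u}) ∈ (v true : ZFSet.{u})} := by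
    rw [Set.empty_definable_iff]
    refine ⟨FirstOrder.Language.Relations.formula₂ (L := setLang) SetRel.mem
      (FirstOrder.Language.Term.var false) (FirstOrder.Language.Term.var true), ?_⟩
    ext v
    rfl
  exact this.mono (Set.empty_subset _)

theorem dfn_eq_var : Dfn (fun v : Bool → W => (v false : ZFSet.{u}) = (v true : ZFSet.{u})) :=
  ⟨⟨(FirstOrder.Language.Term.var false).equal (FirstOrder.Language.Term.var true), by
    ext w
    exact Subtype.ext_iff.symm⟩⟩

instance Dfn.mem (s t : (β → W) → ZFSet.{u}) [hs : Tm s] [ht : Tm t] :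
    Dfn (fun v => s v ∈ t v) :=
  have : ∀ b : Bool, Tm (if b then t else s) := by intro b; cases b <;> simpa
  (dfn_mem_var.subst (fun b : Bool => if b then t else s)).congr (fun v => by simp)

instance Dfn.eq (s t : (β → W) → ZFSet.{u}) [hs : Tm s] [ht : Tm t] :
    Dfn (fun v => s v = t v) :=
  have : ∀ b : Bool, Tm (if b then t else s) := by intro b; cases b <;> simpa
  (dfn_eq_var.subst (fun b : Bool => if b then t else s)).congr (fun v => by simp)

instance Dfn.prop (p : Prop) : Dfn (fun _ : β → W => p) := by
  by_cases hp : p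
  · refine ⟨?_⟩; convert Set.definable_univ using 1; ext; simp [hp]
  · refine ⟨?_⟩; convert Set.definable_empty using 1; ext; simp [hp]

instance Dfn.and (P Q : (β → W) → Prop) [hP : Dfn P] [hQ : Dfn Q] :
    Dfn (fun v => P v ∧ Q v) := ⟨hP.out.inter hQ.out⟩

instance Dfn.or (P Q : (β → W) → Prop) [hP : Dfn P] [hQ : Dfn Q] :
    Dfn (fun v => P v ∨ Q v) := ⟨hP.out.union hQ.out⟩

instance Dfn.not (P : (β → W) → Prop) [hP : Dfn P] : Dfn (fun v => ¬ P v) := ⟨hP.out.compl⟩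

instance Dfn.imp (P Q : (β → W) → Prop) [hP : Dfn P] [hQ : Dfn Q] :
    Dfn (fun v => P v → Q v) :=
  Dfn.congr (P := fun v => ¬ P v ∨ Q v) inferInstance (fun _ => imp_iff_not_or)

instance Dfn.iff (P Q : (β → W) → Prop) [hP : Dfn P] [hQ : Dfn Q] :
    Dfn (fun v => P v ↔ Q v) :=
  Dfn.congr (P := fun v => (P v → Q v) ∧ (Q v → P v)) inferInstance (fun _ => iff_iff_implies_and_implies)

instance Dfn.exists_model (P : (β → W) → ZFSet.{u} → Prop)
    [h : Dfn (fun w : Option β → W => P (fun i => w (some i)) (w none))] :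
    Dfn (fun v => ∃ x ∈ W, P v x) := by
  refine ⟨?_⟩
  have h1 := (h.comp (β := β ⊕ Unit) (fun o => o.elim (Sum.inr ()) Sum.inl)).out
  convert h1.exists_of_finite using 1
  ext v
  simp only [Set.mem_ofPred_eq, Option.elim, Sum.elim_inr, Sum.elim_inl]
  exact ⟨fun ⟨x, hx, h⟩ => ⟨fun _ => ⟨x, hx⟩, h⟩, fun ⟨f, h⟩ => ⟨f (), (f ()).2, h⟩⟩

instance Dfn.forall_model (P : (β → W) → ZFSet.{u} → Prop)
    [h : Dfn (fun w : Option β → W => P (fun i => w (some i)) (w none))] :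
    Dfn (fun v => ∀ x ∈ W, P v x) :=
  Dfn.congr (P := fun v => ¬ ∃ x ∈ W, ¬ P v x) inferInstance (fun _ => by push Not; rfl)

theorem Tm.weaken {t : (γ → W) → ZFSet.{u}} (h : Tm t) (f : γ → β) :
    Tm (fun v : β → W => t (fun i => v (f i))) where
  mem _ := h.mem _
  graph := (h.graph.comp (β := Option β) (fun o => o.elim none (fun i => some (f i)))).congr
    (fun _ => Iff.rfl)

/-- The bound is an element of the transitive set `W`, so a quantifier over its elements is a
quantifier over `W`. -/
instance Dfn.exists_mem [hW : IsTransModel W] (t : (β → W) → ZFSet.{u}) [ht : Tm t]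
    (P : (β → W) → ZFSet.{u} → Prop)
    [h : Dfn (fun w : Option β → W => P (fun i => w (some i)) (w none))] :
    Dfn (fun v => ∃ x ∈ t v, P v x) := by
  have := ht.weaken (β := Option β) some
  exact Dfn.congr (P := fun v => ∃ x ∈ W, x ∈ t v ∧ P v x) inferInstance fun v =>
    ⟨fun ⟨x, hx, h⟩ => ⟨x, hW.transitive _ (ht.mem v) hx, hx, h⟩, fun ⟨x, _, h⟩ => ⟨x, h⟩⟩

instance Dfn.forall_mem [hW : IsTransModel W] (t : (β → W) → ZFSet.{u}) [ht : Tm t]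
    (P : (β → W) → ZFSet.{u} → Prop)
    [h : Dfn (fun w : Option β → W => P (fun i => w (some i)) (w none))] :
    Dfn (fun v => ∀ x ∈ t v, P v x) :=
  Dfn.congr (P := fun v => ¬ ∃ x ∈ t v, ¬ P v x) inferInstance (fun _ => by push Not; rfl)

instance Dfn.subset [hW : IsTransModel W] (s t : (β → W) → ZFSet.{u}) [hs : Tm s] [ht : Tm t] :
    Dfn (fun v => s v ⊆ t v) := by
  have := ht.weaken (β := Option β) some
  exact Dfn.congr (P := fun v => ∀ x ∈ s v, x ∈ t v) inferInstance fun v => Iff.rfl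

/-- Extensionality recovers the graph from the membership relation of the value, and transitivity
makes it enough to test elements of `W`. -/
theorem Tm.of_mem [hW : IsTransModel W] {t : (β → W) → ZFSet.{u}} (hm : ∀ v, t v ∈ W)
    (h : Dfn (fun w : Option β → W => (w none : ZFSet.{u}) ∈ t (fun i => w (some i)))) : Tm t where
  mem := hm
  graph := by
    have h1 : Dfn (fun w : Option (Option β) → W =>
        (w none : ZFSet.{u}) ∈ t (fun i => w (some (some i)))) :=
      h.comp (β := Option (Option β)) (fun o => o.elim none (fun i => some (some i)))
    refine Dfn.congr (P := fun w => ∀ z ∈ W, z ∈ (w none : ZFSet.{u}) ↔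
      z ∈ t (fun i => w (some i))) inferInstance fun w => ?_
    constructor
    · intro e z _; rw [e]
    · intro e
      ext z
      exact ⟨fun hz => (e z (hW.transitive _ (w none).2 hz)).1 hz,
        fun hz => (e z (hW.transitive _ (hm _) hz)).2 hz⟩

theorem Dfn.definable₁ [Finite β] {P : (Option β → W) → Prop} (h : Dfn P) (v : β → W) :
    (Set.univ : Set W).Definable₁ setLang {x | P (fun o => o.elim x v)} := by
  have hc : ∀ i, Fact ((v i : ZFSet.{u}) ∈ W) := fun i => ⟨(v i).2⟩
  have : ∀ o : Option β, Tm (fun w : Fin 1 → W => ((o.elim (w 0) v : W) : ZFSet.{u})) := by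
    rintro (_ | i)
    · exact Tm.var 0
    · exact Tm.const (v i : ZFSet.{u})
  have h1 := h.subst (β := Fin 1) (fun o w => ((o.elim (w 0) v : W) : ZFSet.{u}))
  exact h1.out

theorem Dfn.definable₂ [Finite β] {P : (Option (Option β) → W) → Prop} (h : Dfn P) (v : β → W) :
    (Set.univ : Set W).Definable₂ setLang
      {p | P (fun o => o.elim p.2 (fun o => o.elim p.1 v))} := by
  have hc : ∀ i, Fact ((v i : ZFSet.{u}) ∈ W) := fun i => ⟨(v i).2⟩
  have : ∀ o : Option (Option β), Tm (fun w : Fin 2 → W =>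
      ((o.elim (w 1) (fun o => o.elim (w 0) v) : W) : ZFSet.{u})) := by
    rintro (_ | _ | i)
    · exact Tm.var 1
    · exact Tm.var 0
    · exact Tm.const (v i : ZFSet.{u})
  have h1 := h.subst (β := Fin 2) (fun o w =>
    ((o.elim (w 1) (fun o => o.elim (w 0) v) : W) : ZFSet.{u}))
  exact h1.out

end Dfn

/-! ### Set-theoretic operations in transitive models -/

section Operations

variable {W : ZFSet.{u}} [hW : IsTransModel W] {β : Type}

theorem IsTransModel.mem_of_mem {x y : ZFSet.{u}} (hxy : x ∈ y) (hy : y ∈ W) : x ∈ W :=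
  hW.transitive _ hy hxy

theorem insert_singleton_mem {a b : ZFSet.{u}} (ha : a ∈ W) (hb : b ∈ W) : {a, b} ∈ W := by
  obtain ⟨c, hc⟩ := hW.models.pairing ⟨a, ha⟩ ⟨b, hb⟩
  have : ({a, b} : ZFSet.{u}) = c := by
    ext z
    rw [ZFSet.mem_pair]
    constructor
    · rintro (rfl | rfl)
      · exact (hc ⟨z, ha⟩).2 (Or.inl rfl)
      · exact (hc ⟨z, hb⟩).2 (Or.inr rfl)
    · intro hz
      simpa [Subtype.ext_iff] using (hc ⟨z, IsTransModel.mem_of_mem hz c.2⟩).1 hz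
  rw [this]
  exact c.2

theorem sUnion_mem {a : ZFSet.{u}} (ha : a ∈ W) : (⋃₀ a : ZFSet.{u}) ∈ W := by
  obtain ⟨c, hc⟩ := hW.models.union ⟨a, ha⟩
  have : (⋃₀ a : ZFSet.{u}) = c := by
    ext z
    rw [ZFSet.mem_sUnion]
    constructor
    · rintro ⟨y, hy, hz⟩
      have hyW := IsTransModel.mem_of_mem hy ha
      exact (hc ⟨z, IsTransModel.mem_of_mem hz hyW⟩).2 ⟨⟨y, hyW⟩, hy, hz⟩
    · intro hz
      obtain ⟨y, h1, h2⟩ := (hc ⟨z, IsTransModel.mem_of_mem hz c.2⟩).1 hz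
      exact ⟨y, h1, h2⟩
  rw [this]
  exact c.2

theorem sep_mem [Finite β] (v : β → W) (P : (β → W) → ZFSet.{u} → Prop)
    [h : Dfn (fun w : Option β → W => P (fun i => w (some i)) (w none))] {a : ZFSet.{u}}
    (ha : a ∈ W) : ZFSet.sep (P v) a ∈ W := by
  obtain ⟨c, hc⟩ := hW.models.separation _ (h.definable₁ v) ⟨a, ha⟩
  have : ZFSet.sep (P v) a = c := by
    ext z
    rw [ZFSet.mem_sep]
    constructor
    · rintro ⟨h1, h2⟩
      exact (hc ⟨z, IsTransModel.mem_of_mem h1 ha⟩).2 ⟨h1, h2⟩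
    · intro hz
      exact (hc ⟨z, IsTransModel.mem_of_mem hz c.2⟩).1 hz
  rw [this]
  exact c.2

theorem empty_mem_model : ∅ ∈ W := by
  obtain ⟨x, hx⟩ := hW.models.nonempty
  have : ∀ y ∈ W, ∅ ∈ W := by
    intro y
    induction y using ZFSet.inductionOn with
    | _ y ih =>
      intro hy
      rcases y.eq_empty_or_nonempty with rfl | ⟨z, hz⟩
      · exact hy
      · exact ih z hz (IsTransModel.mem_of_mem hz hy)
  exact this x hx

instance : Fact (∅ ∈ W) := ⟨empty_mem_model⟩

end Operations


/-! ### Functions coded as sets of ordered pairs -/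

/-- The image of the set `a` under `f`. -/
noncomputable def img (f : ZFSet.{u} → ZFSet.{u}) (a : ZFSet.{u}) : ZFSet.{u} :=
  ZFSet.range (fun x : a => f x)

theorem mem_img {f : ZFSet.{u} → ZFSet.{u}} {a z : ZFSet.{u}} :
    z ∈ img f a ↔ ∃ x ∈ a, z = f x := by
  simp only [img, ZFSet.mem_range, Subtype.exists, exists_prop]
  exact exists_congr fun x => and_congr_right fun _ => eq_comm

/-- The restriction of `f` to `a`, as a set of ordered pairs. -/
noncomputable def lam (f : ZFSet.{u} → ZFSet.{u}) (a : ZFSet.{u}) : ZFSet.{u} :=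
  img (fun x => ZFSet.pair x (f x)) a

theorem mem_lam {f : ZFSet.{u} → ZFSet.{u}} {a z : ZFSet.{u}} :
    z ∈ lam f a ↔ ∃ x ∈ a, z = ZFSet.pair x (f x) := mem_img

theorem pair_mem_lam {f : ZFSet.{u} → ZFSet.{u}} {a x y : ZFSet.{u}} :
    ZFSet.pair x y ∈ lam f a ↔ x ∈ a ∧ y = f x := by
  simp only [mem_lam, ZFSet.pair_inj]
  exact ⟨fun ⟨z, hz, h1, h2⟩ => by subst h1; exact ⟨hz, h2⟩, fun ⟨h1, h2⟩ => ⟨x, h1, rfl, h2⟩⟩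

theorem isFunc_lam {f : ZFSet.{u} → ZFSet.{u}} {a b : ZFSet.{u}} (h : ∀ x ∈ a, f x ∈ b) :
    ZFSet.IsFunc a b (lam f a) := by
  refine ⟨fun z hz => ?_, fun x hx => ⟨f x, pair_mem_lam.2 ⟨hx, rfl⟩, fun y hy =>
    (pair_mem_lam.1 hy).2⟩⟩
  obtain ⟨x, hx, rfl⟩ := mem_lam.1 hz
  exact ZFSet.pair_mem_prod.2 ⟨hx, h x hx⟩

/-- The value of the function `f` (a set of ordered pairs) at `x`. -/
noncomputable def ev (f x : ZFSet.{u}) : ZFSet.{u} :=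
  ⋃₀ ZFSet.sep (fun y => ZFSet.pair x y ∈ f) (⋃₀ ⋃₀ f)

theorem mem_sUnion_sUnion_of_pair {x y f : ZFSet.{u}} (h : ZFSet.pair x y ∈ f) :
    x ∈ (⋃₀ ⋃₀ f : ZFSet.{u}) ∧ y ∈ (⋃₀ ⋃₀ f : ZFSet.{u}) := by
  have : ({x, y} : ZFSet.{u}) ∈ (⋃₀ f : ZFSet.{u}) :=
    ZFSet.mem_sUnion.2 ⟨_, h, by simp [ZFSet.pair]⟩
  exact ⟨ZFSet.mem_sUnion.2 ⟨_, this, by simp⟩, ZFSet.mem_sUnion.2 ⟨_, this, by simp⟩⟩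

theorem mem_ev {f x z : ZFSet.{u}} : z ∈ ev f x ↔ ∃ y, ZFSet.pair x y ∈ f ∧ z ∈ y := by
  rw [ev, ZFSet.mem_sUnion]
  simp only [ZFSet.mem_sep]
  constructor
  · rintro ⟨y, ⟨_, h⟩, hz⟩
    exact ⟨y, h, hz⟩
  · rintro ⟨y, h, hz⟩
    exact ⟨y, ⟨(mem_sUnion_sUnion_of_pair h).2, h⟩, hz⟩

/-- Being the union of all candidate values, `ev` is a total operation built by bounded separation;
it returns the value wherever that is unique. -/
theorem ev_eq {f x y : ZFSet.{u}} (h : ZFSet.pair x y ∈ f)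
    (hu : ∀ z, ZFSet.pair x z ∈ f → z = y) : ev f x = y := by
  ext z
  rw [mem_ev]
  exact ⟨fun ⟨w, hw, hz⟩ => hu w hw ▸ hz, fun hz => ⟨y, h, hz⟩⟩

theorem ev_lam {f : ZFSet.{u} → ZFSet.{u}} {a x : ZFSet.{u}} (h : x ∈ a) :
    ev (lam f a) x = f x :=
  ev_eq (pair_mem_lam.2 ⟨h, rfl⟩) fun _ hz => (pair_mem_lam.1 hz).2

theorem lam_congr {f g : ZFSet.{u} → ZFSet.{u}} {a : ZFSet.{u}} (h : ∀ x ∈ a, f x = g x) :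
    lam f a = lam g a := by
  ext z
  simp only [mem_lam]
  exact exists_congr fun x => and_congr_right fun hx => by rw [h x hx]

section IsFunc

variable {a b f x y : ZFSet.{u}}

theorem IsFunc.pair_mem_iff (h : ZFSet.IsFunc a b f) :
    ZFSet.pair x y ∈ f ↔ x ∈ a ∧ y = ev f x := by
  have key : ∀ x ∈ a, ZFSet.pair x (ev f x) ∈ f := by
    intro x hx
    obtain ⟨w, hw, hu⟩ := h.2 x hx
    rwa [ev_eq hw hu]
  constructor
  · intro hxy
    have hx := (ZFSet.pair_mem_prod.1 (h.1 hxy)).1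
    exact ⟨hx, (h.2 x hx).unique hxy (key x hx)⟩
  · rintro ⟨hx, rfl⟩
    exact key x hx

theorem IsFunc.ev_mem (h : ZFSet.IsFunc a b f) (hx : x ∈ a) : ev f x ∈ b :=
  (ZFSet.pair_mem_prod.1 (h.1 ((IsFunc.pair_mem_iff h).2 ⟨hx, rfl⟩))).2

theorem IsFunc.eq_lam (h : ZFSet.IsFunc a b f) : f = lam (ev f) a := by
  ext z
  rw [mem_lam]
  constructor
  · intro hz
    obtain ⟨x, _, y, _, rfl⟩ := ZFSet.mem_prod.1 (h.1 hz)
    obtain ⟨hx, hy⟩ := (IsFunc.pair_mem_iff h).1 hz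
    exact ⟨x, hx, by rw [← hy]⟩
  · rintro ⟨x, hx, rfl⟩
    exact (IsFunc.pair_mem_iff h).2 ⟨hx, rfl⟩

theorem IsFunc.ext {b' g : ZFSet.{u}} (hf : ZFSet.IsFunc a b f) (hg : ZFSet.IsFunc a b' g)
    (h : ∀ x ∈ a, ev f x = ev g x) : f = g := by
  rw [IsFunc.eq_lam hf, IsFunc.eq_lam hg]
  exact lam_congr h

theorem IsFunc.mono {b' : ZFSet.{u}} (hf : ZFSet.IsFunc a b f) (h : ∀ x ∈ a, ev f x ∈ b') :
    ZFSet.IsFunc a b' f := by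
  rw [IsFunc.eq_lam hf]
  exact isFunc_lam h

/-- In this form every quantifier is bounded by one of the three sets, so definability over a
transitive model is automatic. -/
theorem isFunc_iff : ZFSet.IsFunc a b f ↔ (∀ p ∈ f, ∃ x ∈ a, ∃ y ∈ b, p = ZFSet.pair x y) ∧
    ∀ x ∈ a, ∃ y ∈ b, ZFSet.pair x y ∈ f ∧ ∀ z ∈ b, ZFSet.pair x z ∈ f → z = y := by
  constructor
  · intro h
    refine ⟨fun p hp => ZFSet.mem_prod.1 (h.1 hp), fun x hx => ?_⟩
    obtain ⟨y, hy, hu⟩ := h.2 x hx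
    exact ⟨y, (ZFSet.pair_mem_prod.1 (h.1 hy)).2, hy, fun z _ hz => hu z hz⟩
  · rintro ⟨h1, h2⟩
    have h3 : f ⊆ ZFSet.prod a b := fun p hp => ZFSet.mem_prod.2 (h1 p hp)
    refine ⟨h3, fun x hx => ?_⟩
    obtain ⟨y, _, hy, hu⟩ := h2 x hx
    exact ⟨y, hy, fun z hz => hu z (ZFSet.pair_mem_prod.1 (h3 hz)).2 hz⟩

end IsFunc

/-- The main device for membership in a model: a set described from parameters by separation, images
and the like is a term without variables, and instance search places it in `W`. Parameters enter
through `Fact`. -/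
theorem mem_of_tm {W : ZFSet.{u}} (c : ZFSet.{u}) [h : Tm (W := W) (fun _ : Empty → W => c)] :
    c ∈ W :=
  h.mem (fun e => e.elim)

section Operations

variable {W : ZFSet.{u}} [hW : IsTransModel W] {β : Type}

instance Tm.insertSingleton (s t : (β → W) → ZFSet.{u}) [hs : Tm s] [ht : Tm t] :
    Tm (fun v => ({s v, t v} : ZFSet.{u})) :=
  have := hs.weaken (β := Option β) some
  have := ht.weaken (β := Option β) some
  Tm.of_mem (fun v => insert_singleton_mem (hs.mem v) (ht.mem v))
    (Dfn.congr (P := fun w => (w none : ZFSet.{u}) = s (fun i => w (some i)) ∨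
      (w none : ZFSet.{u}) = t (fun i => w (some i))) inferInstance fun w => by simp)

instance Tm.singleton (s : (β → W) → ZFSet.{u}) [hs : Tm s] :
    Tm (fun v => ({s v} : ZFSet.{u})) := by
  simpa using (inferInstance : Tm (fun v => ({s v, s v} : ZFSet.{u})))

instance Tm.pair (s t : (β → W) → ZFSet.{u}) [hs : Tm s] [ht : Tm t] :
    Tm (fun v => ZFSet.pair (s v) (t v)) :=
  (inferInstance : Tm (fun v => ({{s v}, {s v, t v}} : ZFSet.{u})))

instance Tm.sUnion (s : (β → W) → ZFSet.{u}) [hs : Tm s] :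
    Tm (fun v => (⋃₀ s v : ZFSet.{u})) :=
  have := hs.weaken (β := Option β) some
  Tm.of_mem (fun v => sUnion_mem (hs.mem v))
    (Dfn.congr (P := fun w => ∃ y ∈ s (fun i => w (some i)), (w none : ZFSet.{u}) ∈ y)
      inferInstance fun w => by simp)

instance Tm.union (s t : (β → W) → ZFSet.{u}) [hs : Tm s] [ht : Tm t] :
    Tm (fun v => s v ∪ t v) := by
  simpa using (inferInstance : Tm (fun v => (⋃₀ {s v, t v} : ZFSet.{u})))

instance Tm.insert (s t : (β → W) → ZFSet.{u}) [hs : Tm s] [ht : Tm t] :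
    Tm (fun v => (insert (s v) (t v) : ZFSet.{u})) := by
  simp only [ZFSet.insert_eq]
  infer_instance

instance Tm.sep [Finite β] (P : (β → W) → ZFSet.{u} → Prop)
    [h : Dfn (fun w : Option β → W => P (fun i => w (some i)) (w none))]
    (s : (β → W) → ZFSet.{u}) [hs : Tm s] :
    Tm (fun v => ZFSet.sep (P v) (s v)) :=
  have := hs.weaken (β := Option β) some
  Tm.of_mem (fun v => sep_mem v P (hs.mem v))
    (Dfn.congr (P := fun w => (w none : ZFSet.{u}) ∈ s (fun i => w (some i)) ∧
      P (fun i => w (some i)) (w none)) inferInstance fun w => by simp)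

instance Tm.inter [Finite β] (s t : (β → W) → ZFSet.{u}) [hs : Tm s] [ht : Tm t] :
    Tm (fun v => s v ∩ t v) :=
  have := ht.weaken (β := Option β) some
  (inferInstance : Tm (fun v => ZFSet.sep (fun x => x ∈ t v) (s v)))

instance Tm.sdiff [Finite β] (s t : (β → W) → ZFSet.{u}) [hs : Tm s] [ht : Tm t] :
    Tm (fun v => s v \ t v) :=
  have := ht.weaken (β := Option β) some
  (inferInstance : Tm (fun v => ZFSet.sep (fun x => ¬ x ∈ t v) (s v)))

/-- Replacement from collection: a collecting set contains all the values, and separation removes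
the rest. -/
theorem img_mem [Finite β] (v : β → W) (f : (β → W) → ZFSet.{u} → ZFSet.{u})
    [h : Tm (fun w : Option β → W => f (fun i => w (some i)) (w none))] {a : ZFSet.{u}}
    (ha : a ∈ W) : img (f v) a ∈ W := by
  have h1 : Dfn (fun w : Option (Option β) → W =>
      (w none : ZFSet.{u}) = f (fun i => w (some (some i))) (w (some none))) := h.graph
  obtain ⟨c, hc⟩ := hW.models.collection _ (h1.definable₂ v) ⟨a, ha⟩ (fun x _ =>
    ⟨⟨f v x, h.mem (fun o => o.elim x v)⟩, rfl⟩)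
  have : Fact (a ∈ W) := ⟨ha⟩
  have h2 : Dfn (fun w : Option (Option β) → W =>
      (w (some none) : ZFSet.{u}) = f (fun i => w (some (some i))) (w none)) :=
    h1.comp (fun o => o.elim (some none) (fun o => o.elim none (fun i => some (some i))))
  have h3 := sep_mem v (fun v y => ∃ x ∈ a, y = f v x) c.2
  convert h3 using 1
  ext y
  rw [mem_img, ZFSet.mem_sep, iff_and_self]
  rintro ⟨x, hx, rfl⟩
  obtain ⟨y, hy, h⟩ := hc ⟨x, IsTransModel.mem_of_mem hx ha⟩ hx
  have h : (y : ZFSet.{u}) = f v x := h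
  rwa [← h]

instance Tm.img [Finite β] (f : (β → W) → ZFSet.{u} → ZFSet.{u})
    [h : Tm (fun w : Option β → W => f (fun i => w (some i)) (w none))]
    (s : (β → W) → ZFSet.{u}) [hs : Tm s] : Tm (fun v => img (f v) (s v)) :=
  have := hs.weaken (β := Option β) some
  have : Dfn (fun w : Option (Option β) → W =>
      (w (some none) : ZFSet.{u}) = f (fun i => w (some (some i))) (w none)) :=
    h.graph.comp (fun o => o.elim (some none) (fun o => o.elim none (fun i => some (some i))))
  Tm.of_mem (fun v => img_mem v f (hs.mem v))
    (Dfn.congr (P := fun w => ∃ x ∈ s (fun i => w (some i)),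
      (w none : ZFSet.{u}) = f (fun i => w (some i)) x) inferInstance fun _ => mem_img)

instance Tm.lam [Finite β] (f : (β → W) → ZFSet.{u} → ZFSet.{u})
    [h : Tm (fun w : Option β → W => f (fun i => w (some i)) (w none))]
    (s : (β → W) → ZFSet.{u}) [hs : Tm s] : Tm (fun v => lam (f v) (s v)) :=
  (inferInstance : Tm (fun v => StrongRamsey.img (fun x => ZFSet.pair x (f v x)) (s v)))

instance Tm.prod [Finite β] (s t : (β → W) → ZFSet.{u}) [hs : Tm s] [ht : Tm t] :
    Tm (fun v => ZFSet.prod (s v) (t v)) := by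
  have := ht.weaken (β := Option β) some
  have e : (fun v => ZFSet.prod (s v) (t v)) = fun v =>
      (⋃₀ StrongRamsey.img (fun x => StrongRamsey.img (fun y => ZFSet.pair x y) (t v)) (s v) :
        ZFSet.{u}) := by
    funext v
    ext z
    simp only [ZFSet.mem_prod, ZFSet.mem_sUnion, mem_img]
    constructor
    · rintro ⟨x, hx, y, hy, rfl⟩
      exact ⟨_, ⟨x, hx, rfl⟩, mem_img.2 ⟨y, hy, rfl⟩⟩
    · rintro ⟨_, ⟨x, hx, rfl⟩, h⟩
      obtain ⟨y, hy, rfl⟩ := mem_img.1 h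
      exact ⟨x, hx, y, hy, rfl⟩
  rw [e]
  infer_instance

instance Tm.ev [Finite β] (s t : (β → W) → ZFSet.{u}) [hs : Tm s] [ht : Tm t] :
    Tm (fun v => ev (s v) (t v)) :=
  have := hs.weaken (β := Option β) some
  have := ht.weaken (β := Option β) some
  (inferInstance : Tm (fun v =>
    (⋃₀ ZFSet.sep (fun y => ZFSet.pair (t v) y ∈ s v) (⋃₀ ⋃₀ s v) : ZFSet.{u})))

instance Dfn.isFunc [Finite β] (r s t : (β → W) → ZFSet.{u}) [hr : Tm r] [hs : Tm s] [ht : Tm t] :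
    Dfn (fun v => ZFSet.IsFunc (r v) (s v) (t v)) := by
  have := hr.weaken (β := Option β) some
  have := hs.weaken (β := Option β) some
  have := ht.weaken (β := Option β) some
  have := hs.weaken (β := Option (Option β)) (fun i => some (some i))
  have := ht.weaken (β := Option (Option β)) (fun i => some (some i))
  have := hs.weaken (β := Option (Option (Option β))) (fun i => some (some (some i)))
  have := ht.weaken (β := Option (Option (Option β))) (fun i => some (some (some i)))
  simp only [isFunc_iff]
  infer_instance

end Operations


/-! ### `κ`-models -/

theorem card_img_le {f : ZFSet.{u} → ZFSet.{u}} {a : ZFSet.{u}} : (img f a).card ≤ a.card := by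
  have := ZFSet.lift_card_range_le (f := fun x : a => f x)
  rwa [ZFSet.cardinalMk_coe_sort, Cardinal.lift_lift, Cardinal.lift_umax.{u, u+1},
    Cardinal.lift_le] at this

theorem exists_eq_img_ord (x : ZFSet.{u}) :
    ∃ f : ZFSet.{u} → ZFSet.{u}, x = img f x.card.ord.toZFSet ∧
      ∀ y ∈ x.card.ord.toZFSet, f y ∈ x := by
  classical
  have h : Cardinal.mk x = Cardinal.mk x.card.ord.toZFSet := by
    rw [ZFSet.cardinalMk_coe_sort, ZFSet.cardinalMk_coe_sort, Ordinal.card_toZFSet,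
      Cardinal.card_ord]
  obtain ⟨e⟩ := Cardinal.eq.1 h
  let f : ZFSet.{u} → ZFSet.{u} := fun y => if hy : y ∈ x.card.ord.toZFSet then e.symm ⟨y, hy⟩ else ∅
  have hf : ∀ y : x.card.ord.toZFSet, f y = e.symm y := fun y => dif_pos y.2
  refine ⟨f, ?_, fun y hy => ?_⟩
  · ext z
    rw [mem_img]
    constructor
    · intro hz
      exact ⟨e ⟨z, hz⟩, (e ⟨z, hz⟩).2, by rw [hf, Equiv.symm_apply_apply]⟩
    · rintro ⟨y, hy, rfl⟩
      rw [hf ⟨y, hy⟩]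
      exact (e.symm ⟨y, hy⟩).2
  · rw [hf ⟨y, hy⟩]
    exact (e.symm ⟨y, hy⟩).2

theorem mem_ordSet {κ : Cardinal.{u}} {x : ZFSet.{u}} :
    x ∈ ordSet κ ↔ ∃ a < κ.ord, a.toZFSet = x := Ordinal.mem_toZFSet_iff

theorem toZFSet_mem_ordSet {κ : Cardinal.{u}} {a : Ordinal.{u}} :
    a.toZFSet ∈ ordSet κ ↔ a < κ.ord := Ordinal.toZFSet_mem_toZFSet_iff

theorem ordSet_transitive {κ : Cardinal.{u}} : (ordSet κ).IsTransitive :=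
  (ZFSet.isOrdinal_toZFSet _).isTransitive

theorem isOrdinal_of_mem_ordSet {κ : Cardinal.{u}} {x : ZFSet.{u}} (h : x ∈ ordSet κ) :
    x.IsOrdinal := (ZFSet.isOrdinal_toZFSet _).mem h

namespace IsModel

variable {κ : Cardinal.{u}} {W : ZFSet.{u}}

theorem isTransModel (h : IsModel κ W) : IsTransModel W := ⟨h.transitive, h.models⟩

theorem lam_mem (h : IsModel κ W) {δ : Ordinal.{u}} (hδ : δ < κ.ord) {f : ZFSet.{u} → ZFSet.{u}}
    (hf : ∀ x ∈ δ.toZFSet, f x ∈ W) : lam f δ.toZFSet ∈ W :=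
  h.closed δ hδ _ (isFunc_lam hf)

theorem toZFSet_mem (h : IsModel κ W) {δ : Ordinal.{u}} (hδ : δ < κ.ord) : δ.toZFSet ∈ W :=
  h.transitive _ h.mem (toZFSet_mem_ordSet.2 hδ)

/-- An enumeration of `x` by its cardinal is a sequence of length less than `κ`, so closure puts it
in `W`; its range follows. -/
theorem mem_of_card_lt (h : IsModel κ W) {x : ZFSet.{u}} (hx : x ⊆ W) (hc : x.card < κ) :
    x ∈ W := by
  have := h.isTransModel
  obtain ⟨f, hf, hm⟩ := exists_eq_img_ord x
  have hδ : x.card.ord < κ.ord := Cardinal.ord_lt_ord.2 hc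
  have h1 : Fact (lam f x.card.ord.toZFSet ∈ W) := ⟨h.lam_mem hδ fun y hy => hx (hm y hy)⟩
  have h2 : Fact (x.card.ord.toZFSet ∈ W) := ⟨h.toZFSet_mem hδ⟩
  have h3 : img (ev (lam f x.card.ord.toZFSet)) x.card.ord.toZFSet ∈ W := mem_of_tm _
  have h4 : img (ev (lam f x.card.ord.toZFSet)) x.card.ord.toZFSet = x := by
    conv_rhs => rw [hf]
    ext z
    simp only [mem_img]
    exact exists_congr fun y => and_congr_right fun hy => by rw [ev_lam hy]
  rwa [h4] at h3

theorem lam_mem_of_card_lt (h : IsModel κ W) {x : ZFSet.{u}} (hx : x ⊆ W) (hc : x.card < κ)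
    {f : ZFSet.{u} → ZFSet.{u}} (hf : ∀ y ∈ x, f y ∈ W) : lam f x ∈ W := by
  have := h.isTransModel
  refine h.mem_of_card_lt (fun z hz => ?_) (card_img_le.trans_lt hc)
  obtain ⟨y, hy, rfl⟩ := mem_lam.1 hz
  have : Fact (y ∈ W) := ⟨hx hy⟩
  have : Fact (f y ∈ W) := ⟨hf y hy⟩
  exact mem_of_tm _

/-- By transitivity the successor of `κ` is a subset of `W`, which has only `κ` elements; for finite
`κ` it would have one element too many. -/
theorem aleph0_le (h : IsModel κ W) : Cardinal.aleph0 ≤ κ := by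
  have h1 : insert (ordSet κ) (ordSet κ) ⊆ W := by
    intro x hx
    rcases ZFSet.mem_insert_iff.1 hx with rfl | hx
    · exact h.mem
    · exact h.transitive _ h.mem hx
  have h2 := ZFSet.card_mono h1
  rw [ZFSet.card_insert (ZFSet.mem_irrefl _), h.card_eq, Ordinal.card_toZFSet,
    Cardinal.card_ord] at h2
  by_contra hlt
  obtain ⟨n, rfl⟩ := Cardinal.lt_aleph0.1 (not_le.1 hlt)
  exact absurd h2 (by exact_mod_cast (Nat.lt_succ_self n).not_ge)

theorem isSuccLimit (h : IsModel κ W) : Order.IsSuccLimit κ.ord :=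
  Cardinal.isSuccLimit_ord h.aleph0_le

theorem insert_mem_ordSet (h : IsModel κ W) {x : ZFSet.{u}} (hx : x ∈ ordSet κ) :
    insert x x ∈ ordSet κ := by
  obtain ⟨a, ha, rfl⟩ := mem_ordSet.1 hx
  rw [← Ordinal.toZFSet_add_one]
  exact toZFSet_mem_ordSet.2 (h.isSuccLimit.add_one_lt ha)

end IsModel

/-! ### The quantifier "for almost all `ξ < κ`" -/

/-- The property `P` holds for almost all `ξ < κ`, with respect to `U`. -/
def AE (κ : Cardinal.{u}) (U : ZFSet.{u}) (P : ZFSet.{u} → Prop) : Prop :=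
  ZFSet.sep P (ordSet κ) ∈ U

namespace IsMUltrafilter

variable {κ : Cardinal.{u}} {W U : ZFSet.{u}}

theorem ae_of_forall (hU : IsMUltrafilter κ W U) {P : ZFSet.{u} → Prop}
    (h : ∀ ξ ∈ ordSet κ, P ξ) : AE κ U P := by
  have : ZFSet.sep P (ordSet κ) = ordSet κ := by
    ext ξ
    rw [ZFSet.mem_sep]
    exact ⟨fun h => h.1, fun hξ => ⟨hξ, h ξ hξ⟩⟩
  rw [AE, this]
  exact hU.univ_mem

theorem ae_congr {P Q : ZFSet.{u} → Prop} (h : ∀ ξ ∈ ordSet κ, (P ξ ↔ Q ξ)) :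
    AE κ U P ↔ AE κ U Q := by
  have : ZFSet.sep P (ordSet κ) = ZFSet.sep Q (ordSet κ) := by
    ext ξ
    simp only [ZFSet.mem_sep]
    exact and_congr_right fun hξ => h ξ hξ
  rw [AE, AE, this]

theorem ae_and (hU : IsMUltrafilter κ W U) {P Q : ZFSet.{u} → Prop} (hP : AE κ U P)
    (hQ : AE κ U Q) : AE κ U (fun ξ => P ξ ∧ Q ξ) := by
  have h := hU.inter _ hP _ hQ
  have : ZFSet.sep P (ordSet κ) ∩ ZFSet.sep Q (ordSet κ) =
      ZFSet.sep (fun ξ => P ξ ∧ Q ξ) (ordSet κ) := by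
    ext ξ
    simp only [ZFSet.mem_inter, ZFSet.mem_sep]
    tauto
  rwa [this] at h

theorem ae_exists (hU : IsMUltrafilter κ W U) {P : ZFSet.{u} → Prop} (hP : AE κ U P) :
    ∃ ξ ∈ ordSet κ, P ξ := by
  by_contra hne
  push Not at hne
  refine hU.empty_notMem ?_
  have : ZFSet.sep P (ordSet κ) = ∅ := by
    rw [ZFSet.eq_empty]
    intro ξ hξ
    exact hne ξ (ZFSet.mem_sep.1 hξ).1 (ZFSet.mem_sep.1 hξ).2
  rw [← this]
  exact hP

variable [hW : IsTransModel W] [hκW : Fact (ordSet κ ∈ W)]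

theorem ae_mono (hU : IsMUltrafilter κ W U) {P : ZFSet.{u} → Prop} (hP : AE κ U P)
    (Q : ZFSet.{u} → Prop) [hQ : Dfn (fun w : Option Empty → W => Q (w none))]
    (h : ∀ ξ ∈ ordSet κ, P ξ → Q ξ) : AE κ U Q := by
  refine hU.superset _ hP _ (mem_of_tm _) (fun ξ hξ => ?_) ZFSet.sep_subset
  rw [ZFSet.mem_sep] at hξ ⊢
  exact ⟨hξ.1, h ξ hξ.1 hξ.2⟩

theorem ae_mono₂ (hU : IsMUltrafilter κ W U) {P Q : ZFSet.{u} → Prop} (hP : AE κ U P)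
    (hQ : AE κ U Q) (R : ZFSet.{u} → Prop) [hR : Dfn (fun w : Option Empty → W => R (w none))]
    (h : ∀ ξ ∈ ordSet κ, P ξ → Q ξ → R ξ) : AE κ U R :=
  hU.ae_mono (hU.ae_and hP hQ) R fun ξ hξ hh => h ξ hξ hh.1 hh.2

theorem ae_or_not (hU : IsMUltrafilter κ W U) (P : ZFSet.{u} → Prop)
    [hP : Dfn (fun w : Option Empty → W => P (w none))] : AE κ U P ∨ AE κ U (fun ξ => ¬ P ξ) := by
  refine (hU.ultra (ZFSet.sep P (ordSet κ)) (mem_of_tm _) ZFSet.sep_subset).imp id fun h => ?_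
  have : ordSet κ \ ZFSet.sep P (ordSet κ) = ZFSet.sep (fun ξ => ¬ P ξ) (ordSet κ) := by
    ext ξ
    simp only [ZFSet.mem_sdiff, ZFSet.mem_sep]
    tauto
  rwa [this] at h

theorem ae_not (hU : IsMUltrafilter κ W U) (P : ZFSet.{u} → Prop)
    [hP : Dfn (fun w : Option Empty → W => P (w none))] :
    AE κ U (fun ξ => ¬ P ξ) ↔ ¬ AE κ U P := by
  constructor
  · intro h1 h2
    obtain ⟨ξ, -, h3, h4⟩ := hU.ae_exists (hU.ae_and h1 h2)
    exact h3 h4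
  · intro h
    exact (hU.ae_or_not P).resolve_left h

/-- Normality: a regressive choice is constant on a large set. -/
theorem ae_regressive (hU : IsMUltrafilter κ W U) (P : ZFSet.{u} → ZFSet.{u} → Prop)
    [hP : Dfn (fun w : Option (Option Empty) → W => P (w none) (w (some none)))]
    (h : AE κ U (fun ξ => ∃ i ∈ ξ, P ξ i)) : ∃ i ∈ ordSet κ, AE κ U (fun ξ => P ξ i) := by
  by_contra hne
  push Not at hne
  -- If no index works, the complements form a sequence in `W` of sets in `U`. A point of its
  -- diagonal intersection has no witness below itself, but almost every point has one.
  have h1 : ∀ i ∈ ordSet κ, ZFSet.sep (fun ξ => ¬ P ξ i) (ordSet κ) ∈ U := by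
    intro i hi
    have : Fact (i ∈ W) := ⟨hW.transitive _ hκW.out hi⟩
    have : Dfn (fun w : Option Empty → W => P (w none) i) :=
      hP.subst (fun o w => (o.elim (w none : ZFSet.{u}) fun _ => i))
        (ht := by rintro (_ | o) <;> simp only [Option.elim] <;> infer_instance)
    exact (hU.ae_not (fun ξ => P ξ i)).2 (hne i hi)
  have h2 : lam (fun i => ZFSet.sep (fun ξ => ¬ P ξ i) (ordSet κ)) (ordSet κ) ∈ W := mem_of_tm _
  have h3 := hU.normal _ h2 (isFunc_lam h1)
  obtain ⟨ξ, hξ, h4, i, hi, h5⟩ := hU.ae_exists (hU.ae_and h3 h)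
  exact (ZFSet.mem_sep.1 (h4 i hi _ (pair_mem_lam.2 ⟨ordSet_transitive _ hξ hi, rfl⟩))).2 h5

theorem ae_mem (hU : IsMUltrafilter κ W U) (h : IsModel κ W) {i : ZFSet.{u}} (hi : i ∈ ordSet κ) :
    AE κ U (fun ξ => i ∈ ξ) := by
  have : Fact (i ∈ W) := ⟨hW.transitive _ hκW.out hi⟩
  have h1 : AE κ U (fun ξ => ξ ∉ insert i i) := hU.tail _ (h.insert_mem_ordSet hi)
  refine hU.ae_mono h1 _ fun ξ hξ hn => ?_
  rw [ZFSet.mem_insert_iff, not_or] at hn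
  rcases (isOrdinal_of_mem_ordSet hξ).mem_trichotomous (isOrdinal_of_mem_ordSet hi) with h | h | h
  · exact absurd h hn.2
  · exact absurd h hn.1
  · exact h

/-- Completeness: a choice among fewer than `κ` possibilities is constant on a large set. -/
theorem ae_choice_lt (hU : IsMUltrafilter κ W U) (h : IsModel κ W)
    (P : ZFSet.{u} → ZFSet.{u} → Prop)
    [hP : Dfn (fun w : Option (Option Empty) → W => P (w none) (w (some none)))]
    {δ : ZFSet.{u}} (hδ : δ ∈ ordSet κ)
    (hA : AE κ U (fun ξ => ∃ i ∈ δ, P ξ i)) : ∃ i ∈ δ, AE κ U (fun ξ => P ξ i) := by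
  have : Fact (δ ∈ W) := ⟨hW.transitive _ hκW.out hδ⟩
  have := hP.swap
  -- Almost every `ξ` lies above `δ`, so a choice of an element of `δ` is regressive.
  obtain ⟨i, hi, h1⟩ := hU.ae_regressive (fun ξ i => i ∈ δ ∧ P ξ i)
    (hU.ae_mono₂ (hU.ae_mem h hδ) hA _ (fun ξ hξ h1 ⟨i, hi, h2⟩ =>
      ⟨i, (isOrdinal_of_mem_ordSet hξ).mem_trans hi h1, hi, h2⟩))
  obtain ⟨_, _, hi, _⟩ := hU.ae_exists h1
  have : Fact (i ∈ W) := ⟨hW.transitive _ (hW.transitive _ hκW.out hδ) hi⟩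
  have : Dfn (fun w : Option Empty → W => P (w none) i) :=
    hP.subst (fun o w => (o.elim (w none : ZFSet.{u}) fun _ => i))
      (ht := by rintro (_ | o) <;> simp only [Option.elim] <;> infer_instance)
  exact ⟨i, hi, hU.ae_mono h1 _ fun ξ _ h => h.2⟩

theorem ae_forall_lt (hU : IsMUltrafilter κ W U) (h : IsModel κ W)
    (P : ZFSet.{u} → ZFSet.{u} → Prop)
    [hP : Dfn (fun w : Option (Option Empty) → W => P (w none) (w (some none)))]
    {δ : ZFSet.{u}} (hδ : δ ∈ ordSet κ)
    (hA : ∀ i ∈ δ, AE κ U (fun ξ => P ξ i)) : AE κ U (fun ξ => ∀ i ∈ δ, P ξ i) := by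
  have : Fact (δ ∈ W) := ⟨hW.transitive _ hκW.out hδ⟩
  have := hP.swap
  by_contra hne
  have h1 := (hU.ae_not (fun ξ => ∀ i ∈ δ, P ξ i)).2 hne
  obtain ⟨i, hi, h2⟩ := hU.ae_choice_lt h (fun ξ i => ¬ P ξ i) hδ
    (hU.ae_mono h1 _ (fun ξ _ h => by push Not at h; exact h))
  obtain ⟨ξ, _, h3, h4⟩ := hU.ae_exists (hU.ae_and h2 (hA i hi))
  exact h3 h4

end IsMUltrafilter


/-! ### Recursion in transitive models -/

/-- `y` is the value at `x` of the function defined by recursion from `F`, where `pr u` is the set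
of predecessors of `u`, as computed in `W`. -/
def RecRel (W : ZFSet.{u}) (pr : ZFSet.{u} → ZFSet.{u}) (F : ZFSet.{u} → ZFSet.{u} → ZFSet.{u})
    (x y : ZFSet.{u}) : Prop :=
  ∃ s ∈ W, ∃ t ∈ W, (∀ u ∈ t, pr u ⊆ t ∧ ev s u = F u s) ∧ x ∈ t ∧ ev s x = y

section RecRel

variable {W : ZFSet.{u}} {pr : ZFSet.{u} → ZFSet.{u}} {F : ZFSet.{u} → ZFSet.{u} → ZFSet.{u}}
  {Φ : ZFSet.{u} → ZFSet.{u}} {x y : ZFSet.{u}}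

/-- Any approximation agrees with `Φ` by induction along `pr`. The class `D`, closed under
predecessors, confines the induction to points where the recursion clause is known to compute `Φ`.
-/
theorem RecRel.eq (h : RecRel W pr F x y) (wf : WellFounded (fun v u => v ∈ pr u))
    (D : ZFSet.{u} → Prop) (hD : ∀ u v, D u → v ∈ pr u → D v) (hx : D x)
    (hF : ∀ u s, D u → (∀ v ∈ pr u, ev s v = Φ v) → F u s = Φ u) : y = Φ x := by
  obtain ⟨s, _, t, _, h1, hxt, rfl⟩ := h
  have : ∀ u, D u → u ∈ t → ev s u = Φ u := by
    intro u
    induction u using wf.induction with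
    | _ u ih =>
      intro hDu hu
      rw [(h1 u hu).2]
      exact hF u s hDu fun v hv => ih v hv (hD u v hDu hv) ((h1 u hu).1 hv)
  exact this x hx hxt

/-- The restriction of `Φ` to a set closed under predecessors is itself an approximation. In a
`κ`-model it lies in `W` as soon as that set has fewer than `κ` elements and the values lie in `W`.
-/
theorem RecRel.intro {t : ZFSet.{u}} (ht : t ∈ W) (hs : lam Φ t ∈ W) (hx : x ∈ t)
    (hp : ∀ u ∈ t, pr u ⊆ t)
    (hF : ∀ u ∈ t, ∀ s, (∀ v ∈ pr u, ev s v = Φ v) → F u s = Φ u) : RecRel W pr F x (Φ x) := by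
  refine ⟨_, hs, t, ht, fun u hu => ⟨hp u hu, ?_⟩, hx, ev_lam hx⟩
  rw [ev_lam hu, hF u hu]
  exact fun v hv => ev_lam (hp u hu hv)

end RecRel

/-! ### The cardinal `κ` is inaccessible -/

namespace IsMUltrafilter

variable {κ : Cardinal.{u}} {W U : ZFSet.{u}} [hW : IsTransModel W] [hκW : Fact (ordSet κ ∈ W)]

/-- Were `x` unbounded, each `ξ` would omit an element of `x`. By completeness one and the same
element would be omitted by almost all `ξ`, but almost all `ξ` lie above it. -/
theorem bounded_of_card_lt (hU : IsMUltrafilter κ W U) (h : IsModel κ W) {x : ZFSet.{u}}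
    (hx : x ⊆ ordSet κ) (hc : x.card < κ) : ∃ ξ ∈ ordSet κ, ∀ i ∈ x, i ∈ ξ := by
  by_contra hne
  push Not at hne
  obtain ⟨f, hf, hm⟩ := exists_eq_img_ord x
  have hδ : x.card.ord < κ.ord := Cardinal.ord_lt_ord.2 hc
  have h1 : Fact (lam f x.card.ord.toZFSet ∈ W) :=
    ⟨h.lam_mem hδ fun y hy => hW.transitive _ hκW.out (hx (hm y hy))⟩
  obtain ⟨i, hi, h2⟩ := hU.ae_choice_lt h (fun ξ i => ev (lam f x.card.ord.toZFSet) i ∉ ξ)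
    (toZFSet_mem_ordSet.2 hδ) (hU.ae_of_forall fun ξ hξ => by
      obtain ⟨y, hy, hn⟩ := hne ξ hξ
      rw [hf] at hy
      obtain ⟨i, hi, rfl⟩ := mem_img.1 hy
      exact ⟨i, hi, by rwa [ev_lam hi]⟩)
  simp only [ev_lam hi] at h2
  obtain ⟨ξ, _, h3, h4⟩ := hU.ae_exists (hU.ae_and h2 (hU.ae_mem h (hx (hm i hi))))
  exact h3 h4

theorem isRegular (hU : IsMUltrafilter κ W U) (h : IsModel κ W) : κ.IsRegular := by
  refine ⟨h.aleph0_le, ?_⟩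
  by_contra hlt
  rw [not_le] at hlt
  obtain ⟨s, hs, hc⟩ := Order.exists_cof_eq (α := Set.Iio κ.ord)
  rw [Ordinal.cof_Iio, ← Ordinal.lift_cof] at hc
  have h1 : ZFSet.range (fun i : s => i.1.1.toZFSet) ⊆ ordSet κ := by
    intro z hz
    obtain ⟨i, rfl⟩ := ZFSet.mem_range.1 hz
    exact toZFSet_mem_ordSet.2 i.1.2
  have h2 := ZFSet.lift_card_range_le (f := fun i : s => i.1.1.toZFSet)
  rw [hc, Cardinal.lift_lift, Cardinal.lift_umax.{u, u+1}, Cardinal.lift_le] at h2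
  obtain ⟨ξ, hξ, h3⟩ := hU.bounded_of_card_lt h h1 (h2.trans_lt hlt)
  obtain ⟨a, ha, rfl⟩ := mem_ordSet.1 hξ
  obtain ⟨b, hb, hab⟩ := hs ⟨a, ha⟩
  have h4 := h3 _ (ZFSet.mem_range_self (⟨b, hb⟩ : s))
  exact (Ordinal.toZFSet_mem_toZFSet_iff.1 h4).not_ge hab

/-- If `κ` were `ω`, the predecessor function would be regressive on nonzero ordinals and so
constant on a set in `U`, although sets in `U` are unbounded. -/
theorem aleph0_lt (hU : IsMUltrafilter κ W U) (h : IsModel κ W) : Cardinal.aleph0 < κ := by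
  refine h.aleph0_le.lt_of_ne fun he => ?_
  have h0 : ∅ ∈ ordSet κ := by
    rw [← Ordinal.toZFSet_zero]
    exact toZFSet_mem_ordSet.2 h.isSuccLimit.bot_lt
  obtain ⟨i, hi, h1⟩ := hU.ae_regressive (fun ξ i => ∀ z ∈ ξ, z ∈ i ∨ z = i)
    (hU.ae_mono (hU.ae_mem h h0) _ fun ξ hξ h1 => by
      obtain ⟨a, ha, rfl⟩ := mem_ordSet.1 hξ
      rw [← he, Cardinal.ord_aleph0] at ha
      obtain ⟨n, rfl⟩ := Ordinal.lt_omega0.1 ha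
      rcases n with _ | n
      · simp at h1
      · refine ⟨(n : Ordinal).toZFSet, Ordinal.toZFSet_mem_toZFSet_iff.2 (by simp), fun z hz => ?_⟩
        rw [Nat.cast_add_one, Ordinal.toZFSet_add_one, ZFSet.mem_insert_iff] at hz
        exact hz.symm)
  obtain ⟨ξ, _, h2, h3⟩ := hU.ae_exists (hU.ae_and h1 (hU.ae_mem h (h.insert_mem_ordSet hi)))
  have h4 : i ∈ (insert i i : ZFSet.{u}) := ZFSet.mem_insert _ _
  rcases h2 _ h3 with h5 | h5
  · exact ZFSet.mem_asymm h4 h5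
  · rw [h5] at h4
    exact ZFSet.mem_irrefl _ h4

end IsMUltrafilter

/-! ### Ordinal addition in `κ`-models -/

/-- `z` is the ordinal sum of `x` and `y`, as computed in `W`. -/
def AddRel (W x y z : ZFSet.{u}) : Prop :=
  RecRel W (fun u => u) (fun u s => x ∪ img (ev s) u) y z

theorem toZFSet_add (a b : Ordinal.{u}) :
    (a + b).toZFSet = a.toZFSet ∪ img (fun y => (a + y.rank).toZFSet) b.toZFSet := by
  ext z
  simp only [ZFSet.mem_union, mem_img, Ordinal.mem_toZFSet_iff]
  constructor
  · rintro ⟨c, hc, rfl⟩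
    rcases lt_or_ge c a with hca | hca
    · exact Or.inl ⟨c, hca, rfl⟩
    · refine Or.inr ⟨(c - a).toZFSet, ⟨c - a, ?_, rfl⟩, ?_⟩
      · rw [Ordinal.sub_lt_of_le hca]
        exact hc
      · rw [Ordinal.rank_toZFSet, Ordinal.add_sub_cancel_of_le hca]
  · rintro (⟨c, hc, rfl⟩ | ⟨_, ⟨c, hc, rfl⟩, rfl⟩)
    · exact ⟨c, hc.trans_le le_self_add, rfl⟩
    · exact ⟨a + c, by simpa using hc, by simp⟩

theorem IsModel.addRel_iff {κ : Cardinal.{u}} {W : ZFSet.{u}} (h : IsModel κ W)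
    {a b : Ordinal.{u}} (ha : a < κ.ord) (hb : b < κ.ord) {z : ZFSet.{u}} :
    AddRel W a.toZFSet b.toZFSet z ↔ z = (a + b).toZFSet := by
  have hb' := h.isSuccLimit.add_one_lt hb
  have hop := Ordinal.isPrincipal_add_ord h.aleph0_le
  have hF : ∀ u ∈ ordSet κ, ∀ s, (∀ v ∈ u, ev s v = (a + v.rank).toZFSet) →
      a.toZFSet ∪ img (ev s) u = (a + u.rank).toZFSet := by
    intro u hu s hs
    obtain ⟨c, hc, rfl⟩ := mem_ordSet.1 hu
    simp only [Ordinal.rank_toZFSet, toZFSet_add a c]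
    congr 1
    ext y
    simp only [mem_img]
    exact exists_congr fun v => and_congr_right fun hv => by rw [hs v hv]
  constructor
  · intro hz
    have := hz.eq (Φ := fun u => (a + u.rank).toZFSet) ZFSet.mem_wf (fun u => u ∈ ordSet κ)
      (fun u v hu hv => ordSet_transitive _ hu hv) (toZFSet_mem_ordSet.2 hb)
      (fun u s hu hs => hF u hu s hs)
    rwa [Ordinal.rank_toZFSet] at this
  · rintro rfl
    have := RecRel.intro (W := W) (pr := fun u => u) (F := fun u s => a.toZFSet ∪ img (ev s) u)
      (Φ := fun u => (a + u.rank).toZFSet) (x := b.toZFSet)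
      (h.toZFSet_mem hb') (h.lam_mem hb' fun x hx => ?_) ?_ (fun u hu =>
        (ZFSet.isOrdinal_toZFSet _).isTransitive _ hu) (fun u hu s hs =>
        hF u ((ZFSet.isOrdinal_toZFSet _).mem_trans hu (toZFSet_mem_ordSet.2 hb')) s hs)
    · simp only [Ordinal.rank_toZFSet] at this
      exact this
    · obtain ⟨c, hc, rfl⟩ := Ordinal.mem_toZFSet_iff.1 hx
      simp only [Ordinal.rank_toZFSet]
      exact h.toZFSet_mem (hop ha (hc.trans hb'))
    · rw [Ordinal.toZFSet_add_one]
      exact ZFSet.mem_insert _ _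

/-- Suppose λ < κ ≤ 2^λ with λ infinite, and code κ distinct subsets of λ into one A ⊆ κ, the q-th
of them on the block [λq, λq + λ). In a model containing A, completeness makes the pattern of A on
the window [ξ, ξ + λ + λ) the same set for almost all ξ. The window contains the whole block
following the one of ξ, so such a ξ is determined by its remainder modulo λ. Thus a set of at most λ
ordinals belongs to the ultrafilter, which is absurd. -/
theorem IsStronglyRamsey.isStrongLimit {κ : Cardinal.{u}} (hκ : IsStronglyRamsey κ) :
    κ.IsStrongLimit := by
  classical
  have hinf : Cardinal.aleph0 ≤ κ := by
    obtain ⟨M, _, hM, _⟩ := hκ ∅ (ZFSet.empty_subset _)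
    exact hM.aleph0_le
  refine ⟨(Cardinal.aleph0_pos.trans_le hinf).ne', fun l hl => ?_⟩
  by_contra hle
  rw [not_lt] at hle
  have hl0 : Cardinal.aleph0 ≤ l := by
    by_contra hlt
    exact hle.not_gt ((Cardinal.power_lt_aleph0 (Cardinal.natCast_lt_aleph0 (n := 2)) (not_le.1 hlt)).trans_le
      hinf)
  -- an injection of the ordinals below `κ` into the sets of ordinals below `l`
  have hcard : Cardinal.mk (Set.Iio κ.ord) ≤ Cardinal.mk (Set (Set.Iio l.ord)) := by
    rw [Cardinal.mk_set, Cardinal.mk_Iio_ordinal, Cardinal.mk_Iio_ordinal, Cardinal.card_ord,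
      Cardinal.card_ord, ← Cardinal.lift_two.{u+1, u}, ← Cardinal.lift_power, Cardinal.lift_le]
    exact hle
  obtain ⟨e⟩ := hcard
  let E : Ordinal.{u} → Ordinal.{u} → Prop := fun q i =>
    ∃ (hq : q < κ.ord) (hi : i < l.ord), ⟨i, hi⟩ ∈ e ⟨q, hq⟩
  have hE : ∀ q q', q < κ.ord → q' < κ.ord → (∀ i < l.ord, E q i ↔ E q' i) → q = q' := by
    intro q q' hq hq' h
    have : e ⟨q, hq⟩ = e ⟨q', hq'⟩ := by
      ext ⟨i, hi⟩
      have := h i hi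
      constructor
      · intro hm
        obtain ⟨_, _, hm⟩ := this.1 ⟨hq, hi, hm⟩
        exact hm
      · intro hm
        obtain ⟨_, _, hm⟩ := this.2 ⟨hq', hi, hm⟩
        exact hm
    exact congrArg Subtype.val (e.injective this)
  obtain ⟨M, hA, hM, U, hU, -⟩ := hκ
    (ZFSet.sep (fun x => E (x.rank / l.ord) (x.rank % l.ord)) (ordSet κ)) ZFSet.sep_subset
  set A := ZFSet.sep (fun x => E (x.rank / l.ord) (x.rank % l.ord)) (ordSet κ) with hAdef
  have := hM.isTransModel
  have : Fact (A ∈ M) := ⟨hA⟩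
  have : Fact (ordSet κ ∈ M) := ⟨hM.mem⟩
  have hop := Ordinal.isPrincipal_add_ord hM.aleph0_le
  have hlo : l.ord < κ.ord := Cardinal.ord_lt_ord.2 hl
  have hlpos : l.ord ≠ 0 := (Cardinal.ord_pos.2 (Cardinal.aleph0_pos.trans_le hl0)).ne'
  have hl2 : l.ord + l.ord < κ.ord := hop hlo hlo
  let D : ZFSet.{u} → ZFSet.{u} → Prop := fun ξ i => ∃ z ∈ A, AddRel M ξ i z
  have hD : ∀ a i, a < κ.ord → i < κ.ord → (D a.toZFSet i.toZFSet ↔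
      E ((a + i) / l.ord) ((a + i) % l.ord)) := by
    intro a i ha hi
    simp only [D, hM.addRel_iff ha hi, exists_eq_right, hAdef, ZFSet.mem_sep, Ordinal.rank_toZFSet]
    exact and_iff_right (toZFSet_mem_ordSet.2 (hop ha hi))
  -- `S` is the common pattern. Its definition mentions `U`, but it lies in `M` because it has fewer
  -- than `κ` elements; weak amenability is not needed.
  let S : ZFSet.{u} := ZFSet.sep (fun i => AE κ U (fun ξ => D ξ i)) (l.ord + l.ord).toZFSet
  have hS : S ∈ M := by
    refine hM.mem_of_card_lt (fun x hx => hM.transitive _ (hM.toZFSet_mem hl2)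
      (ZFSet.mem_sep.1 hx).1) ((ZFSet.card_mono ZFSet.sep_subset).trans_lt ?_)
    rw [Ordinal.card_toZFSet]
    exact Cardinal.lt_ord.1 hl2
  have : Fact (S ∈ M) := ⟨hS⟩
  have : Fact ((l.ord + l.ord).toZFSet ∈ M) := ⟨hM.toZFSet_mem hl2⟩
  have hDdfn : Dfn (fun w : Option (Option Empty) → M => D (w none) (w (some none))) := by
    simp only [D, AddRel, RecRel]
    infer_instance
  have hB : AE κ U (fun ξ => ∀ i ∈ (l.ord + l.ord).toZFSet, D ξ i ↔ i ∈ S) := by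
    refine hU.ae_forall_lt hM (fun ξ i => D ξ i ↔ i ∈ S) (toZFSet_mem_ordSet.2 hl2) fun i hi => ?_
    have : Fact (i ∈ M) := ⟨hM.transitive _ (hM.toZFSet_mem hl2) hi⟩
    have : Dfn (fun w : Option Empty → M => D (w none) i) := by
      simp only [D, AddRel, RecRel]
      infer_instance
    rcases hU.ae_or_not (fun ξ => D ξ i) with h | h
    · have hiS : i ∈ S := ZFSet.mem_sep.2 ⟨hi, h⟩
      exact hU.ae_mono h _ fun ξ _ hd => iff_of_true hd hiS
    · have hiS : i ∉ S := fun h' => (hU.ae_not (fun ξ => D ξ i)).1 h (ZFSet.mem_sep.1 h').2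
      exact hU.ae_mono h _ fun ξ _ hd => iff_of_false hd hiS
  -- elements of this set are determined by their remainders
  have hinj : ∀ a b, a < κ.ord → b < κ.ord → a % l.ord = b % l.ord →
      (∀ i ∈ (l.ord + l.ord).toZFSet, D a.toZFSet i ↔ i ∈ S) →
      (∀ i ∈ (l.ord + l.ord).toZFSet, D b.toZFSet i ↔ i ∈ S) → a = b := by
    intro a b ha hb hab h1 h2
    -- `j` is the distance from `a` to the start of the next block. It can be as large as `l.ord`,
    -- which is why the window has length `l.ord + l.ord`.
    obtain ⟨j, hj, hij⟩ : ∃ j ≤ l.ord, ∀ q i, l.ord * q + a % l.ord + (j + i) =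
        l.ord * (q + 1) + i := by
      refine ⟨l.ord - a % l.ord, Ordinal.sub_le_self _ _, fun q i => ?_⟩
      rw [mul_add, mul_one, ← add_assoc, add_assoc (l.ord * q) (a % l.ord),
        Ordinal.add_sub_cancel_of_le (Ordinal.mod_lt a hlpos).le]
    have key : ∀ c, c < κ.ord → c % l.ord = a % l.ord → ∀ i < l.ord,
        (D c.toZFSet (j + i).toZFSet ↔ E (c / l.ord + 1) i) := by
      intro c hc hca i hi
      have hji : j + i < κ.ord := (add_lt_add_of_le_of_lt hj hi).trans hl2
      have hc' : c + (j + i) = l.ord * (c / l.ord + 1) + i := by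
        rw [← hij, ← hca, Ordinal.div_add_mod]
      rw [hD c _ hc hji, hc', Ordinal.mul_add_div _ hlpos, Ordinal.div_eq_zero_of_lt hi, add_zero,
        Ordinal.mul_add_mod_self, Ordinal.mod_eq_of_lt hi]
    have hlt : ∀ c, c < κ.ord → c / l.ord + 1 < κ.ord := fun c hc =>
      hM.isSuccLimit.add_one_lt ((Ordinal.div_le_of_le_mul (le_mul_of_one_le_left zero_le
        (Order.one_le_iff_ne_zero.2 hlpos))).trans_lt hc)
    have hq : a / l.ord + 1 = b / l.ord + 1 := by
      refine hE _ _ (hlt a ha) (hlt b hb) fun i hi => ?_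
      have hm : (j + i).toZFSet ∈ (l.ord + l.ord).toZFSet :=
        Ordinal.toZFSet_mem_toZFSet_iff.2 (add_lt_add_of_le_of_lt hj hi)
      rw [← key a ha rfl i hi, ← key b hb hab.symm i hi, h1 _ hm, h2 _ hm]
    have hq' : a / l.ord = b / l.ord := by simpa using hq
    rw [← Ordinal.div_add_mod a l.ord, ← Ordinal.div_add_mod b l.ord, hab, hq']
  have hBc : (ZFSet.sep (fun ξ => ∀ i ∈ (l.ord + l.ord).toZFSet, D ξ i ↔ i ∈ S) (ordSet κ)).card <
      κ := by
    refine lt_of_le_of_lt ?_ hl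
    rw [← Cardinal.lift_le.{u+1}, ← ZFSet.cardinalMk_coe_sort]
    have h3 : Cardinal.mk (Set.Iio l.ord) = Cardinal.lift.{u+1} l := by
      rw [Cardinal.mk_Iio_ordinal, Cardinal.card_ord]
    rw [← h3]
    refine Cardinal.mk_le_of_injective (f := fun x => ⟨x.1.rank % l.ord, Ordinal.mod_lt _ hlpos⟩) ?_
    rintro ⟨x, hx⟩ ⟨y, hy⟩ hxy
    obtain ⟨hx, h1⟩ := ZFSet.mem_sep.1 hx
    obtain ⟨hy, h2⟩ := ZFSet.mem_sep.1 hy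
    obtain ⟨a, ha, rfl⟩ := mem_ordSet.1 hx
    obtain ⟨b, hb, rfl⟩ := mem_ordSet.1 hy
    simp only [Ordinal.rank_toZFSet, Subtype.mk.injEq] at hxy
    simp only [hinj a b ha hb hxy h1 h2]
  obtain ⟨ξ, hξ, hbd⟩ := hU.bounded_of_card_lt hM ZFSet.sep_subset hBc
  obtain ⟨ζ, hζ, h1, h2⟩ := hU.ae_exists (hU.ae_and hB (hU.ae_mem hM hξ))
  exact ZFSet.mem_asymm h2 (hbd ζ (ZFSet.mem_sep.2 ⟨hζ, h1⟩))

theorem IsStronglyRamsey.isInaccessible {κ : Cardinal.{u}} (hκ : IsStronglyRamsey κ) :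
    κ.IsInaccessible := by
  obtain ⟨M, _, hM, U, hU, -⟩ := hκ ∅ (ZFSet.empty_subset _)
  have := hM.isTransModel
  have : Fact (ordSet κ ∈ M) := ⟨hM.mem⟩
  exact Cardinal.isInaccessible_def.2 ⟨hU.aleph0_lt hM, hU.isRegular hM, hκ.isStrongLimit⟩


/-! ### The sets of rank less than `κ` -/

section VKappa

variable {κ : Cardinal.{u}}

theorem card_lt_of_mem_V (hi : κ.IsInaccessible) {x : ZFSet.{u}} (hx : x ∈ V_ κ.ord) :
    x.card < κ := by
  have h1 := ZFSet.card_mono (ZFSet.subset_vonNeumann_self x)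
  rw [ZFSet.card_vonNeumann] at h1
  refine h1.trans_lt ?_
  conv_rhs => rw [← hi.preBeth_ord]
  exact Cardinal.preBeth_strictMono (ZFSet.mem_vonNeumann.1 hx)

theorem mem_V_of_card_lt (hi : κ.IsInaccessible) {x : ZFSet.{u}} (hx : x ⊆ V_ κ.ord)
    (hc : x.card < κ) : x ∈ V_ κ.ord := by
  rw [ZFSet.mem_vonNeumann]
  have h1 : ⨆ i : Shrink.{u} x, (((equivShrink x).symm i : ZFSet.{u}).rank + 1) < κ.ord := by
    refine Ordinal.iSup_add_one_lt_of_lt_cof ?_ fun i => ?_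
    · rw [hi.isRegular.cof_ord]
      exact hc
    · exact ZFSet.mem_vonNeumann.1 (hx ((equivShrink x).symm i).2)
  refine lt_of_le_of_lt (ZFSet.rank_le_iff.2 fun y hy => ?_) h1
  refine lt_of_lt_of_le (lt_add_one y.rank) ?_
  have := Ordinal.le_iSup (fun i : Shrink.{u} x =>
    (((equivShrink x).symm i : ZFSet.{u}).rank + 1)) (equivShrink x ⟨y, hy⟩)
  simpa using this

theorem card_V (hi : κ.IsInaccessible) : (V_ κ.ord).card = κ := by
  rw [ZFSet.card_vonNeumann, hi.preBeth_ord]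

theorem V_transitive : (V_ κ.ord).IsTransitive := ZFSet.isTransitive_vonNeumann _

theorem ordSet_subset_V : ordSet κ ⊆ V_ κ.ord := Ordinal.toZFSet_subset_vonNeumann _

theorem rank_mem_ordSet {x : ZFSet.{u}} : x.rank.toZFSet ∈ ordSet κ ↔ x ∈ V_ κ.ord := by
  rw [toZFSet_mem_ordSet, ZFSet.mem_vonNeumann]

theorem insert_singleton_mem_V (hi : κ.IsInaccessible) {x y : ZFSet.{u}} (hx : x ∈ V_ κ.ord)
    (hy : y ∈ V_ κ.ord) : ({x, y} : ZFSet.{u}) ∈ V_ κ.ord := by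
  have hl := Cardinal.isSuccLimit_ord hi.1.le
  rw [ZFSet.mem_vonNeumann] at *
  rw [ZFSet.rank_pair]
  exact max_lt (hl.succ_lt hx) (hl.succ_lt hy)

theorem pair_mem_V (hi : κ.IsInaccessible) {x y : ZFSet.{u}} (hx : x ∈ V_ κ.ord)
    (hy : y ∈ V_ κ.ord) : ZFSet.pair x y ∈ V_ κ.ord := by
  have := insert_singleton_mem_V hi hx hx
  rw [ZFSet.pair_eq_singleton] at this
  exact insert_singleton_mem_V hi this (insert_singleton_mem_V hi hx hy)

theorem lam_mem_V (hi : κ.IsInaccessible) {x : ZFSet.{u}} {f : ZFSet.{u} → ZFSet.{u}}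
    (hx : x ∈ V_ κ.ord) (hf : ∀ y ∈ x, f y ∈ V_ κ.ord) : lam f x ∈ V_ κ.ord := by
  refine mem_V_of_card_lt hi (fun z hz => ?_) (card_img_le.trans_lt (card_lt_of_mem_V hi hx))
  obtain ⟨y, hy, rfl⟩ := mem_lam.1 hz
  exact pair_mem_V hi (V_transitive _ hx hy) (hf y hy)

theorem IsModel.V_subset {W : ZFSet.{u}} (h : IsModel κ W) (hi : κ.IsInaccessible) :
    V_ κ.ord ⊆ W := by
  intro x
  induction x using ZFSet.inductionOn with
  | _ x ih =>
    intro hx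
    exact h.mem_of_card_lt (fun y hy => ih y hy (V_transitive _ hx hy)) (card_lt_of_mem_V hi hx)

end VKappa

theorem collection {W : ZFSet.{u}} [hW : IsTransModel W] (P : ZFSet.{u} → ZFSet.{u} → Prop)
    [hP : Dfn (fun w : Option (Option Empty) → W => P (w (some none)) (w none))] {a : ZFSet.{u}}
    (ha : a ∈ W) (h : ∀ x ∈ a, ∃ y ∈ W, P x y) : ∃ c ∈ W, ∀ x ∈ a, ∃ y ∈ c, P x y := by
  obtain ⟨c, hc⟩ := hW.models.collection _ (hP.definable₂ (fun e : Empty => e.elim)) ⟨a, ha⟩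
    (fun x hx => by
      obtain ⟨y, hy, hp⟩ := h x hx
      exact ⟨⟨y, hy⟩, hp⟩)
  refine ⟨c, c.2, fun x hx => ?_⟩
  obtain ⟨y, hy, hp⟩ := hc ⟨x, hW.transitive _ ha hx⟩ hx
  exact ⟨y, hy, hp⟩

/-! ### The rank function of a `κ`-model -/

/-- The ordinal `y` is the rank of `x`, as computed in `W`. -/
def RankRel (W x y : ZFSet.{u}) : Prop :=
  RecRel W (fun u => u) (fun u s => ⋃₀ img (fun v => insert (ev s v) (ev s v)) u) x y

instance Dfn.rankRel {W : ZFSet.{u}} [hW : IsTransModel W] {β : Type} [Finite β]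
    (s t : (β → W) → ZFSet.{u}) [hs : Tm s] [ht : Tm t] :
    Dfn (fun v => RankRel W (s v) (t v)) := by
  have := hs.weaken (β := Option (Option β)) (fun i => some (some i))
  have := ht.weaken (β := Option (Option β)) (fun i => some (some i))
  simp only [RankRel, RecRel]
  infer_instance

theorem toZFSet_rank (x : ZFSet.{u}) : x.rank.toZFSet =
    ⋃₀ img (fun v => insert v.rank.toZFSet v.rank.toZFSet) x := by
  ext z
  simp only [ZFSet.mem_sUnion, mem_img, Ordinal.mem_toZFSet_iff, ← Ordinal.toZFSet_add_one]
  constructor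
  · rintro ⟨a, ha, rfl⟩
    obtain ⟨y, hy, hay⟩ := ZFSet.lt_rank_iff.1 ha
    exact ⟨_, ⟨y, hy, rfl⟩, Ordinal.toZFSet_mem_toZFSet_iff.2 (Order.lt_add_one_iff.2 hay)⟩
  · rintro ⟨_, ⟨y, hy, rfl⟩, hz⟩
    obtain ⟨a, ha, rfl⟩ := Ordinal.mem_toZFSet_iff.1 hz
    exact ⟨a, (Order.lt_add_one_iff.1 ha).trans_lt (ZFSet.rank_lt_of_mem hy), rfl⟩

theorem sUnion_img_insert_eq {u s : ZFSet.{u}} (h : ∀ v ∈ u, ev s v = v.rank.toZFSet) :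
    (⋃₀ img (fun v => insert (ev s v) (ev s v)) u : ZFSet.{u}) = u.rank.toZFSet := by
  rw [toZFSet_rank]
  congr 1
  ext z
  simp only [mem_img]
  exact exists_congr fun v => and_congr_right fun hv => by rw [h v hv]

theorem RankRel.eq {W x y : ZFSet.{u}} (h : RankRel W x y) : y = x.rank.toZFSet :=
  RecRel.eq (Φ := fun u => u.rank.toZFSet) h ZFSet.mem_wf (fun _ => True)
    (fun _ _ _ _ => trivial) trivial (fun _ _ _ hs => sUnion_img_insert_eq hs)

theorem IsModel.rankRel_iff {κ : Cardinal.{u}} {W : ZFSet.{u}} (h : IsModel κ W)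
    (hi : κ.IsInaccessible) {x y : ZFSet.{u}} (hx : x ∈ V_ κ.ord) :
    RankRel W x y ↔ y = x.rank.toZFSet := by
  refine ⟨RankRel.eq, ?_⟩
  rintro rfl
  have hr := h.isSuccLimit.add_one_lt (ZFSet.mem_vonNeumann.1 hx)
  have ht : V_ (x.rank + 1) ∈ V_ κ.ord := ZFSet.vonNeumann_mem_of_lt hr
  refine RecRel.intro (Φ := fun u => u.rank.toZFSet) (h.V_subset hi ht)
    (h.V_subset hi (lam_mem_V hi ht fun y hy => ordSet_subset_V (rank_mem_ordSet.2
      (V_transitive _ ht hy)))) ?_ (fun u hu => ZFSet.isTransitive_vonNeumann _ _ hu)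
      (fun u _ s hs => sUnion_img_insert_eq hs)
  rw [ZFSet.mem_vonNeumann]
  exact lt_add_one _

/-- Without power sets in `W`, V_κ is reached by collection. Each V_b with b < κ lies in `W`, so `W`
has a set `c` that contains, for each b < κ, some set including V_b. Separation by the definable
rank then cuts V_κ out of the union of `c`. -/
theorem IsModel.V_mem {κ : Cardinal.{u}} {W : ZFSet.{u}} (h : IsModel κ W)
    (hi : κ.IsInaccessible) : V_ κ.ord ∈ W := by
  have := h.isTransModel
  have : Fact (ordSet κ ∈ W) := ⟨h.mem⟩
  obtain ⟨c, hc, h1⟩ := collection (W := W)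
    (fun a y => ∀ x ∈ W, (∃ r ∈ a, RankRel W x r) → x ∈ y)
    h.mem (fun a ha => by
      obtain ⟨b, hb, rfl⟩ := mem_ordSet.1 ha
      refine ⟨V_ b, h.V_subset hi (ZFSet.vonNeumann_mem_of_lt hb), fun x _ ⟨r, hr, hxr⟩ => ?_⟩
      rw [hxr.eq, Ordinal.toZFSet_mem_toZFSet_iff] at hr
      exact ZFSet.mem_vonNeumann.2 hr)
  have : Fact (c ∈ W) := ⟨hc⟩
  have h2 : ZFSet.sep (fun x => ∃ r ∈ ordSet κ, RankRel W x r) (⋃₀ c) ∈ W := mem_of_tm _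
  convert h2 using 1
  ext x
  rw [ZFSet.mem_sep, ZFSet.mem_sUnion]
  constructor
  · intro hx
    have hx' := rank_mem_ordSet.2 hx
    have hr := (h.rankRel_iff hi hx).2 rfl
    obtain ⟨y, hy, h3⟩ := h1 _ (h.insert_mem_ordSet hx')
    exact ⟨⟨y, hy, h3 x (h.V_subset hi hx) ⟨_, ZFSet.mem_insert _ _, hr⟩⟩, _, hx', hr⟩
  · rintro ⟨_, r, hr, hxr⟩
    rw [hxr.eq] at hr
    exact rank_mem_ordSet.1 hr

/-! ### Well-orderings of type `κ` -/

/-- In a `κ`-model, a well-ordering of a set of size `κ` all of whose proper initial segments have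
size less than `κ` is isomorphic to `κ`. -/
theorem IsModel.hasSizeIn_of_wellOrder {κ : Cardinal.{u}} {W : ZFSet.{u}} (h : IsModel κ W)
    {D r : ZFSet.{u}} (hD : D ∈ W) (hr : r ∈ W) (hc : κ ≤ D.card)
    (trans : ∀ x ∈ D, ∀ y ∈ D, ∀ z ∈ D, ZFSet.pair x y ∈ r → ZFSet.pair y z ∈ r →
      ZFSet.pair x z ∈ r)
    (tri : ∀ x ∈ D, ∀ y ∈ D, ZFSet.pair x y ∈ r ∨ x = y ∨ ZFSet.pair y x ∈ r)
    (min : ∀ S : Set ZFSet.{u}, (∀ x ∈ S, x ∈ D) → S.Nonempty →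
      ∃ m ∈ S, ∀ x ∈ S, ZFSet.pair x m ∉ r)
    (seg : ∀ x ∈ D, (ZFSet.sep (fun y => ZFSet.pair y x ∈ r) D).card < κ) : HasSizeIn κ W D := by
  have := h.isTransModel
  have : Fact (ordSet κ ∈ W) := ⟨h.mem⟩
  have : Fact (D ∈ W) := ⟨hD⟩
  have : Fact (r ∈ W) := ⟨hr⟩
  set pr : ZFSet.{u} → ZFSet.{u} := fun x => ZFSet.sep (fun y => ZFSet.pair y x ∈ r) D with hpr
  have mem_pr : ∀ {x y}, y ∈ pr x ↔ y ∈ D ∧ ZFSet.pair y x ∈ r := ZFSet.mem_sep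
  have wf : WellFounded (fun v u => v ∈ pr u) := by
    rw [WellFounded.wellFounded_iff_has_min]
    intro S hS
    by_cases hSD : (S ∩ D).Nonempty
    · obtain ⟨m, hm, h1⟩ := min (S ∩ D) (fun x hx => hx.2) hSD
      exact ⟨m, hm.1, fun x hx hxm => h1 x ⟨hx, (mem_pr.1 hxm).1⟩ (mem_pr.1 hxm).2⟩
    · obtain ⟨m, hm⟩ := hS
      exact ⟨m, hm, fun x hx hxm => hSD ⟨x, hx, (mem_pr.1 hxm).1⟩⟩
  -- `Φ` is the Mostowski collapse of `r`, defined outside `W`. It maps `D` injectively onto an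
  -- ordinal all of whose elements are below `κ` and which has at least `κ` elements, hence onto
  -- `κ`.
  let Φ : ZFSet.{u} → ZFSet.{u} :=
    wf.fix (fun u F => ZFSet.range (fun v : pr u => F v v.2))
  have hΦ : ∀ u, Φ u = img Φ (pr u) := fun u => wf.fix_eq _ u
  have hord : ∀ u, u ∈ D → Φ u ∈ ordSet κ := by
    intro u
    induction u using wf.induction with
    | _ u ih =>
      intro hu
      have h1 : (Φ u).IsOrdinal := by
        rw [ZFSet.isOrdinal_iff_forall_mem_isOrdinal]
        constructor
        · intro y hy z hz
          rw [hΦ, mem_img] at hy ⊢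
          obtain ⟨v, hv, rfl⟩ := hy
          rw [hΦ, mem_img] at hz
          obtain ⟨w, hw, rfl⟩ := hz
          rw [mem_pr] at hv hw
          exact ⟨w, mem_pr.2 ⟨hw.1, trans w hw.1 v hv.1 u hu hw.2 hv.2⟩, rfl⟩
        · intro y hy
          rw [hΦ, mem_img] at hy
          obtain ⟨v, hv, rfl⟩ := hy
          exact isOrdinal_of_mem_ordSet (ih v hv (mem_pr.1 hv).1)
      have h2 : (Φ u).card < κ := by
        rw [hΦ]
        exact card_img_le.trans_lt (seg u hu)
      rw [← h1.toZFSet_rank_eq] at h2 ⊢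
      rw [Ordinal.card_toZFSet] at h2
      exact toZFSet_mem_ordSet.2 (Cardinal.lt_ord.2 h2)
  have hinj : ∀ x ∈ D, ∀ y ∈ D, Φ x = Φ y → x = y := by
    have : ∀ x ∈ D, ∀ y ∈ D, ZFSet.pair x y ∈ r → Φ x ≠ Φ y := by
      intro x hx y hy hxy he
      have : Φ x ∈ Φ y := by
        rw [hΦ y]
        exact mem_img.2 ⟨x, mem_pr.2 ⟨hx, hxy⟩, rfl⟩
      rw [he] at this
      exact ZFSet.mem_irrefl _ this
    intro x hx y hy he
    rcases tri x hx y hy with h1 | h1 | h1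
    · exact absurd he (this x hx y hy h1)
    · exact h1
    · exact absurd he.symm (this y hy x hx h1)
  have himg : img Φ D = ordSet κ := by
    have h1 : (img Φ D).IsOrdinal := by
      rw [ZFSet.isOrdinal_iff_forall_mem_isOrdinal]
      constructor
      · intro y hy z hz
        obtain ⟨v, hv, rfl⟩ := mem_img.1 hy
        rw [hΦ, mem_img] at hz
        obtain ⟨w, hw, rfl⟩ := hz
        exact mem_img.2 ⟨w, (mem_pr.1 hw).1, rfl⟩
      · intro y hy
        obtain ⟨v, hv, rfl⟩ := mem_img.1 hy
        exact isOrdinal_of_mem_ordSet (hord v hv)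
    have h2 : κ ≤ (img Φ D).card := by
      refine hc.trans ?_
      rw [← Cardinal.lift_le.{u+1}, ← ZFSet.cardinalMk_coe_sort, ← ZFSet.cardinalMk_coe_sort]
      refine Cardinal.mk_le_of_injective (f := fun x => ⟨Φ x, mem_img.2 ⟨x, x.2, rfl⟩⟩) ?_
      intro x y hxy
      exact Subtype.ext (hinj x x.2 y y.2 (congrArg Subtype.val hxy))
    apply le_antisymm
    · intro y hy
      obtain ⟨v, hv, rfl⟩ := mem_img.1 hy
      exact hord v hv
    · rw [← h1.toZFSet_rank_eq] at h2 ⊢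
      rw [Ordinal.card_toZFSet] at h2
      exact Ordinal.toZFSet_subset_toZFSet_iff.2 (Cardinal.ord_le.2 h2)
  have hprD : ∀ u, pr u ⊆ D := fun u v hv => (mem_pr.1 hv).1
  have hrec : ∀ x ∈ D, ∀ y, RecRel W pr (fun u s => img (ev s) (pr u)) x y ↔ y = Φ x := by
    intro x hx y
    have hF : ∀ u s, (∀ v ∈ pr u, ev s v = Φ v) → img (ev s) (pr u) = Φ u := by
      intro u s hs
      rw [hΦ]
      ext z
      simp only [mem_img]
      exact exists_congr fun v => and_congr_right fun hv => by rw [hs v hv]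
    constructor
    · exact fun hxy => hxy.eq wf (fun _ => True) (fun _ _ _ _ => trivial) trivial
        fun u s _ => hF u s
    · rintro rfl
      -- An approximation is needed only on `x` and its predecessors. There are fewer than `κ` of
      -- them, so `W` contains it and the collapse becomes definable over `W`.
      have ht : insert x (pr x) ⊆ D := by
        intro v hv
        rcases ZFSet.mem_insert_iff.1 hv with rfl | hv
        · exact hx
        · exact hprD _ hv
      have htc : (insert x (pr x)).card < κ :=
        ZFSet.card_insert_le.trans_lt (Cardinal.add_lt_of_lt h.aleph0_le (seg x hx)
          (Cardinal.one_lt_aleph0.trans_le h.aleph0_le))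
      have htW : insert x (pr x) ⊆ W := fun v hv => h.transitive _ hD (ht hv)
      refine RecRel.intro (h.mem_of_card_lt htW htc) (h.lam_mem_of_card_lt htW htc fun v hv =>
        h.transitive _ h.mem (hord v (ht hv))) (ZFSet.mem_insert _ _) (fun u hu v hv => ?_)
        (fun u _ s hs => hF u s hs)
      refine ZFSet.mem_insert_of_mem _ ?_
      rcases ZFSet.mem_insert_iff.1 hu with rfl | hu
      · exact hv
      · rw [mem_pr] at hu hv ⊢
        exact ⟨hv.1, trans v hv.1 u hu.1 x hx hv.2 hu.2⟩
  have hdfn : Dfn (fun w : Option Empty → W => ∃ x ∈ D, ∃ y ∈ ordSet κ,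
      (w none : ZFSet.{u}) = ZFSet.pair y x ∧ RecRel W pr (fun u s => img (ev s) (pr u)) x y) := by
    simp only [RecRel, hpr]
    infer_instance
  set e := ZFSet.sep (fun p => ∃ x ∈ D, ∃ y ∈ ordSet κ, p = ZFSet.pair y x ∧
    RecRel W pr (fun u s => img (ev s) (pr u)) x y) (ZFSet.prod (ordSet κ) D) with he
  have heW : e ∈ W := mem_of_tm _
  have hpair : ∀ {x y}, ZFSet.pair y x ∈ e ↔ x ∈ D ∧ y = Φ x := by
    intro x y
    rw [he, ZFSet.mem_sep, ZFSet.pair_mem_prod]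
    constructor
    · rintro ⟨_, x', hx', y', hy', h1, h2⟩
      obtain ⟨rfl, rfl⟩ := ZFSet.pair_inj.1 h1
      exact ⟨hx', (hrec _ hx' _).1 h2⟩
    · rintro ⟨hx, rfl⟩
      exact ⟨⟨hord x hx, hx⟩, x, hx, _, hord x hx, rfl, (hrec x hx _).2 rfl⟩
  refine ⟨hD, e, heW, ⟨ZFSet.sep_subset, fun y hy => ?_⟩, fun x hx => ?_⟩
  · rw [← himg] at hy
    obtain ⟨x, hx, rfl⟩ := mem_img.1 hy
    exact ⟨x, hpair.2 ⟨hx, rfl⟩, fun z hz => hinj z (hpair.1 hz).1 x hx (hpair.1 hz).2.symm⟩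
  · exact ⟨Φ x, hpair.2 ⟨hx, rfl⟩, fun z hz => (hpair.1 hz).2⟩

/-- Ordering V_κ by rank first, and by a well-ordering from `W` among sets of equal rank, makes
every proper initial segment a subset of some V_b with b < κ, hence of size less than κ. -/
theorem IsModel.hasSizeIn_V {κ : Cardinal.{u}} {W : ZFSet.{u}} (h : IsModel κ W)
    (hi : κ.IsInaccessible) : HasSizeIn κ W (V_ κ.ord) := by
  have := h.isTransModel
  have hV := h.V_mem hi
  have : Fact (ordSet κ ∈ W) := ⟨h.mem⟩
  have : Fact (V_ κ.ord ∈ W) := ⟨hV⟩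
  obtain ⟨⟨r₀, hr₀⟩, irr, tr, tot, le⟩ := h.models.wellOrdering ⟨_, hV⟩
  have : Fact (r₀ ∈ W) := ⟨hr₀⟩
  set r := ZFSet.sep (fun p => ∃ x ∈ V_ κ.ord, ∃ y ∈ V_ κ.ord,
      p = ZFSet.pair x y ∧ ∃ a ∈ ordSet κ, ∃ b ∈ ordSet κ, RankRel W x a ∧
        RankRel W y b ∧ (a ∈ b ∨ a = b ∧ ZFSet.pair x y ∈ r₀))
    (ZFSet.prod (V_ κ.ord) (V_ κ.ord)) with hr
  have hrW : r ∈ W := mem_of_tm _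
  have hpair : ∀ x ∈ V_ κ.ord, ∀ y ∈ V_ κ.ord, (ZFSet.pair x y ∈ r ↔
      x.rank < y.rank ∨ x.rank = y.rank ∧ ZFSet.pair x y ∈ r₀) := by
    intro x hx y hy
    rw [hr, ZFSet.mem_sep]
    constructor
    · rintro ⟨_, x', hx', y', hy', h1, a, _, b, _, h2, h3, h4⟩
      obtain ⟨rfl, rfl⟩ := ZFSet.pair_inj.1 h1
      rw [h2.eq, h3.eq, Ordinal.toZFSet_mem_toZFSet_iff, Ordinal.toZFSet_injective.eq_iff] at h4
      exact h4
    · intro h1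
      refine ⟨ZFSet.pair_mem_prod.2 ⟨hx, hy⟩, x, hx, y, hy, rfl, _, rank_mem_ordSet.2 hx, _,
        rank_mem_ordSet.2 hy, (h.rankRel_iff hi hx).2 rfl, (h.rankRel_iff hi hy).2 rfl, ?_⟩
      rwa [Ordinal.toZFSet_mem_toZFSet_iff, Ordinal.toZFSet_injective.eq_iff]
  have hVW : ∀ {x}, x ∈ V_ κ.ord → x ∈ W := fun hx => h.transitive _ hV hx
  refine h.hasSizeIn_of_wellOrder hV hrW (card_V hi).ge ?_ ?_ ?_ ?_
  · intro x hx y hy z hz hxy hyz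
    rw [hpair x hx y hy] at hxy
    rw [hpair y hy z hz] at hyz
    rw [hpair x hx z hz]
    rcases hxy with h1 | ⟨h1, h1'⟩ <;> rcases hyz with h2 | ⟨h2, h2'⟩
    · exact Or.inl (h1.trans h2)
    · exact Or.inl (h2 ▸ h1)
    · exact Or.inl (h1 ▸ h2)
    · exact Or.inr ⟨h1.trans h2, tr ⟨x, hVW hx⟩ ⟨y, hVW hy⟩ ⟨z, hVW hz⟩ hx hy hz h1' h2'⟩
  · intro x hx y hy
    rw [hpair x hx y hy, hpair y hy x hx]
    rcases lt_trichotomy x.rank y.rank with h1 | h1 | h1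
    · exact Or.inl (Or.inl h1)
    · rcases tot ⟨x, hVW hx⟩ ⟨y, hVW hy⟩ hx hy with h2 | h2 | h2
      · exact Or.inl (Or.inr ⟨h1, h2⟩)
      · exact Or.inr (Or.inl (congrArg Subtype.val h2))
      · exact Or.inr (Or.inr (Or.inr ⟨h1.symm, h2⟩))
    · exact Or.inr (Or.inr (Or.inl h1))
  · intro S hS hne
    obtain ⟨m₀, hm₀, hmin⟩ := (InvImage.wf ZFSet.rank Ordinal.lt_wf).has_min S hne
    -- `S` is arbitrary and need not be in `W`. Its layer of least rank is an element of V_κ and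
    -- hence of `W`, so the internal well-ordering provides a least element of it.
    have hsub : ZFSet.sep (fun x => x ∈ S ∧ x.rank = m₀.rank) (V_ (m₀.rank + 1)) ∈ W := by
      refine h.V_subset hi (ZFSet.mem_vonNeumann_of_subset ZFSet.sep_subset
        (ZFSet.vonNeumann_mem_of_lt (h.isSuccLimit.add_one_lt
          (ZFSet.mem_vonNeumann.1 (hS m₀ hm₀)))))
    have hTS : ∀ x ∈ ZFSet.sep (fun x => x ∈ S ∧ x.rank = m₀.rank) (V_ (m₀.rank + 1)),
        x ∈ S ∧ x.rank = m₀.rank := fun x hx => (ZFSet.mem_sep.1 hx).2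
    have hm₀T : m₀ ∈ ZFSet.sep (fun x => x ∈ S ∧ x.rank = m₀.rank) (V_ (m₀.rank + 1)) :=
      ZFSet.mem_sep.2 ⟨ZFSet.mem_vonNeumann.2 (lt_add_one _), hm₀, rfl⟩
    obtain ⟨⟨m, hmW⟩, hm, h1⟩ := le ⟨_, hsub⟩ (fun x hx => hS x (hTS x.1 hx).1)
      ⟨⟨m₀, hVW (hS _ hm₀)⟩, hm₀T⟩
    obtain ⟨hmS, hmr⟩ := hTS m hm
    refine ⟨m, hmS, fun x hx hxm => ?_⟩
    rw [hpair x (hS x hx) m (hS m hmS)] at hxm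
    rcases hxm with h2 | ⟨h2, h3⟩
    · rw [hmr] at h2
      exact hmin x hx h2
    · have hxm' : x ∈ ZFSet.sep (fun x => x ∈ S ∧ x.rank = m₀.rank) (V_ (m₀.rank + 1)) :=
        ZFSet.mem_sep.2 ⟨ZFSet.mem_vonNeumann.2 (by rw [h2, hmr]; exact lt_add_one _), hx,
          h2.trans hmr⟩
      by_cases hne : x = m
      · rw [hne] at h3
        exact irr ⟨m, hmW⟩ (hS m hmS) h3
      · have h4 := h1 ⟨x, hVW (hS x hx)⟩ hxm' (fun he => hne (congrArg Subtype.val he))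
        exact irr ⟨m, hmW⟩ (hS m hmS)
          (tr ⟨m, hmW⟩ ⟨x, hVW (hS x hx)⟩ ⟨m, hmW⟩ (hS m hmS) (hS x hx) (hS m hmS) h4 h3)
  · intro x hx
    refine card_lt_of_mem_V hi (ZFSet.mem_vonNeumann_of_subset (y := V_ (x.rank + 1)) ?_
      (ZFSet.vonNeumann_mem_of_lt (h.isSuccLimit.add_one_lt (ZFSet.mem_vonNeumann.1 hx))))
    intro y hy
    obtain ⟨hyV, hyx⟩ := ZFSet.mem_sep.1 hy
    rw [hpair y hyV x hx] at hyx
    refine ZFSet.mem_vonNeumann.2 (Order.lt_add_one_iff.2 ?_)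
    rcases hyx with h1 | h1
    · exact h1.le
    · exact h1.1.le


/-! ### Choice in transitive models -/

/-- Take the least witness in a well-ordering of `a` from `W`. Written as the union of the set of
least witnesses, it is a total definable operation, with value `∅` where there is no witness. -/
theorem exists_choice {W : ZFSet.{u}} [hW : IsTransModel W] (P : ZFSet.{u} → ZFSet.{u} → Prop)
    [hP : Dfn (fun w : Option (Option Empty) → W => P (w none) (w (some none)))] {a b : ZFSet.{u}}
    (ha : a ∈ W) (hb : b ∈ W) : ∃ g : ZFSet.{u} → ZFSet.{u}, lam g b ∈ W ∧ (∀ x ∈ W, g x ∈ W) ∧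
      ∀ x ∈ W, (∃ y ∈ a, P x y) → g x ∈ a ∧ P x (g x) := by
  obtain ⟨⟨r, hr⟩, irr, tr, tot, le⟩ := hW.models.wellOrdering ⟨a, ha⟩
  have : Fact (a ∈ W) := ⟨ha⟩
  have : Fact (b ∈ W) := ⟨hb⟩
  have : Fact (r ∈ W) := ⟨hr⟩
  have hP' := hP.swap
  have hP'' : Dfn (fun w : Option (Option (Option Empty)) → W => P (w (some (some none))) (w none)) :=
    hP.comp (fun o => o.elim (some (some none)) (fun _ => none))
  have haW : ∀ {x}, x ∈ a → x ∈ W := fun hx => hW.transitive _ ha hx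
  let g : ZFSet.{u} → ZFSet.{u} := fun x =>
    ⋃₀ ZFSet.sep (fun y => P x y ∧ ∀ z ∈ a, P x z → z = y ∨ ZFSet.pair y z ∈ r) a
  refine ⟨g, mem_of_tm _, fun x hx => ?_, fun x hx hex => ?_⟩
  · have : Tm (fun w : Option Empty → W => g (w none)) := by
      simp only [g]; infer_instance
    exact this.mem (fun o => o.elim ⟨x, hx⟩ (fun e => e.elim))
  · have : Fact (x ∈ W) := ⟨hx⟩
    have : Dfn (fun w : Option Empty → W => P x (w none)) :=
      hP'.subst (fun o w => (o.elim (w none : ZFSet.{u}) fun _ => x))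
        (ht := by rintro (_ | o) <;> simp only [Option.elim] <;> infer_instance)
    have hS : ZFSet.sep (P x) a ∈ W := mem_of_tm (W := W) (ZFSet.sep (fun y => P x y) a)
    obtain ⟨y₀, hy₀, hp₀⟩ := hex
    have hmem : ∀ z ∈ ZFSet.sep (P x) a, z ∈ a ∧ P x z := fun z hz => ZFSet.mem_sep.1 hz
    obtain ⟨⟨m, hmW⟩, hm, h1⟩ := le ⟨_, hS⟩ (fun z hz => (hmem z hz).1)
      ⟨⟨y₀, haW hy₀⟩, ZFSet.mem_sep.2 ⟨hy₀, hp₀⟩⟩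
    obtain ⟨hma, hmP⟩ := hmem m hm
    have hle : ∀ z ∈ a, P x z → z = m ∨ ZFSet.pair m z ∈ r := by
      intro z hz hpz
      by_cases hzm : z = m
      · exact Or.inl hzm
      · exact Or.inr (h1 ⟨z, haW hz⟩ (ZFSet.mem_sep.2 ⟨hz, hpz⟩)
          (fun he => hzm (congrArg Subtype.val he)))
    have hg : g x = m := by
      have : ZFSet.sep (fun y => P x y ∧ ∀ z ∈ a, P x z → z = y ∨ ZFSet.pair y z ∈ r) a = {m} := by
        ext y
        rw [ZFSet.mem_sep, ZFSet.mem_singleton]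
        constructor
        · rintro ⟨hya, hpy, hly⟩
          rcases hle y hya hpy with h2 | h2
          · exact h2
          · rcases hly m hma hmP with h3 | h3
            · exact h3.symm
            · exact absurd (tr ⟨m, hmW⟩ ⟨y, haW hya⟩ ⟨m, hmW⟩ hma hya hma h2 h3)
                (irr ⟨m, hmW⟩ hma)
        · rintro rfl
          exact ⟨hma, hmP, hle⟩
      simp only [g, this, ZFSet.sUnion_singleton]
    rw [hg]
    exact ⟨hma, hmP⟩

/-! ### The ultrapower -/

section Ultrapower

variable {κ : Cardinal.{u}} {W U : ZFSet.{u}}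

theorem ultEq_iff {f g : ZFSet.{u}} (hf : IsUltFun κ W f) (hg : IsUltFun κ W g) :
    UltEq κ U f g ↔ AE κ U (fun ξ => ev f ξ = ev g ξ) := by
  refine IsMUltrafilter.ae_congr fun ξ hξ => ?_
  simp only [IsFunc.pair_mem_iff hf.2, IsFunc.pair_mem_iff hg.2]
  constructor
  · rintro ⟨y, ⟨_, rfl⟩, _, h⟩
    exact h
  · intro h
    exact ⟨_, ⟨hξ, rfl⟩, hξ, h⟩

theorem ultMem_iff {f g : ZFSet.{u}} (hf : IsUltFun κ W f) (hg : IsUltFun κ W g) :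
    UltMem κ U f g ↔ AE κ U (fun ξ => ev f ξ ∈ ev g ξ) := by
  refine IsMUltrafilter.ae_congr fun ξ hξ => ?_
  simp only [IsFunc.pair_mem_iff hf.2, IsFunc.pair_mem_iff hg.2]
  constructor
  · rintro ⟨y, z, ⟨_, rfl⟩, ⟨_, rfl⟩, h⟩
    exact h
  · intro h
    exact ⟨_, _, ⟨hξ, rfl⟩, ⟨hξ, rfl⟩, h⟩

/-- `p` is the transitive collapse of the ultrapower of `W` by `U`, as a function of the
representatives. -/
def IsCollapse (κ : Cardinal.{u}) (W U : ZFSet.{u}) (p : ZFSet.{u} → ZFSet.{u}) : Prop :=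
  ∀ f, IsUltFun κ W f → ∀ x, x ∈ p f ↔
    ∃ g, IsUltFun κ W g ∧ AE κ U (fun ξ => ev g ξ ∈ ev f ξ) ∧ x = p g

theorem IsCollapse.mem_of_ae {p : ZFSet.{u} → ZFSet.{u}} {f g : ZFSet.{u}}
    (hp : IsCollapse κ W U p) (hf : IsUltFun κ W f) (hg : IsUltFun κ W g)
    (h : AE κ U (fun ξ => ev f ξ ∈ ev g ξ)) : p f ∈ p g :=
  (hp g hg _).2 ⟨f, hf, h, rfl⟩

variable [hW : IsTransModel W] [hκW : Fact (ordSet κ ∈ W)]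

theorem isUltFun_lam (f : ZFSet.{u} → ZFSet.{u}) [hf : Tm (fun w : Option Empty → W => f (w none))] :
    IsUltFun κ W (lam f (ordSet κ)) :=
  ⟨mem_of_tm _, isFunc_lam fun x hx =>
    hf.mem (fun o => o.elim ⟨x, hW.transitive _ hκW.out hx⟩ (fun e => e.elim))⟩

/-- A descending chain chosen outside `W` yields countably many sets in `U`. Their sequence lies in
`W` by closure under `ω`-sequences, so they have a common point, and the values at that point would
descend in `∈`. -/
theorem IsMUltrafilter.wellFounded (hU : IsMUltrafilter κ W U) (h : IsModel κ W) :
    WellFounded (fun f g : {f // IsUltFun κ W f} => AE κ U (fun ξ => ev f ξ ∈ ev g ξ)) := by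
  rw [wellFounded_iff_isEmpty_descending_chain]
  refine ⟨fun ⟨F, hF⟩ => ?_⟩
  have hω : Ordinal.omega0 < κ.ord := by
    rw [← Cardinal.ord_aleph0, Cardinal.ord_lt_ord]
    exact hU.aleph0_lt h
  have hinj : Function.Injective (fun n : ℕ => (n : Ordinal.{u}).toZFSet) := fun m n hmn => by
    simpa using Ordinal.toZFSet_injective hmn
  let S : ℕ → ZFSet.{u} := fun n =>
    ZFSet.sep (fun ξ => ev (F (n + 1)) ξ ∈ ev (F n) ξ) (ordSet κ)
  have hS : ∀ n, S n ∈ U := hF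
  let s : ZFSet.{u} → ZFSet.{u} := fun x =>
    S (Function.invFun (fun n : ℕ => (n : Ordinal.{u}).toZFSet) x)
  have hs : ∀ n : ℕ, s (n : Ordinal.{u}).toZFSet = S n := fun n =>
    congrArg S (Function.leftInverse_invFun hinj n)
  have : Fact (lam s Ordinal.omega0.toZFSet ∈ W) :=
    ⟨h.lam_mem hω fun x _ => (hU.subset _ (hS _)).1⟩
  have h1 : AE κ U (fun ξ => ∀ i ∈ Ordinal.omega0.toZFSet,
      ξ ∈ ev (lam s Ordinal.omega0.toZFSet) i) := by
    refine hU.ae_forall_lt h (fun ξ i => ξ ∈ ev (lam s Ordinal.omega0.toZFSet) i)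
      (toZFSet_mem_ordSet.2 hω) fun i hi => ?_
    rw [ev_lam hi]
    have : ZFSet.sep (fun ξ => ξ ∈ s i) (ordSet κ) = s i := by
      ext ξ
      rw [ZFSet.mem_sep]
      exact ⟨fun h => h.2, fun h => ⟨(ZFSet.mem_sep.1 h).1, h⟩⟩
    rw [AE, this]
    exact hS _
  obtain ⟨ξ, _, h2⟩ := hU.ae_exists h1
  refine (wellFounded_iff_isEmpty_descending_chain.1 ZFSet.mem_wf.{u}).false
    ⟨fun n => ev (F n) ξ, fun n => ?_⟩
  have hn : (n : Ordinal.{u}).toZFSet ∈ Ordinal.omega0.toZFSet :=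
    Ordinal.toZFSet_mem_toZFSet_iff.2 (Ordinal.natCast_lt_omega0 n)
  have := h2 _ hn
  rw [ev_lam hn, hs] at this
  exact (ZFSet.mem_sep.1 this).2

theorem IsMUltrafilter.exists_collapse (hU : IsMUltrafilter κ W U) (h : IsModel κ W) :
    ∃ p, IsCollapse κ W U p := by
  classical
  have hs : Small.{u} {f // IsUltFun κ W f} :=
    small_of_injective (β := W) (f := fun f => ⟨f.1, f.2.1⟩) fun f g hfg => by
      simpa [Subtype.ext_iff] using hfg
  have wf := hU.wellFounded h
  let q : {f // IsUltFun κ W f} → ZFSet.{u} := wf.fix (fun f F => ZFSet.range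
    (fun g : {g : {f // IsUltFun κ W f} // AE κ U (fun ξ => ev g ξ ∈ ev f ξ)} => F g.1 g.2))
  have hq : ∀ f, q f = ZFSet.range (fun g : {g : {f // IsUltFun κ W f} //
      AE κ U (fun ξ => ev g ξ ∈ ev f ξ)} => q g.1) := fun f => wf.fix_eq _ f
  let p : ZFSet.{u} → ZFSet.{u} := fun f => if hf : IsUltFun κ W f then q ⟨f, hf⟩ else ∅
  have hp : ∀ f : {f // IsUltFun κ W f}, p f = q f := fun f => dif_pos f.2
  refine ⟨p, fun f hf x => ?_⟩
  rw [hp ⟨f, hf⟩, hq, ZFSet.mem_range]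
  constructor
  · rintro ⟨⟨g, hg⟩, rfl⟩
    exact ⟨g, g.2, hg, (hp g).symm⟩
  · rintro ⟨g, hg, hgf, rfl⟩
    exact ⟨⟨⟨g, hg⟩, hgf⟩, (hp ⟨g, hg⟩).symm⟩

namespace IsCollapse

variable {p : ZFSet.{u} → ZFSet.{u}} {f g : ZFSet.{u}}

theorem subset_of_ae (hp : IsCollapse κ W U p) (hU : IsMUltrafilter κ W U) (hf : IsUltFun κ W f)
    (hg : IsUltFun κ W g) (h : AE κ U (fun ξ => ev f ξ ⊆ ev g ξ)) : p f ⊆ p g := by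
  intro x hx
  obtain ⟨k, hk, hkf, rfl⟩ := (hp f hf x).1 hx
  have : Fact (g ∈ W) := ⟨hg.1⟩
  have : Fact (k ∈ W) := ⟨hk.1⟩
  exact hp.mem_of_ae hk hg (hU.ae_mono₂ h hkf _ fun ξ _ h1 h2 => h1 h2)

theorem eq_of_ae (hp : IsCollapse κ W U p) (hU : IsMUltrafilter κ W U) (hf : IsUltFun κ W f)
    (hg : IsUltFun κ W g) (h : AE κ U (fun ξ => ev f ξ = ev g ξ)) : p f = p g := by
  have : Fact (f ∈ W) := ⟨hf.1⟩
  have : Fact (g ∈ W) := ⟨hg.1⟩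
  exact subset_antisymm
    (hp.subset_of_ae hU hf hg (hU.ae_mono h _ fun ξ _ h => h.subset))
    (hp.subset_of_ae hU hg hf (hU.ae_mono h _ fun ξ _ h => h.symm.subset))

/-- Pointwise witnesses are assembled into one function by the choice available in `W`; this is the
existential step of Łoś's theorem. -/
theorem exists_ae_of_ae_exists (hU : IsMUltrafilter κ W U) (hf : IsUltFun κ W f)
    (P : ZFSet.{u} → ZFSet.{u} → Prop)
    [hP : Dfn (fun w : Option (Option Empty) → W => P (w none) (w (some none)))]
    (h : AE κ U (fun ξ => ∃ y ∈ ev f ξ, P ξ y)) :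
    ∃ k, IsUltFun κ W k ∧ AE κ U (fun ξ => ev k ξ ∈ ev f ξ ∧ P ξ (ev k ξ)) := by
  have : Fact (f ∈ W) := ⟨hf.1⟩
  have ha : (⋃₀ img (ev f) (ordSet κ) : ZFSet.{u}) ∈ W :=
    mem_of_tm (W := W) (⋃₀ img (fun ξ => ev f ξ) (ordSet κ))
  have := hP.swap
  obtain ⟨k, hk, hkW, hk'⟩ := exists_choice (W := W) (fun ξ y => y ∈ ev f ξ ∧ P ξ y) ha hκW.out
  have hkF : IsUltFun κ W (lam k (ordSet κ)) :=
    ⟨hk, isFunc_lam fun ξ hξ => hkW ξ (hW.transitive _ hκW.out hξ)⟩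
  have : Fact (lam k (ordSet κ) ∈ W) := ⟨hk⟩
  have : Dfn (fun w : Option Empty → W => P (w none) (ev (lam k (ordSet κ)) (w none))) :=
    hP.subst (fun o w => (o.elim (w none : ZFSet.{u}) fun _ => ev (lam k (ordSet κ)) (w none)))
      (ht := by rintro (_ | o) <;> simp only [Option.elim] <;> infer_instance)
  refine ⟨_, hkF, hU.ae_mono h _ fun ξ hξ ⟨y, hy, hPy⟩ => ?_⟩
  rw [ev_lam hξ]
  exact (hk' ξ (hW.transitive _ hκW.out hξ) ⟨y, ZFSet.mem_sUnion.2
    ⟨ev f ξ, mem_img.2 ⟨ξ, hξ, rfl⟩, hy⟩, hy, hPy⟩).2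

/-- The ultrapower is extensional, so its collapse is injective. If `f` is not included in `g`
almost everywhere, a function `k` picks elements of the difference. Then `p k` is in the common
value, hence equals some `p l` with `l` almost everywhere in `g`, and the induction hypothesis
identifies `k` with `l`. -/
theorem ae_eq_of_eq (hp : IsCollapse κ W U p) (hU : IsMUltrafilter κ W U) (hf : IsUltFun κ W f)
    (hg : IsUltFun κ W g) (h : p f = p g) : AE κ U (fun ξ => ev f ξ = ev g ξ) := by
  have key : ∀ x, ∀ f g, IsUltFun κ W f → IsUltFun κ W g → p f = x → p g = x →
      AE κ U (fun ξ => ev f ξ ⊆ ev g ξ) := by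
    intro x
    induction x using ZFSet.inductionOn with
    | _ x ih =>
      intro f g hf hg hfx hgx
      have : Fact (f ∈ W) := ⟨hf.1⟩
      have : Fact (g ∈ W) := ⟨hg.1⟩
      by_contra hne
      have h1 := (hU.ae_not (fun ξ => ev f ξ ⊆ ev g ξ)).2 hne
      obtain ⟨k, hk, h2⟩ := exists_ae_of_ae_exists hU hf (fun ξ y => y ∉ ev g ξ)
        (hU.ae_mono h1 _ (fun ξ _ hn => by
          rw [ZFSet.subset_def] at hn
          push Not at hn
          exact hn))
      have : Fact (k ∈ W) := ⟨hk.1⟩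
      have hkf : p k ∈ p f := hp.mem_of_ae hk hf (hU.ae_mono h2 _ fun ξ _ h => h.1)
      rw [hfx] at hkf
      obtain ⟨l, hl, hlg, hkl⟩ := (hp g hg (p k)).1 (hgx ▸ hkf)
      have : Fact (l ∈ W) := ⟨hl.1⟩
      have h3 := ih _ hkf k l hk hl rfl hkl.symm
      have h4 := ih _ hkf l k hl hk hkl.symm rfl
      obtain ⟨ξ, _, ⟨⟨_, h5⟩, h6⟩, h7, h8⟩ :=
        hU.ae_exists (hU.ae_and (hU.ae_and h2 hlg) (hU.ae_and h3 h4))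
      rw [subset_antisymm h7 h8] at h5
      exact h5 h6
  have : Fact (f ∈ W) := ⟨hf.1⟩
  have : Fact (g ∈ W) := ⟨hg.1⟩
  exact hU.ae_mono₂ (key _ f g hf hg rfl h.symm) (key _ g f hg hf h.symm rfl) _
    fun ξ _ h1 h2 => subset_antisymm h1 h2

theorem eq_iff (hp : IsCollapse κ W U p) (hU : IsMUltrafilter κ W U) (hf : IsUltFun κ W f)
    (hg : IsUltFun κ W g) : p f = p g ↔ AE κ U (fun ξ => ev f ξ = ev g ξ) :=
  ⟨hp.ae_eq_of_eq hU hf hg, hp.eq_of_ae hU hf hg⟩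

theorem mem_iff (hp : IsCollapse κ W U p) (hU : IsMUltrafilter κ W U) (hf : IsUltFun κ W f)
    (hg : IsUltFun κ W g) : p f ∈ p g ↔ AE κ U (fun ξ => ev f ξ ∈ ev g ξ) := by
  refine ⟨fun h => ?_, hp.mem_of_ae hf hg⟩
  have : Fact (f ∈ W) := ⟨hf.1⟩
  have : Fact (g ∈ W) := ⟨hg.1⟩
  obtain ⟨k, hk, hkg, he⟩ := (hp g hg _).1 h
  exact hU.ae_mono₂ (hp.ae_eq_of_eq hU hf hk he) hkg _ fun ξ _ h1 h2 => h1 ▸ h2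

theorem exists_ultrapowerMap (hp : IsCollapse κ W U p) (hU : IsMUltrafilter κ W U) :
    ∃ N, IsUltrapowerMap κ W U N (fun a => p (lam (fun _ => a) (ordSet κ))) ∧
      ∀ x, x ∈ N ↔ ∃ f, IsUltFun κ W f ∧ p f = x := by
  have hs : Small.{u} {f // IsUltFun κ W f} :=
    small_of_injective (β := W) (f := fun f => ⟨f.1, f.2.1⟩) fun f g hfg => by
      simpa [Subtype.ext_iff] using hfg
  have hN : ∀ x, x ∈ ZFSet.range (fun f : {f // IsUltFun κ W f} => p f) ↔
      ∃ f, IsUltFun κ W f ∧ p f = x := by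
    intro x
    simp
  refine ⟨_, ⟨?_, p, hN, fun f g hf hg => ?_, fun f g hf hg => ?_, fun a ha => ?_⟩, hN⟩
  · intro x hx y hy
    obtain ⟨f, hf, rfl⟩ := (hN x).1 hx
    obtain ⟨g, hg, _, rfl⟩ := (hp f hf y).1 hy
    exact (hN _).2 ⟨g, hg, rfl⟩
  · rw [ultEq_iff hf hg, hp.eq_iff hU hf hg]
  · rw [ultMem_iff hf hg, hp.mem_iff hU hf hg]
  · have : Fact (a ∈ W) := ⟨ha⟩
    have he : ZFSet.prod (ordSet κ) {a} = lam (fun _ => a) (ordSet κ) := by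
      ext z
      simp [ZFSet.mem_prod, mem_lam]
    rw [he]
    exact ⟨isUltFun_lam _, rfl⟩

end IsCollapse

end Ultrapower


/-! ### Satisfaction as a relation between sets -/

open FirstOrder.Language in
/-- The value of a term of the language of set theory. -/
def termVal {α : Type v} : setLang.Term α → (α → ZFSet.{u}) → ZFSet.{u}
  | .var i, a => a i
  | .func f _, _ => nomatch f

open FirstOrder.Language in
/-- Satisfaction in `⟨W, ∈⟩`. -/
def Sat (W : ZFSet.{u}) {α : Type v} :
    ∀ {n : ℕ}, setLang.BoundedFormula α n → (α → ZFSet.{u}) → (Fin n → ZFSet.{u}) → Prop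
  | _, .falsum, _, _ => False
  | _, .equal s t, a, b => termVal s (Sum.elim a b) = termVal t (Sum.elim a b)
  | _, .rel R ts, a, b => match R with
    | SetRel.mem => termVal (ts 0) (Sum.elim a b) ∈ termVal (ts 1) (Sum.elim a b)
  | _, .imp φ ψ, a, b => Sat W φ a b → Sat W ψ a b
  | _, .all φ, a, b => ∀ x ∈ W, Sat W φ a (Fin.snoc b x)

theorem coe_realize_term {W : ZFSet.{u}} {α : Type v} (t : setLang.Term α) (a : α → W) :
    ((t.realize a : W) : ZFSet.{u}) = termVal t (fun i => a i) := by
  cases t with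
  | var i => rfl
  | func f _ => exact nomatch f

theorem snoc_coe {W : ZFSet.{u}} {n : ℕ} (b : Fin n → W) (x : W) :
    (fun i => ((Fin.snoc (α := fun _ => W) b x i : W) : ZFSet.{u})) =
      Fin.snoc (α := fun _ => ZFSet.{u}) (fun i => (b i : ZFSet.{u})) (x : ZFSet.{u}) := by
  funext i
  refine Fin.lastCases ?_ (fun j => ?_) i <;> simp

theorem realize_iff_sat {W : ZFSet.{u}} {α : Type v} {n : ℕ} (φ : setLang.BoundedFormula α n)
    (a : α → W) (b : Fin n → W) : φ.Realize a b ↔ Sat W φ (fun i => a i) (fun i => b i) := by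
  have he : ∀ {n : ℕ} (b : Fin n → W), (fun i => ((Sum.elim a b i : W) : ZFSet.{u})) =
      Sum.elim (fun i => (a i : ZFSet.{u})) (fun i => (b i : ZFSet.{u})) := fun b => by
    funext i
    cases i <;> rfl
  induction φ with
  | falsum => rfl
  | equal s t =>
    simp only [Language.BoundedFormula.Realize, Sat, Subtype.ext_iff, coe_realize_term, he]
  | rel R ts =>
    cases R
    have := coe_realize_term (ts 0) (Sum.elim a b)
    have h1 := coe_realize_term (ts 1) (Sum.elim a b)
    rw [he] at this h1
    simp only [Sat]
    rw [← this, ← h1]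
    rfl
  | imp φ ψ ih1 ih2 =>
    simp only [Language.BoundedFormula.Realize, Sat, ih1, ih2]
  | all φ ih =>
    simp only [Language.BoundedFormula.Realize, Sat, ih, snoc_coe]
    exact ⟨fun h x hx => h ⟨x, hx⟩, fun h x => h x x.2⟩

theorem tm_termVal {W : ZFSet.{u}} {β : Type} {α : Type v} (t : setLang.Term α)
    (a : α → (β → W) → ZFSet.{u}) (ha : ∀ i, Tm (a i)) :
    Tm (fun v => termVal t (fun i => a i v)) := by
  cases t with
  | var i => exact ha i
  | func f _ => exact nomatch f

/-- Since `V` is an element of `W`, the quantifiers in satisfaction over `V` are bounded. The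
formula is fixed outside; no truth predicate inside `W` is needed. -/
theorem dfn_sat {W V : ZFSet.{u}} [hW : IsTransModel W] [hV : Fact (V ∈ W)] {α : Type v} {n : ℕ}
    (φ : setLang.BoundedFormula α n) : ∀ {β : Type} (a : α → (β → W) → ZFSet.{u})
      (b : Fin n → (β → W) → ZFSet.{u}), (∀ i, Tm (a i)) → (∀ i, Tm (b i)) →
      Dfn (fun v => Sat V φ (fun i => a i v) (fun i => b i v)) := by
  have he : ∀ {n : ℕ} {β : Type} (a : α → (β → W) → ZFSet.{u})
      (b : Fin n → (β → W) → ZFSet.{u}) v, Sum.elim (fun i => a i v) (fun i => b i v) =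
        fun i => Sum.elim a b i v := fun a b v => by
    funext i
    cases i <;> rfl
  induction φ with
  | falsum => exact fun a b _ _ => Dfn.prop False
  | equal s t =>
    intro β a b ha hb
    have := tm_termVal s (Sum.elim a b) (by rintro (i | i); exacts [ha i, hb i])
    have := tm_termVal t (Sum.elim a b) (by rintro (i | i); exacts [ha i, hb i])
    simp only [Sat, he]
    infer_instance
  | rel R ts =>
    cases R
    intro β a b ha hb
    have := tm_termVal (ts 0) (Sum.elim a b) (by rintro (i | i); exacts [ha i, hb i])
    have := tm_termVal (ts 1) (Sum.elim a b) (by rintro (i | i); exacts [ha i, hb i])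
    simp only [Sat, he]
    infer_instance
  | imp φ ψ ih1 ih2 =>
    intro β a b ha hb
    have := ih1 a b ha hb
    have := ih2 a b ha hb
    exact Dfn.imp _ _
  | all φ ih =>
    intro β a b ha hb
    have := ih (β := Option β) (fun i w => a i fun j => w (some j))
      (fun i w => Fin.snoc (α := fun _ => ZFSet.{u}) (fun i => b i fun j => w (some j))
        (w none : ZFSet.{u}) i) (fun i => (ha i).weaken some) (fun i => by
          refine Fin.lastCases ?_ (fun j => ?_) i
          · simp only [Fin.snoc_last]; infer_instance
          · simp only [Fin.snoc_castSucc]; exact (hb j).weaken some)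
    exact Dfn.forall_mem (fun _ => V) (fun v x => Sat V φ (fun i => a i v)
      (Fin.snoc (α := fun _ => ZFSet.{u}) (fun i => b i v) x))

/-! ### Łoś's theorem for functions with values in a set -/

/-- `f ∈ W` is a function from `κ` to `V`. -/
def IsFunTo (κ : Cardinal.{u}) (W V f : ZFSet.{u}) : Prop :=
  f ∈ W ∧ ZFSet.IsFunc (ordSet κ) V f

theorem IsFunTo.ev_mem {κ : Cardinal.{u}} {W V f ξ : ZFSet.{u}} (hf : IsFunTo κ W V f)
    (hξ : ξ ∈ ordSet κ) : ev f ξ ∈ V := IsFunc.ev_mem hf.2 hξ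

theorem isFunTo_lam {κ : Cardinal.{u}} {W V : ZFSet.{u}} [IsTransModel W]
    [Fact (ordSet κ ∈ W)] (f : ZFSet.{u} → ZFSet.{u}) [hf : Tm (fun w : Option Empty → W => f (w none))]
    (h : ∀ ξ ∈ ordSet κ, f ξ ∈ V) : IsFunTo κ W V (lam f (ordSet κ)) :=
  ⟨mem_of_tm _, isFunc_lam h⟩

theorem IsFunTo.isUltFun {κ : Cardinal.{u}} {W V : ZFSet.{u}} [hW : IsTransModel W]
    [hV : Fact (V ∈ W)] {f : ZFSet.{u}} (hf : IsFunTo κ W V f) : IsUltFun κ W f :=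
  ⟨hf.1, IsFunc.mono hf.2 fun _ hx => hW.transitive _ hV.out (hf.ev_mem hx)⟩

section Los

variable {κ : Cardinal.{u}} {W U V : ZFSet.{u}} [hW : IsTransModel W] [hκW : Fact (ordSet κ ∈ W)]
  [hV : Fact (V ∈ W)] {p : ZFSet.{u} → ZFSet.{u}}

theorem IsUltFun.exists_isFunTo (hU : IsMUltrafilter κ W U) (h0 : ∅ ∈ V) {f : ZFSet.{u}}
    (hf : IsUltFun κ W f) (h : AE κ U (fun ξ => ev f ξ ∈ V)) :
    ∃ g, IsFunTo κ W V g ∧ AE κ U (fun ξ => ev g ξ = ev f ξ) := by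
  have : Fact (f ∈ W) := ⟨hf.1⟩
  -- This is `ev f ξ` when that value lies in `V`, and `∅` otherwise; hence the requirement that `∅`
  -- be in `V`.
  let g : ZFSet.{u} → ZFSet.{u} := fun ξ => ⋃₀ ZFSet.sep (fun x => x ∈ V) {ev f ξ}
  have hg1 : ∀ ξ, ev f ξ ∈ V → g ξ = ev f ξ := fun ξ hξ => by
    have : ZFSet.sep (fun x => x ∈ V) {ev f ξ} = {ev f ξ} := by
      ext x
      simp only [ZFSet.mem_sep, ZFSet.mem_singleton]
      exact ⟨fun h => h.1, fun h => ⟨h, h ▸ hξ⟩⟩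
    simp only [g, this, ZFSet.sUnion_singleton]
  have hg2 : ∀ ξ, g ξ ∈ V := fun ξ => by
    by_cases hξ : ev f ξ ∈ V
    · rwa [hg1 ξ hξ]
    · have : ZFSet.sep (fun x => x ∈ V) {ev f ξ} = ∅ := by
        rw [ZFSet.eq_empty]
        rintro x hx
        simp only [ZFSet.mem_sep, ZFSet.mem_singleton] at hx
        exact hξ (hx.1 ▸ hx.2)
      simpa only [g, this, ZFSet.sUnion_empty]
  have : Tm (fun w : Option Empty → W => g (w none)) := by
    simp only [g]; infer_instance
  have hl := isFunTo_lam (κ := κ) (W := W) (V := V) g fun ξ _ => hg2 ξ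
  have : Fact (lam g (ordSet κ) ∈ W) := ⟨hl.1⟩
  exact ⟨_, hl, hU.ae_mono h _ fun ξ hξ h => by rw [ev_lam hξ, hg1 ξ h]⟩

theorem exists_isFunTo_of_ae_exists (hU : IsMUltrafilter κ W U) (h0 : ∅ ∈ V)
    (P : ZFSet.{u} → ZFSet.{u} → Prop)
    [hP : Dfn (fun w : Option (Option Empty) → W => P (w none) (w (some none)))]
    (h : AE κ U (fun ξ => ∃ y ∈ V, P ξ y)) :
    ∃ k, IsFunTo κ W V k ∧ AE κ U (fun ξ => P ξ (ev k ξ)) := by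
  have hc : IsUltFun κ W (lam (fun _ => V) (ordSet κ)) := isUltFun_lam _
  obtain ⟨k, hk, hk'⟩ := IsCollapse.exists_ae_of_ae_exists hU hc P
    ((IsMUltrafilter.ae_congr fun ξ hξ => by rw [ev_lam hξ]).1 h)
  have : Fact (k ∈ W) := ⟨hk.1⟩
  obtain ⟨g, hg, hgk⟩ := hk.exists_isFunTo hU h0
    (hU.ae_mono hk' _ fun ξ hξ h => by simpa only [ev_lam hξ] using h.1)
  have : Fact (g ∈ W) := ⟨hg.1⟩
  have : Dfn (fun w : Option Empty → W => P (w none) (ev g (w none))) :=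
    hP.subst (fun o w => (o.elim (w none : ZFSet.{u}) fun _ => ev g (w none)))
      (ht := by rintro (_ | o) <;> simp only [Option.elim] <;> infer_instance)
  exact ⟨g, hg, hU.ae_mono₂ hk' hgk _ fun ξ _ h1 h2 => h2 ▸ h1.2⟩

namespace IsCollapse

theorem mem_const_iff (hp : IsCollapse κ W U p) (hU : IsMUltrafilter κ W U) (h0 : ∅ ∈ V)
    {x : ZFSet.{u}} :
    x ∈ p (lam (fun _ => V) (ordSet κ)) ↔ ∃ f, IsFunTo κ W V f ∧ x = p f := by
  have hc : IsUltFun κ W (lam (fun _ => V) (ordSet κ)) := isUltFun_lam _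
  constructor
  · intro hx
    obtain ⟨f, hf, hfV, rfl⟩ := (hp _ hc x).1 hx
    obtain ⟨g, hg, hgf⟩ := hf.exists_isFunTo hU h0
      ((IsMUltrafilter.ae_congr fun ξ hξ => by rw [ev_lam hξ]).1 hfV)
    exact ⟨g, hg, (hp.eq_of_ae hU hg.isUltFun hf hgf).symm⟩
  · rintro ⟨f, hf, rfl⟩
    exact hp.mem_of_ae hf.isUltFun hc (hU.ae_of_forall fun ξ hξ => by
      rw [ev_lam hξ]; exact hf.ev_mem hξ)

theorem isTransitive_const (hp : IsCollapse κ W U p) (hU : IsMUltrafilter κ W U) (h0 : ∅ ∈ V)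
    (hVt : V.IsTransitive) : (p (lam (fun _ => V) (ordSet κ))).IsTransitive := by
  have hc : IsUltFun κ W (lam (fun _ => V) (ordSet κ)) := isUltFun_lam _
  intro x hx
  obtain ⟨f, hf, rfl⟩ := (hp.mem_const_iff hU h0).1 hx
  exact hp.subset_of_ae hU hf.isUltFun hc (hU.ae_of_forall fun ξ hξ => by
    rw [ev_lam hξ]; exact hVt _ (hf.ev_mem hξ))

/-- Induction on the formula. Atomic formulas are the description of the collapse, implications use
that `U` is ultra, and in the universal case a function into `V` choosing counterexamples is found
in `W`. -/
theorem sat_iff (hp : IsCollapse κ W U p) (hU : IsMUltrafilter κ W U) (h0 : ∅ ∈ V)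
    {α : Type v} {n : ℕ} (φ : setLang.BoundedFormula α n) (a : α → ZFSet.{u})
    (b : Fin n → ZFSet.{u}) (ha : ∀ i, IsFunTo κ W V (a i)) (hb : ∀ i, IsFunTo κ W V (b i)) :
    Sat (p (lam (fun _ => V) (ordSet κ))) φ (fun i => p (a i)) (fun i => p (b i)) ↔
      AE κ U (fun ξ => Sat V φ (fun i => ev (a i) ξ) (fun i => ev (b i) ξ)) := by
  have hD : ∀ {n : ℕ} (φ : setLang.BoundedFormula α n) (b : Fin n → ZFSet.{u}),
      (∀ i, IsFunTo κ W V (b i)) → Dfn (fun w : Option Empty → W =>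
        Sat V φ (fun i => ev (a i) (w none)) (fun i => ev (b i) (w none))) := by
    intro n φ b hb
    have : ∀ i, Fact (a i ∈ W) := fun i => ⟨(ha i).1⟩
    have : ∀ i, Fact (b i ∈ W) := fun i => ⟨(hb i).1⟩
    exact dfn_sat φ (fun i (w : Option Empty → W) => ev (a i) (w none))
      (fun i w => ev (b i) (w none)) (fun i => inferInstance) (fun i => inferInstance)
  have ht : ∀ {n : ℕ} (t : setLang.Term (α ⊕ Fin n)) (b : Fin n → ZFSet.{u}),
      (∀ i, IsFunTo κ W V (b i)) → ∃ f, IsFunTo κ W V f ∧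
        termVal t (Sum.elim (fun i => p (a i)) (fun i => p (b i))) = p f ∧
        ∀ ξ, termVal t (Sum.elim (fun i => ev (a i) ξ) (fun i => ev (b i) ξ)) = ev f ξ := by
    intro n t b hb
    cases t with
    | var i =>
      rcases i with i | i
      · exact ⟨a i, ha i, rfl, fun _ => rfl⟩
      · exact ⟨b i, hb i, rfl, fun _ => rfl⟩
    | func f _ => exact nomatch f
  induction φ with
  | falsum =>
    exact ⟨False.elim, fun h => (hU.ae_exists h).elim fun _ h => h.2⟩
  | equal s t =>
    obtain ⟨f, hf, h1, h2⟩ := ht s b hb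
    obtain ⟨g, hg, h3, h4⟩ := ht t b hb
    simp only [Sat, h1, h2, h3, h4]
    exact hp.eq_iff hU hf.isUltFun hg.isUltFun
  | rel R ts =>
    cases R
    obtain ⟨f, hf, h1, h2⟩ := ht (ts 0) b hb
    obtain ⟨g, hg, h3, h4⟩ := ht (ts 1) b hb
    simp only [Sat, h1, h2, h3, h4]
    exact hp.mem_iff hU hf.isUltFun hg.isUltFun
  | imp φ ψ ih1 ih2 =>
    have := hD φ b hb
    have := hD ψ b hb
    refine (imp_congr (ih1 b hb) (ih2 b hb)).trans ?_
    change _ ↔ AE κ U (fun ξ => Sat V φ (fun i => ev (a i) ξ) (fun i => ev (b i) ξ) →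
      Sat V ψ (fun i => ev (a i) ξ) (fun i => ev (b i) ξ))
    constructor
    · intro h
      by_cases h1 : AE κ U (fun ξ => Sat V φ (fun i => ev (a i) ξ) (fun i => ev (b i) ξ))
      · exact hU.ae_mono (h h1) _ fun ξ _ h _ => h
      · exact hU.ae_mono ((hU.ae_not _).2 h1) _ fun ξ _ h h' => absurd h' h
    · intro h h1
      exact hU.ae_mono₂ h h1 _ fun ξ _ h h' => h h'
  | all φ ih =>
    have hsn : ∀ {n : ℕ} (b : Fin n → ZFSet.{u}) x (F : ZFSet.{u} → ZFSet.{u}),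
        (fun i => F (Fin.snoc (α := fun _ => ZFSet.{u}) b x i)) =
          Fin.snoc (α := fun _ => ZFSet.{u}) (fun i => F (b i)) (F x) := by
      intro n b x F
      funext i
      refine Fin.lastCases ?_ (fun j => ?_) i <;> simp
    have hbx : ∀ x, IsFunTo κ W V x → ∀ i, IsFunTo κ W V
        (Fin.snoc (α := fun _ => ZFSet.{u}) b x i) := by
      intro x hx i
      refine Fin.lastCases ?_ (fun j => ?_) i
      · simpa only [Fin.snoc_last]
      · simpa only [Fin.snoc_castSucc] using hb j
    have hDa := hD (φ.all) b hb
    simp only [Sat] at hDa ⊢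
    constructor
    · intro h
      by_contra hne
      have h1 := (hU.ae_not _).2 hne
      have : ∀ i, Fact (a i ∈ W) := fun i => ⟨(ha i).1⟩
      have : ∀ i, Fact (b i ∈ W) := fun i => ⟨(hb i).1⟩
      have hQ : Dfn (fun w : Option (Option Empty) → W => Sat V φ (fun i => ev (a i) (w none))
          (Fin.snoc (α := fun _ => ZFSet.{u}) (fun i => ev (b i) (w none))
            (w (some none) : ZFSet.{u}))) :=
        dfn_sat φ (fun i (w : Option (Option Empty) → W) => ev (a i) (w none))
          (fun i w => Fin.snoc (α := fun _ => ZFSet.{u}) (fun i => ev (b i) (w none))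
            (w (some none) : ZFSet.{u}) i)
          (fun i => inferInstance) (fun i => by
            refine Fin.lastCases ?_ (fun j => ?_) i
            · simp only [Fin.snoc_last]; infer_instance
            · simp only [Fin.snoc_castSucc]; infer_instance)
      obtain ⟨k, hk, hk'⟩ := exists_isFunTo_of_ae_exists hU h0 (fun ξ y => ¬ Sat V φ
          (fun i => ev (a i) ξ) (Fin.snoc (α := fun _ => ZFSet.{u}) (fun i => ev (b i) ξ) y))
        ((IsMUltrafilter.ae_congr fun ξ _ => by push Not; rfl).1 h1)
      have h2 := (ih _ (hbx k hk)).1 (by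
        rw [hsn b k p]
        exact h _ ((hp.mem_const_iff hU h0).2 ⟨k, hk, rfl⟩))
      obtain ⟨ξ, _, h3, h4⟩ := hU.ae_exists (hU.ae_and hk' h2)
      rw [hsn b k (fun x => ev x ξ)] at h4
      exact h3 h4
    · intro h x hx
      obtain ⟨k, hk, rfl⟩ := (hp.mem_const_iff hU h0).1 hx
      have hDk := hD φ _ (hbx k hk)
      have h2 := (ih _ (hbx k hk)).2 (hU.ae_mono h _ fun ξ hξ h => by
        rw [hsn b k (fun x => ev x ξ)]
        exact h _ (hk.ev_mem hξ))
      rwa [hsn b k p] at h2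

end IsCollapse

end Los


/-! ### First-order properties of transitive sets, uniformly in the set -/

/-- `P` is expressed by one first-order formula in all transitive sets. -/
class FO {β : Type v} (P : ∀ W : ZFSet.{u}, (β → W) → Prop) : Prop where
  out : ∃ φ : setLang.Formula β, ∀ W : ZFSet.{u}, W.IsTransitive → ∀ v : β → W,
    φ.Realize v ↔ P W v

section FO

variable {β γ : Type v}

theorem FO.congr {P Q : ∀ W : ZFSet.{u}, (β → W) → Prop} (h : FO P)
    (e : ∀ W, W.IsTransitive → ∀ v, Q W v ↔ P W v) : FO Q := by
  obtain ⟨φ, hφ⟩ := h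
  exact ⟨φ, fun W hW v => (hφ W hW v).trans (e W hW v).symm⟩

theorem FO.realize (φ : setLang.Formula γ) (f : γ → β) :
    FO.{u} (fun W (v : β → W) => φ.Realize (fun i => v (f i))) :=
  ⟨φ.relabel f, fun _ _ _ => Language.Formula.realize_relabel⟩

instance FO.mem (i j : β) : FO.{u} (fun _ v => (v i : ZFSet.{u}) ∈ (v j : ZFSet.{u})) :=
  ⟨Language.Relations.formula₂ (L := setLang) SetRel.mem (.var i) (.var j), fun _ _ _ => Iff.rfl⟩

instance FO.eq (i j : β) : FO.{u} (fun _ v => v i = v j) :=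
  ⟨(Language.Term.var i).equal (.var j), fun _ _ _ => Iff.rfl⟩

instance FO.not (P : ∀ W : ZFSet.{u}, (β → W) → Prop) [h : FO P] : FO (fun W v => ¬ P W v) := by
  obtain ⟨φ, hφ⟩ := h
  exact ⟨φ.not, fun W hW v => not_congr (hφ W hW v)⟩

instance FO.imp (P Q : ∀ W : ZFSet.{u}, (β → W) → Prop) [hP : FO P] [hQ : FO Q] :
    FO (fun W v => P W v → Q W v) := by
  obtain ⟨φ, hφ⟩ := hP
  obtain ⟨ψ, hψ⟩ := hQ
  exact ⟨φ.imp ψ, fun W hW v => imp_congr (hφ W hW v) (hψ W hW v)⟩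

instance FO.or (P Q : ∀ W : ZFSet.{u}, (β → W) → Prop) [hP : FO P] [hQ : FO Q] :
    FO (fun W v => P W v ∨ Q W v) :=
  FO.congr (P := fun W v => ¬ P W v → Q W v) inferInstance fun _ _ _ => or_iff_not_imp_left

instance FO.and (P Q : ∀ W : ZFSet.{u}, (β → W) → Prop) [hP : FO P] [hQ : FO Q] :
    FO (fun W v => P W v ∧ Q W v) :=
  FO.congr (P := fun W v => ¬ (P W v → ¬ Q W v)) inferInstance fun _ _ _ => by push Not; rfl

instance FO.iff (P Q : ∀ W : ZFSet.{u}, (β → W) → Prop) [hP : FO P] [hQ : FO Q] :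
    FO (fun W v => P W v ↔ Q W v) :=
  FO.congr (P := fun W v => (P W v → Q W v) ∧ (Q W v → P W v)) inferInstance
    fun _ _ _ => iff_iff_implies_and_implies

instance FO.forall (P : ∀ W : ZFSet.{u}, (β → W) → W → Prop)
    [h : FO (fun W (w : Option β → W) => P W (fun i => w (some i)) (w none))] :
    FO (fun W v => ∀ x : W, P W v x) := by
  obtain ⟨φ, hφ⟩ := h
  let f : Option β → β ⊕ Unit := fun o => o.elim (Sum.inr ()) Sum.inl
  refine ⟨(φ.relabel f).iAlls Unit, fun W hW v => ?_⟩
  rw [Language.Formula.Realize, Language.BoundedFormula.realize_iAlls]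
  simp only [Language.Formula.realize_relabel]
  constructor
  · intro h x
    exact (hφ W hW _).1 (h fun _ => x)
  · intro h x
    exact (hφ W hW _).2 (h (x ()))

instance FO.exists (P : ∀ W : ZFSet.{u}, (β → W) → W → Prop)
    [h : FO (fun W (w : Option β → W) => P W (fun i => w (some i)) (w none))] :
    FO (fun W v => ∃ x : W, P W v x) :=
  FO.congr (P := fun W v => ¬ ∀ x : W, ¬ P W v x) inferInstance fun _ _ _ => by push Not; rfl

/-- A transitive set need not be closed under pairing. But a pair that belongs to one of its
elements is an element itself, and so are the two members of the pair, so it can be decoded inside.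
-/
instance FO.pair_mem (i j k : β) :
    FO.{u} (fun _ v => ZFSet.pair (v i : ZFSet.{u}) (v j : ZFSet.{u}) ∈ (v k : ZFSet.{u})) := by
  refine FO.congr (P := fun W v => ∃ q : W, q.1 ∈ (v k).1 ∧ ∃ s : W, ∃ t : W,
    (∀ z : W, z.1 ∈ q.1 ↔ z = s ∨ z = t) ∧ (∀ z : W, z.1 ∈ s.1 ↔ z = v i) ∧
      (∀ z : W, z.1 ∈ t.1 ↔ z = v i ∨ z = v j)) inferInstance fun W hW v => ?_
  constructor
  · intro h
    have hp := hW _ (v k).2 h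
    have hs : ({(v i).1} : ZFSet.{u}) ∈ W := hW _ hp (by simp [ZFSet.pair])
    have ht : ({(v i).1, (v j).1} : ZFSet.{u}) ∈ W := hW _ hp (by simp [ZFSet.pair])
    refine ⟨⟨_, hp⟩, h, ⟨_, hs⟩, ⟨_, ht⟩, fun z => ?_, fun z => ?_, fun z => ?_⟩
    · change z.1 ∈ ({{(v i).1}, {(v i).1, (v j).1}} : ZFSet.{u}) ↔ _
      rw [ZFSet.mem_pair, Subtype.ext_iff, Subtype.ext_iff]
    · rw [ZFSet.mem_singleton, Subtype.ext_iff]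
    · rw [ZFSet.mem_pair, Subtype.ext_iff, Subtype.ext_iff]
  · rintro ⟨q, hq, s, t, h1, h2, h3⟩
    have hs : s.1 = {(v i).1} := by
      ext z
      rw [ZFSet.mem_singleton]
      exact ⟨fun hz => congrArg Subtype.val ((h2 ⟨z, hW _ s.2 hz⟩).1 hz),
        fun hz => hz ▸ (h2 (v i)).2 rfl⟩
    have ht : t.1 = {(v i).1, (v j).1} := by
      ext z
      rw [ZFSet.mem_pair]
      constructor
      · intro hz
        exact ((h3 ⟨z, hW _ t.2 hz⟩).1 hz).imp (congrArg Subtype.val) (congrArg Subtype.val)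
      · rintro (rfl | rfl)
        · exact (h3 (v i)).2 (Or.inl rfl)
        · exact (h3 (v j)).2 (Or.inr rfl)
    have : q.1 = ZFSet.pair (v i).1 (v j).1 := by
      rw [ZFSet.pair, ← hs, ← ht]
      ext z
      rw [ZFSet.mem_pair]
      constructor
      · intro hz
        exact ((h1 ⟨z, hW _ q.2 hz⟩).1 hz).imp (congrArg Subtype.val) (congrArg Subtype.val)
      · rintro (rfl | rfl)
        · exact (h1 s).2 (Or.inl rfl)
        · exact (h1 t).2 (Or.inr rfl)
    exact this ▸ hq

end FO

/-- Elements of the image of `V` have representatives with all values in `V`, so the property holds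
at every `ξ` and Łoś's theorem applies. With free variables it carries over schemes, the variables
being the parameters. -/
theorem IsCollapse.transfer {κ : Cardinal.{u}} {W U V : ZFSet.{u}} [hW : IsTransModel W]
    [hκW : Fact (ordSet κ ∈ W)] [hV : Fact (V ∈ W)] {p : ZFSet.{u} → ZFSet.{u}}
    (hp : IsCollapse κ W U p) (hU : IsMUltrafilter κ W U) (h0 : ∅ ∈ V) (hVt : V.IsTransitive)
    {β : Type v} (P : ∀ W : ZFSet.{u}, (β → W) → Prop) [hP : FO P] (h : ∀ v, P V v) :
    ∀ v, P (p (lam (fun _ => V) (ordSet κ))) v := by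
  intro v
  obtain ⟨φ, hφ⟩ := hP
  rw [← hφ _ (hp.isTransitive_const hU h0 hVt), Language.Formula.Realize, realize_iff_sat]
  choose f hf hv using fun i => (hp.mem_const_iff hU h0).1 (v i).2
  have := (hp.sat_iff hU h0 φ f Fin.elim0 hf (fun i => i.elim0)).2 (hU.ae_of_forall fun ξ hξ => by
    have := (hφ V hVt fun i => ⟨ev (f i) ξ, (hf i).ev_mem hξ⟩).2 (h _)
    rw [Language.Formula.Realize, realize_iff_sat] at this
    convert this using 2)
  convert this using 2
  exact hv _


/-! ### `V_κ` is a model of `ZFC`, and so are its images -/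

section VKappa

variable {κ : Cardinal.{u}}

theorem sUnion_mem_V {x : ZFSet.{u}} (hx : x ∈ V_ κ.ord) : (⋃₀ x : ZFSet.{u}) ∈ V_ κ.ord := by
  rw [ZFSet.mem_vonNeumann] at *
  exact (ZFSet.rank_sUnion_le x).trans_lt hx

theorem powerset_mem_V (hi : κ.IsInaccessible) {x : ZFSet.{u}} (hx : x ∈ V_ κ.ord) :
    x.powerset ∈ V_ κ.ord := by
  rw [ZFSet.mem_vonNeumann] at *
  rw [ZFSet.rank_powerset]
  exact (Cardinal.isSuccLimit_ord hi.1.le).succ_lt hx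

theorem empty_mem_V (hi : κ.IsInaccessible) : ∅ ∈ V_ κ.ord := by
  rw [ZFSet.mem_vonNeumann, ZFSet.rank_empty]
  exact (Cardinal.isSuccLimit_ord hi.1.le).bot_lt

theorem img_mem_V (hi : κ.IsInaccessible) {x : ZFSet.{u}} {f : ZFSet.{u} → ZFSet.{u}}
    (hx : x ∈ V_ κ.ord) (hf : ∀ y ∈ x, f y ∈ V_ κ.ord) : img f x ∈ V_ κ.ord := by
  refine mem_V_of_card_lt hi (fun z hz => ?_) (card_img_le.trans_lt (card_lt_of_mem_V hi hx))
  obtain ⟨y, hy, rfl⟩ := mem_img.1 hz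
  exact hf y hy

theorem modelsBase_V (hi : κ.IsInaccessible) : ModelsBase (V_ κ.ord) where
  nonempty := ⟨∅, empty_mem_V hi⟩
  extensionality a b h := by
    refine Subtype.ext (ZFSet.ext fun z => ⟨fun hz => ?_, fun hz => ?_⟩)
    · exact (h ⟨z, V_transitive _ a.2 hz⟩).1 hz
    · exact (h ⟨z, V_transitive _ b.2 hz⟩).2 hz
  foundation a := by
    rintro ⟨x, hx⟩
    obtain ⟨y, hy, h⟩ := ZFSet.regularity a.1 (fun h => by simp [h] at hx)
    refine ⟨⟨y, V_transitive _ a.2 hy⟩, hy, fun z hz hzy => ?_⟩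
    exact ZFSet.notMem_empty z.1 (h ▸ ZFSet.mem_inter.2 ⟨hz, hzy⟩)
  pairing a b := ⟨⟨_, insert_singleton_mem_V hi a.2 b.2⟩, fun x => by
    rw [ZFSet.mem_pair, Subtype.ext_iff, Subtype.ext_iff]⟩
  union a := ⟨⟨_, sUnion_mem_V a.2⟩, fun x => by
    rw [ZFSet.mem_sUnion]
    exact ⟨fun ⟨y, hy, h⟩ => ⟨⟨y, V_transitive _ a.2 hy⟩, hy, h⟩, fun ⟨y, h⟩ => ⟨y, h⟩⟩⟩
  infinity := by
    have hω : Ordinal.omega0.toZFSet ∈ V_ κ.ord := by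
      refine ordSet_subset_V (toZFSet_mem_ordSet.2 ?_)
      rw [← Cardinal.ord_aleph0, Cardinal.ord_lt_ord]
      exact hi.1
    refine ⟨⟨_, hω⟩, ⟨⟨∅, empty_mem_V hi⟩, ?_, fun z => ZFSet.notMem_empty _⟩, ?_⟩
    · exact Ordinal.mem_toZFSet_iff.2 ⟨0, Ordinal.omega0_pos, by simp⟩
    · rintro ⟨n, hn⟩ hn'
      obtain ⟨a, ha, rfl⟩ := Ordinal.mem_toZFSet_iff.1 hn'
      have hs : (a + 1).toZFSet ∈ Ordinal.omega0.toZFSet :=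
        Ordinal.toZFSet_mem_toZFSet_iff.2 (Ordinal.isSuccLimit_omega0.add_one_lt ha)
      refine ⟨⟨_, V_transitive _ hω hs⟩, hs, fun z => ?_⟩
      change z.1 ∈ (a + 1).toZFSet ↔ _
      rw [Ordinal.toZFSet_add_one, ZFSet.mem_insert_iff, Subtype.ext_iff, or_comm]
  separation D _ a := by
    refine ⟨⟨ZFSet.sep (fun x => ∃ h, (⟨x, h⟩ : (V_ κ.ord : ZFSet.{u})) ∈ D) a.1,
      ZFSet.mem_vonNeumann_of_subset (fun x hx => (ZFSet.mem_sep.1 hx).1) a.2⟩, fun x => ?_⟩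
    rw [ZFSet.mem_sep]
    exact and_congr_right fun _ => ⟨fun ⟨_, h⟩ => h, fun h => ⟨x.2, h⟩⟩

theorem modelsZFC_V (hi : κ.IsInaccessible) : ModelsZFC (V_ κ.ord) where
  toModelsBase := modelsBase_V hi
  powerset a := ⟨⟨_, powerset_mem_V hi a.2⟩, fun x => by
    rw [ZFSet.mem_powerset]
    exact ⟨fun h y hy => h hy, fun h y hy => h ⟨y, V_transitive _ x.2 hy⟩ hy⟩⟩
  replacement R _ a h := by
    classical
    let f : ZFSet.{u} → ZFSet.{u} := fun x => if hx : ∃ h, ∃ y,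
      ((⟨x, h⟩ : (V_ κ.ord : ZFSet.{u})), y) ∈ R then hx.choose_spec.choose.1 else ∅
    have hf : ∀ x y, x.1 ∈ a.1 → (x, y) ∈ R → f x.1 = y := by
      intro x y hxa hxy
      have hx : ∃ h, ∃ y, ((⟨x, h⟩ : (V_ κ.ord : ZFSet.{u})), y) ∈ R := ⟨x.2, y, hxy⟩
      simp only [f, dif_pos hx]
      exact congrArg Subtype.val (h x _ y hxa hx.choose_spec.choose_spec hxy)
    have hm : ZFSet.sep (fun y => ∃ h, ∃ x, x.1 ∈ a.1 ∧
        (x, (⟨y, h⟩ : (V_ κ.ord : ZFSet.{u}))) ∈ R) (V_ κ.ord) ∈ V_ κ.ord := by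
      refine mem_V_of_card_lt hi (fun x hx => (ZFSet.mem_sep.1 hx).1) ?_
      refine lt_of_le_of_lt ((ZFSet.card_mono fun y hy => ?_).trans (card_img_le (f := f)))
        (card_lt_of_mem_V hi a.2)
      obtain ⟨_, hy, x, hx, hxy⟩ := ZFSet.mem_sep.1 hy
      exact mem_img.2 ⟨x, hx, (hf x _ hx hxy).symm⟩
    refine ⟨⟨_, hm⟩, fun y => ?_⟩
    rw [ZFSet.mem_sep]
    exact ⟨fun ⟨_, _, h⟩ => h, fun h => ⟨y.2, y.2, h⟩⟩
  choice a h0 h1 := by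
    classical
    let f : ZFSet.{u} → ZFSet.{u} := fun x => if hx : ∃ y, y ∈ x then hx.choose else ∅
    have hf : ∀ x ∈ a.1, f x ∈ x := fun x hx => by
      obtain ⟨y, hy⟩ := h0 ⟨x, V_transitive _ a.2 hx⟩ hx
      have hex : ∃ y, y ∈ x := ⟨y, hy⟩
      simp only [f, dif_pos hex]
      exact hex.choose_spec
    have hV : ∀ {x}, x ∈ a.1 → x ∈ V_ κ.ord := fun hx => V_transitive _ a.2 hx
    have hfV : ∀ x ∈ a.1, f x ∈ V_ κ.ord := fun x hx => V_transitive _ (hV hx) (hf x hx)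
    refine ⟨⟨_, img_mem_V hi a.2 hfV⟩, fun x hx => ⟨⟨f x, hfV _ hx⟩,
      ⟨hf _ hx, mem_img.2 ⟨x, hx, rfl⟩⟩, ?_⟩⟩
    rintro y ⟨hyx, hy⟩
    obtain ⟨z, hz, hyz⟩ := mem_img.1 hy
    refine Subtype.ext ?_
    have : x = ⟨z, hV hz⟩ := h1 x ⟨z, hV hz⟩ y hx hz hyx (hyz ▸ hf z hz)
    exact hyz.trans (congrArg f (congrArg Subtype.val this).symm)

theorem modelsZFCMinus_V (hi : κ.IsInaccessible) : ModelsZFCMinus (V_ κ.ord) where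
  toModelsBase := modelsBase_V hi
  collection R _ a h := by
    classical
    let f : ZFSet.{u} → ZFSet.{u} := fun x => if hx : ∃ h, ∃ y,
      ((⟨x, h⟩ : (V_ κ.ord : ZFSet.{u})), y) ∈ R then hx.choose_spec.choose.1 else ∅
    have hf : ∀ x, x.1 ∈ a.1 → ∃ h, (x, (⟨f x.1, h⟩ : (V_ κ.ord : ZFSet.{u}))) ∈ R := by
      intro x hxa
      obtain ⟨y, hxy⟩ := h x hxa
      have hx : ∃ h, ∃ y, ((⟨x, h⟩ : (V_ κ.ord : ZFSet.{u})), y) ∈ R := ⟨x.2, y, hxy⟩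
      simp only [f, dif_pos hx]
      exact ⟨hx.choose_spec.choose.2, hx.choose_spec.choose_spec⟩
    have hfV : ∀ x ∈ a.1, f x ∈ V_ κ.ord := fun x hx =>
      (hf ⟨x, V_transitive _ a.2 hx⟩ hx).choose
    refine ⟨⟨_, img_mem_V hi a.2 hfV⟩, fun x hx => ?_⟩
    obtain ⟨h2, h3⟩ := hf x hx
    exact ⟨⟨_, h2⟩, mem_img.2 ⟨x, hx, rfl⟩, h3⟩
  wellOrdering a := by
    have hV : ∀ {x}, x ∈ a.1 → x ∈ V_ κ.ord := fun hx => V_transitive _ a.2 hx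
    have hr : ZFSet.sep (fun q => ∃ x y, WellOrderingRel x y ∧ q = ZFSet.pair x y)
        (ZFSet.prod a.1 a.1) ∈ V_ κ.ord := by
      refine ZFSet.mem_vonNeumann_of_subset (y := a.1.powerset.powerset) (fun z hz => ?_)
        (powerset_mem_V hi (powerset_mem_V hi a.2))
      obtain ⟨x, hx, y, hy, rfl⟩ := ZFSet.mem_prod.1 (ZFSet.mem_sep.1 hz).1
      rw [ZFSet.mem_powerset]
      intro w hw
      rw [ZFSet.mem_powerset]
      intro t ht
      rcases ZFSet.mem_pair.1 hw with rfl | rfl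
      · rwa [ZFSet.mem_singleton.1 ht]
      · rcases ZFSet.mem_pair.1 ht with rfl | rfl <;> assumption
    have hr' : ∀ {x y}, x ∈ a.1 → y ∈ a.1 → (ZFSet.pair x y ∈ ZFSet.sep
        (fun q => ∃ x y, WellOrderingRel x y ∧ q = ZFSet.pair x y) (ZFSet.prod a.1 a.1) ↔
          WellOrderingRel x y) := by
      intro x y hx hy
      rw [ZFSet.mem_sep, ZFSet.pair_mem_prod]
      constructor
      · rintro ⟨_, x', y', h, he⟩
        obtain ⟨rfl, rfl⟩ := ZFSet.pair_injective he
        exact h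
      · exact fun h => ⟨⟨hx, hy⟩, x, y, h, rfl⟩
    refine ⟨⟨_, hr⟩, fun x hx => ?_, fun x y z hx hy hz => ?_, fun x y hx hy => ?_,
      fun b hb hb' => ?_⟩
    · rw [hr' hx hx]
      exact irrefl _
    · rw [hr' hx hy, hr' hy hz, hr' hx hz]
      exact fun h h' => _root_.trans h h'
    · rw [hr' hx hy, hr' hy hx, Subtype.ext_iff]
      exact trichotomous_of WellOrderingRel x.1 y.1
    · obtain ⟨x, hx⟩ := hb'
      have wf : WellFounded (WellOrderingRel (α := ZFSet.{u})) := WellOrderingRel.isWellOrder.wf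
      obtain ⟨m, hm, h⟩ := wf.has_min {z | z ∈ b.1} ⟨x, hx⟩
      have hba : ∀ z ∈ b.1, z ∈ a.1 := fun z hz => hb ⟨z, V_transitive _ b.2 hz⟩ hz
      refine ⟨⟨m, V_transitive _ b.2 hm⟩, hm, fun z hz hzm => ?_⟩
      rw [hr' (hba m hm) (hba z hz)]
      rcases trichotomous_of WellOrderingRel m z.1 with h1 | h1 | h1
      · exact h1
      · exact absurd (Subtype.ext h1.symm) hzm
      · exact absurd h1 (h _ hz)

end VKappa

theorem FO.realize₂ {β γ : Type v} (φ : setLang.Formula (γ ⊕ Fin 2)) (f : γ → β) (i j : β) :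
    FO.{u} (fun W (w : β → W) => φ.Realize (Sum.elim (fun k => w (f k)) ![w i, w j])) :=
  (FO.realize (β := β) φ (Sum.elim f ![i, j])).congr fun W _ v => by
    refine iff_of_eq (congrArg φ.Realize (funext fun k => ?_))
    rcases k with k | k
    · rfl
    · refine Fin.cases rfl (fun k => ?_) k
      refine Fin.cases rfl (fun k => k.elim0) k

theorem definable₁_realize {V : ZFSet.{u}} {β : Type*} (φ : setLang.Formula (β ⊕ Fin 1))
    (v : β → V) :
    (Set.univ : Set V).Definable₁ setLang {x | φ.Realize (Sum.elim v fun _ => x)} := by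
  refine Set.definable_iff_exists_formula_sum.2
    ⟨φ.relabel (Sum.map (fun i => ⟨v i, Set.mem_univ _⟩) id), ?_⟩
  ext x
  refine Iff.trans ?_ Language.Formula.realize_relabel.symm
  refine iff_of_eq (congrArg φ.Realize (funext fun i => ?_))
  rcases i with i | i
  · rfl
  · exact congrArg x (Subsingleton.elim _ _)

theorem definable₂_realize {V : ZFSet.{u}} {β : Type*} (φ : setLang.Formula (β ⊕ Fin 2))
    (v : β → V) :
    (Set.univ : Set V).Definable₂ setLang {q | φ.Realize (Sum.elim v ![q.1, q.2])} := by
  refine Set.definable_iff_exists_formula_sum.2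
    ⟨φ.relabel (Sum.map (fun i => ⟨v i, Set.mem_univ _⟩) id), ?_⟩
  ext x
  refine Iff.trans ?_ Language.Formula.realize_relabel.symm
  refine iff_of_eq (congrArg φ.Realize (funext fun i => ?_))
  rcases i with i | i
  · rfl
  · refine Fin.cases rfl (fun i => ?_) i
    refine Fin.cases rfl (fun i => i.elim0) i

/-! ### The axioms of ZFC and ZFC⁻ in the image of a model -/

section Transfer

variable {κ : Cardinal.{u}} {W U V : ZFSet.{u}} [hW : IsTransModel W] [hκW : Fact (ordSet κ ∈ W)]
  [hV : Fact (V ∈ W)] {p : ZFSet.{u} → ZFSet.{u}}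

namespace IsCollapse

theorem modelsBase (hp : IsCollapse κ W U p) (hU : IsMUltrafilter κ W U) (h0 : ∅ ∈ V)
    (hVt : V.IsTransitive) (h : ModelsBase V) :
    ModelsBase (p (lam (fun _ => V) (ordSet κ))) := by
  have T := fun (P : ∀ W : ZFSet.{u}, (Empty → W) → Prop) [FO P] (h : ∀ v, P V v) =>
    hp.transfer hU h0 hVt P h (fun e => e.elim)
  refine ⟨?_, ?_, ?_, ?_, ?_, ?_, ?_⟩
  · obtain ⟨x, hx⟩ := h.nonempty
    obtain ⟨x, -⟩ := T (fun W _ => ∃ x : W, x = x) fun _ => ⟨⟨x, hx⟩, rfl⟩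
    exact ⟨x, x.2⟩
  · exact T (fun W _ => ∀ a b : W, (∀ x : W, x.1 ∈ a.1 ↔ x.1 ∈ b.1) → a = b)
      fun _ => h.extensionality
  · exact T (fun M _ => ∀ a : M, (∃ x : M, x.1 ∈ a.1) →
      ∃ x : M, x.1 ∈ a.1 ∧ ∀ y : M, y.1 ∈ a.1 → y.1 ∉ x.1) fun _ => h.foundation
  · exact T (fun M _ => ∀ a b : M, ∃ c : M, ∀ x : M, x.1 ∈ c.1 ↔ x = a ∨ x = b)
      fun _ => h.pairing
  · exact T (fun M _ => ∀ a : M, ∃ c : M, ∀ x : M, x.1 ∈ c.1 ↔ ∃ y : M, y.1 ∈ a.1 ∧ x.1 ∈ y.1)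
      fun _ => h.union
  · exact T (fun M _ => ∃ w : M, (∃ e : M, e.1 ∈ w.1 ∧ ∀ z : M, z.1 ∉ e.1) ∧
      ∀ n : M, n.1 ∈ w.1 → ∃ s : M, s.1 ∈ w.1 ∧ ∀ z : M, z.1 ∈ s.1 ↔ z.1 ∈ n.1 ∨ z = n)
      fun _ => h.infinity
  · intro D hD
    -- The parameters of `D` lie in the image and not in `V`. So the instance of separation for `φ`
    -- is taken in `V` with arbitrary parameters, and transferred as a single statement.
    obtain ⟨φ, hφ⟩ := Set.definable_iff_exists_formula_sum.1 hD
    have hφ' : ∀ x, x ∈ D ↔ φ.Realize (Sum.elim (fun i => i.1) fun _ => x) := fun x =>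
      Set.ext_iff.1 hφ fun _ => x
    have hF : FO.{u} (fun W (w : Option (Option (Option
        (Set.univ : Set (p (lam (fun _ => V) (ordSet κ)) : ZFSet.{u})))) → W) =>
        φ.Realize (Sum.elim (fun i => w (some (some (some i)))) fun _ => w none)) :=
      (FO.realize φ (Sum.elim (fun i => some (some (some i))) fun _ => none)).congr
        fun W _ v => by
          refine iff_of_eq (congrArg _ (funext fun i => ?_))
          cases i <;> rfl
    have := hp.transfer hU h0 hVt (fun M v => ∀ a : M, ∃ c : M, ∀ x : M, x.1 ∈ c.1 ↔
      x.1 ∈ a.1 ∧ φ.Realize (Sum.elim v fun _ => x)) (fun v => ?_) (fun i => i.1)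
    · simpa only [hφ'] using this
    · exact h.separation {x | φ.Realize (Sum.elim v fun _ => x)} (definable₁_realize φ v)

theorem modelsZFC (hp : IsCollapse κ W U p) (hU : IsMUltrafilter κ W U) (h0 : ∅ ∈ V)
    (hVt : V.IsTransitive) (h : ModelsZFC V) :
    ModelsZFC (p (lam (fun _ => V) (ordSet κ))) := by
  have T := fun (P : ∀ W : ZFSet.{u}, (Empty → W) → Prop) [FO P] (h : ∀ v, P V v) =>
    hp.transfer hU h0 hVt P h (fun e => e.elim)
  refine ⟨hp.modelsBase hU h0 hVt h.toModelsBase, ?_, ?_, ?_⟩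
  · exact T (fun M _ => ∀ a : M, ∃ c : M, ∀ x : M, x.1 ∈ c.1 ↔ ∀ y : M, y.1 ∈ x.1 → y.1 ∈ a.1)
      fun _ => h.powerset
  · intro R hR
    obtain ⟨φ, hφ⟩ := Set.definable_iff_exists_formula_sum.1 hR
    have hφ' : ∀ x y, (x, y) ∈ R ↔ φ.Realize (Sum.elim (fun i => i.1) ![x, y]) := fun x y =>
      Set.ext_iff.1 hφ ![x, y]
    have h1 := FO.realize₂ φ (fun i => some (some (some (some i)))) (some (some none)) (some none)
    have h2 := FO.realize₂ φ (fun i => some (some (some (some i)))) (some (some none)) none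
    have h3 := FO.realize₂ φ (fun i => some (some (some (some i)))) none (some none)
    have := hp.transfer hU h0 hVt (fun M v => ∀ a : M,
      (∀ x y z : M, x.1 ∈ a.1 → φ.Realize (Sum.elim v ![x, y]) →
        φ.Realize (Sum.elim v ![x, z]) → y = z) →
      ∃ c : M, ∀ y : M, y.1 ∈ c.1 ↔ ∃ x : M, x.1 ∈ a.1 ∧ φ.Realize (Sum.elim v ![x, y]))
      (fun v => h.replacement {q | φ.Realize (Sum.elim v ![q.1, q.2])} (definable₂_realize φ v))
      (fun i => i.1)
    simpa only [hφ'] using this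
  · exact T (fun M _ => ∀ a : M, (∀ x : M, x.1 ∈ a.1 → ∃ y : M, y.1 ∈ x.1) →
      (∀ x y z : M, x.1 ∈ a.1 → y.1 ∈ a.1 → z.1 ∈ x.1 → z.1 ∈ y.1 → x = y) →
      ∃ c : M, ∀ x : M, x.1 ∈ a.1 → ∃ y : M, (y.1 ∈ x.1 ∧ y.1 ∈ c.1) ∧
        ∀ z : M, z.1 ∈ x.1 ∧ z.1 ∈ c.1 → z = y) fun _ => h.choice

theorem modelsZFCMinus (hp : IsCollapse κ W U p) (hU : IsMUltrafilter κ W U) (h0 : ∅ ∈ V)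
    (hVt : V.IsTransitive) (h : ModelsZFCMinus V) :
    ModelsZFCMinus (p (lam (fun _ => V) (ordSet κ))) := by
  refine ⟨hp.modelsBase hU h0 hVt h.toModelsBase, ?_, ?_⟩
  · intro R hR
    obtain ⟨φ, hφ⟩ := Set.definable_iff_exists_formula_sum.1 hR
    have hφ' : ∀ x y, (x, y) ∈ R ↔ φ.Realize (Sum.elim (fun i => i.1) ![x, y]) := fun x y =>
      Set.ext_iff.1 hφ ![x, y]
    have h1 := FO.realize₂ φ (fun i => some (some (some i))) (some none) none
    have h2 := FO.realize₂ φ (fun i => some (some (some (some i)))) (some none) none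
    have := hp.transfer hU h0 hVt (fun M v => ∀ a : M,
      (∀ x : M, x.1 ∈ a.1 → ∃ y : M, φ.Realize (Sum.elim v ![x, y])) →
      ∃ c : M, ∀ x : M, x.1 ∈ a.1 → ∃ y : M, y.1 ∈ c.1 ∧ φ.Realize (Sum.elim v ![x, y]))
      (fun v => h.collection {q | φ.Realize (Sum.elim v ![q.1, q.2])} (definable₂_realize φ v))
      (fun i => i.1)
    simpa only [hφ'] using this
  · exact hp.transfer hU h0 hVt (β := Empty) (fun M _ => ∀ a : M, ∃ r : M,
      (∀ x : M, x.1 ∈ a.1 → ZFSet.pair x.1 x.1 ∉ r.1) ∧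
      (∀ x y z : M, x.1 ∈ a.1 → y.1 ∈ a.1 → z.1 ∈ a.1 →
        ZFSet.pair x.1 y.1 ∈ r.1 → ZFSet.pair y.1 z.1 ∈ r.1 → ZFSet.pair x.1 z.1 ∈ r.1) ∧
      (∀ x y : M, x.1 ∈ a.1 → y.1 ∈ a.1 →
        ZFSet.pair x.1 y.1 ∈ r.1 ∨ x = y ∨ ZFSet.pair y.1 x.1 ∈ r.1) ∧
      (∀ b : M, (∀ x : M, x.1 ∈ b.1 → x.1 ∈ a.1) → (∃ x : M, x.1 ∈ b.1) →
        ∃ m : M, m.1 ∈ b.1 ∧ ∀ x : M, x.1 ∈ b.1 → ¬ x = m → ZFSet.pair m.1 x.1 ∈ r.1))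
      (fun _ => h.wellOrdering) (fun e => e.elim)

end IsCollapse

end Transfer


theorem Dfn.subst₂ {W : ZFSet.{u}} {β : Type} {P : ZFSet.{u} → ZFSet.{u} → Prop}
    (hP : Dfn (fun w : Option (Option Empty) → W => P (w none) (w (some none))))
    (s t : (β → W) → ZFSet.{u}) [hs : Tm s] [ht : Tm t] : Dfn (fun v => P (s v) (t v)) :=
  hP.subst (fun o w => o.elim (s w) fun _ => t w)
    (ht := by rintro (_ | o) <;> simp only [Option.elim] <;> infer_instance)

/-! ### The ultrapower of `V_κ` -/

/-- `κ` is inaccessible, `W` is a `κ`-model, `U` is a weakly amenable `W`-ultrafilter, and `p` is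
the collapse of the ultrapower. -/
structure RamseyUltrapower (κ : Cardinal.{u}) (W U : ZFSet.{u}) (p : ZFSet.{u} → ZFSet.{u}) :
    Prop where
  inaccessible : κ.IsInaccessible
  model : IsModel κ W
  ultra : IsMUltrafilter κ W U
  amenable : IsWeaklyAmenable κ W U
  collapse : IsCollapse κ W U p

/-- The image of `V_κ` under the ultrapower map. -/
noncomputable def imageV (κ : Cardinal.{u}) (p : ZFSet.{u} → ZFSet.{u}) : ZFSet.{u} :=
  p (lam (fun _ => V_ κ.ord) (ordSet κ))

namespace RamseyUltrapower

variable {κ : Cardinal.{u}} {W U : ZFSet.{u}} {p : ZFSet.{u} → ZFSet.{u}}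
  [hW : IsTransModel W] [hκW : Fact (ordSet κ ∈ W)]

theorem isFunTo_id : IsFunTo κ W (V_ κ.ord) (lam (fun ξ => ξ) (ordSet κ)) :=
  isFunTo_lam _ fun _ hξ => ordSet_subset_V hξ

theorem apply_upair (S : RamseyUltrapower κ W U p) {f g : ZFSet.{u}} (hf : IsUltFun κ W f)
    (hg : IsUltFun κ W g) :
    p (lam (fun ξ => {ev f ξ, ev g ξ}) (ordSet κ)) = {p f, p g} := by
  have : Fact (f ∈ W) := ⟨hf.1⟩
  have : Fact (g ∈ W) := ⟨hg.1⟩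
  have hl : IsUltFun κ W (lam (fun ξ => {ev f ξ, ev g ξ}) (ordSet κ)) := isUltFun_lam _
  ext x
  rw [ZFSet.mem_pair]
  constructor
  · intro hx
    obtain ⟨k, hk, h, rfl⟩ := (S.collapse _ hl x).1 hx
    have : Fact (k ∈ W) := ⟨hk.1⟩
    have h1 : AE κ U (fun ξ => ev k ξ = ev f ξ ∨ ev k ξ = ev g ξ) :=
      S.ultra.ae_mono h _ fun ξ hξ h => by
        rw [ev_lam hξ] at h
        exact ZFSet.mem_pair.1 h
    rcases S.ultra.ae_or_not (fun ξ => ev k ξ = ev f ξ) with h2 | h2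
    · exact Or.inl (S.collapse.eq_of_ae S.ultra hk hf h2)
    · exact Or.inr (S.collapse.eq_of_ae S.ultra hk hg
        (S.ultra.ae_mono₂ h1 h2 _ fun ξ _ h h' => h.resolve_left h'))
  · rintro (rfl | rfl)
    · exact S.collapse.mem_of_ae hf hl (S.ultra.ae_of_forall fun ξ hξ => by
        rw [ev_lam hξ]; simp)
    · exact S.collapse.mem_of_ae hg hl (S.ultra.ae_of_forall fun ξ hξ => by
        rw [ev_lam hξ]; simp)

theorem apply_pair (S : RamseyUltrapower κ W U p) {f g : ZFSet.{u}} (hf : IsUltFun κ W f)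
    (hg : IsUltFun κ W g) :
    p (lam (fun ξ => ZFSet.pair (ev f ξ) (ev g ξ)) (ordSet κ)) = ZFSet.pair (p f) (p g) := by
  have : Fact (f ∈ W) := ⟨hf.1⟩
  have : Fact (g ∈ W) := ⟨hg.1⟩
  have h1 : IsUltFun κ W (lam (fun ξ => {ev f ξ, ev f ξ}) (ordSet κ)) := isUltFun_lam _
  have h2 : IsUltFun κ W (lam (fun ξ => {ev f ξ, ev g ξ}) (ordSet κ)) := isUltFun_lam _
  have h3 := S.apply_upair h1 h2
  rw [S.apply_upair hf hf, S.apply_upair hf hg, ZFSet.pair_eq_singleton] at h3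
  rw [ZFSet.pair, ← h3]
  refine congrArg p (lam_congr fun ξ hξ => ?_)
  rw [ev_lam hξ, ev_lam hξ, ZFSet.pair_eq_singleton]
  rfl

variable [hV : Fact (V_ κ.ord ∈ W)]

theorem mem_iff (S : RamseyUltrapower κ W U p) {x : ZFSet.{u}} :
    x ∈ imageV κ p ↔ ∃ f, IsFunTo κ W (V_ κ.ord) f ∧ x = p f :=
  S.collapse.mem_const_iff S.ultra (empty_mem_V S.inaccessible)

theorem isTransitive (S : RamseyUltrapower κ W U p) : (imageV κ p).IsTransitive :=
  S.collapse.isTransitive_const S.ultra (empty_mem_V S.inaccessible) V_transitive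

theorem modelsZFC (S : RamseyUltrapower κ W U p) : ModelsZFC (imageV κ p) :=
  S.collapse.modelsZFC S.ultra (empty_mem_V S.inaccessible) V_transitive
    (modelsZFC_V S.inaccessible)

theorem modelsZFCMinus (S : RamseyUltrapower κ W U p) : ModelsZFCMinus (imageV κ p) :=
  S.collapse.modelsZFCMinus S.ultra (empty_mem_V S.inaccessible) V_transitive
    (modelsZFCMinus_V S.inaccessible)

/-- Completeness for index sets in V_κ: such a set is enumerated by an ordinal below κ, and the
enumeration lies in `W` by closure. -/
theorem ae_forall_mem (S : RamseyUltrapower κ W U p) {a : ZFSet.{u}} (ha : a ∈ V_ κ.ord)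
    (P : ZFSet.{u} → ZFSet.{u} → Prop)
    [hP : Dfn (fun w : Option (Option Empty) → W => P (w none) (w (some none)))]
    (h : ∀ y ∈ a, AE κ U (fun ξ => P ξ y)) : AE κ U (fun ξ => ∀ y ∈ a, P ξ y) := by
  obtain ⟨f, hf, hm⟩ := exists_eq_img_ord a
  have hδ : a.card.ord < κ.ord := Cardinal.ord_lt_ord.2 (card_lt_of_mem_V S.inaccessible ha)
  have haW : ∀ {y}, y ∈ a → y ∈ W := fun hy =>
    hW.transitive _ (hW.transitive _ hV.out ha) hy
  have : Fact (lam f a.card.ord.toZFSet ∈ W) := ⟨S.model.lam_mem hδ fun y hy => haW (hm y hy)⟩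
  have : Fact (a ∈ W) := ⟨hW.transitive _ hV.out ha⟩
  have := hP.subst₂ (W := W) (β := Option (Option Empty)) (fun w => w none)
    (fun w => ev (lam f a.card.ord.toZFSet) (w (some none)))
  have := hP.swap
  have h1 := S.ultra.ae_forall_lt S.model (fun ξ i => P ξ (ev (lam f a.card.ord.toZFSet) i))
    (toZFSet_mem_ordSet.2 hδ) fun i hi => by
      rw [ev_lam hi]
      exact h _ (hm i hi)
  refine S.ultra.ae_mono h1 _ fun ξ _ h y hy => ?_
  rw [hf] at hy
  obtain ⟨i, hi, rfl⟩ := mem_img.1 hy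
  have := h i hi
  rwa [ev_lam hi] at this

theorem ae_exists_mem (S : RamseyUltrapower κ W U p) {a : ZFSet.{u}} (ha : a ∈ V_ κ.ord)
    (P : ZFSet.{u} → ZFSet.{u} → Prop)
    [hP : Dfn (fun w : Option (Option Empty) → W => P (w none) (w (some none)))]
    (h : AE κ U (fun ξ => ∃ y ∈ a, P ξ y)) : ∃ y ∈ a, AE κ U (fun ξ => P ξ y) := by
  by_contra hne
  push Not at hne
  have h1 := S.ae_forall_mem ha (fun ξ y => ¬ P ξ y) fun y hy => by
    have : Fact (y ∈ W) := ⟨hW.transitive _ (hW.transitive _ hV.out ha) hy⟩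
    have := hP.subst₂ (W := W) (β := Option Empty) (fun w => w none) (fun _ => y)
    exact (S.ultra.ae_not _).2 (hne y hy)
  obtain ⟨ξ, _, ⟨y, hy, h2⟩, h3⟩ := S.ultra.ae_exists (S.ultra.ae_and h h1)
  exact h3 y hy h2

theorem isFunTo_const {x : ZFSet.{u}} (hx : x ∈ V_ κ.ord) :
    IsFunTo κ W (V_ κ.ord) (lam (fun _ => x) (ordSet κ)) := by
  have : Fact (x ∈ W) := ⟨hW.transitive _ hV.out hx⟩
  exact isFunTo_lam _ fun _ _ => hx

/-- The ultrapower map fixes V_κ pointwise: a function with values almost everywhere in a set of V_κ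
is almost everywhere constant, by completeness. -/
theorem apply_const (S : RamseyUltrapower κ W U p) : ∀ {x : ZFSet.{u}}, x ∈ V_ κ.ord →
    p (lam (fun _ => x) (ordSet κ)) = x := by
  intro x
  induction x using ZFSet.inductionOn with
  | _ x ih =>
    intro hx
    have : Fact (x ∈ W) := ⟨hW.transitive _ hV.out hx⟩
    have hc := (isFunTo_const (W := W) hx).isUltFun
    ext y
    constructor
    · intro hy
      obtain ⟨g, hg, h, rfl⟩ := (S.collapse _ hc y).1 hy
      have : Fact (g ∈ W) := ⟨hg.1⟩
      obtain ⟨z, hz, h1⟩ := S.ae_exists_mem hx (fun ξ y => ev g ξ = y)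
        (S.ultra.ae_mono h _ fun ξ hξ h => by
          rw [ev_lam hξ] at h
          exact ⟨_, h, rfl⟩)
      have hzV := V_transitive _ hx hz
      have : p g = p (lam (fun _ => z) (ordSet κ)) :=
        S.collapse.eq_of_ae S.ultra hg (isFunTo_const hzV).isUltFun
          ((IsMUltrafilter.ae_congr fun ξ hξ => by rw [ev_lam hξ]).2 h1)
      rwa [this, ih z hz hzV]
    · intro hy
      have hyV := V_transitive _ hx hy
      rw [← ih y hy hyV]
      refine S.collapse.mem_of_ae (isFunTo_const hyV).isUltFun hc
        (S.ultra.ae_of_forall fun ξ hξ => ?_)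
      rwa [ev_lam hξ, ev_lam hξ]

theorem V_subset (S : RamseyUltrapower κ W U p) : V_ κ.ord ⊆ imageV κ p := fun _ hx =>
  S.mem_iff.2 ⟨_, isFunTo_const hx, (S.apply_const hx).symm⟩

/-- Evaluating all representatives at `ξ` gives a sequence in V_κ, and these sequences together
represent the sequence of classes. The family of representatives lies in `W` because `a` has fewer
than κ elements. This yields closure of the image under short sequences. -/
theorem apply_lam (S : RamseyUltrapower κ W U p) {a : ZFSet.{u}} (ha : a ∈ V_ κ.ord)
    {h : ZFSet.{u} → ZFSet.{u}} (hh : ∀ i ∈ a, IsFunTo κ W (V_ κ.ord) (h i)) :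
    ∃ F, IsFunTo κ W (V_ κ.ord) F ∧ (∀ ξ ∈ ordSet κ, ev F ξ = lam (fun i => ev (h i) ξ) a) ∧
      p F = lam (fun i => p (h i)) a := by
  have haW : ∀ {y}, y ∈ a → y ∈ W := fun hy =>
    hW.transitive _ (hW.transitive _ hV.out ha) hy
  have : Fact (a ∈ W) := ⟨hW.transitive _ hV.out ha⟩
  have : Fact (lam h a ∈ W) := ⟨S.model.lam_mem_of_card_lt (fun y => haW)
    (card_lt_of_mem_V S.inaccessible ha) fun i hi => (hh i hi).1⟩
  have he : ∀ ξ, lam (fun i => ev (ev (lam h a) i) ξ) a = lam (fun i => ev (h i) ξ) a := fun ξ =>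
    lam_congr fun i hi => by rw [ev_lam hi]
  have hF : IsFunTo κ W (V_ κ.ord)
      (lam (fun ξ => lam (fun i => ev (ev (lam h a) i) ξ) a) (ordSet κ)) :=
    isFunTo_lam _ fun ξ hξ => by
      rw [he]
      exact lam_mem_V S.inaccessible ha fun i hi => (hh i hi).ev_mem hξ
  refine ⟨_, hF, fun ξ hξ => by rw [ev_lam hξ, he], ?_⟩
  have hpair : ∀ i ∈ a, IsUltFun κ W (lam (fun ξ => ZFSet.pair (ev (lam (fun _ => i) (ordSet κ)) ξ)
      (ev (h i) ξ)) (ordSet κ)) ∧ p (lam (fun ξ => ZFSet.pair (ev (lam (fun _ => i) (ordSet κ)) ξ)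
      (ev (h i) ξ)) (ordSet κ)) = ZFSet.pair i (p (h i)) := by
    intro i hi
    have hiV := V_transitive _ ha hi
    have hc := (isFunTo_const (W := W) hiV)
    have : Fact (lam (fun _ => i) (ordSet κ) ∈ W) := ⟨hc.1⟩
    have : Fact (h i ∈ W) := ⟨(hh i hi).1⟩
    refine ⟨isUltFun_lam _, ?_⟩
    rw [S.apply_pair hc.isUltFun (hh i hi).isUltFun, S.apply_const hiV]
  ext z
  rw [mem_lam]
  constructor
  · intro hz
    obtain ⟨g, hg, h1, rfl⟩ := (S.collapse _ hF.isUltFun z).1 hz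
    have : Fact (g ∈ W) := ⟨hg.1⟩
    obtain ⟨i, hi, h2⟩ := S.ae_exists_mem ha
      (fun ξ i => ev g ξ = ZFSet.pair i (ev (ev (lam h a) i) ξ))
      (S.ultra.ae_mono h1 _ fun ξ hξ h => by
        rw [ev_lam hξ] at h
        obtain ⟨i, hi, h⟩ := mem_lam.1 h
        exact ⟨i, hi, h⟩)
    refine ⟨i, hi, ?_⟩
    rw [← (hpair i hi).2]
    refine S.collapse.eq_of_ae S.ultra hg (hpair i hi).1
      ((IsMUltrafilter.ae_congr fun ξ hξ => ?_).1 h2)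
    rw [ev_lam hξ, ev_lam hξ, ev_lam hi]
  · rintro ⟨i, hi, rfl⟩
    rw [← (hpair i hi).2]
    refine S.collapse.mem_of_ae (hpair i hi).1 hF.isUltFun (S.ultra.ae_of_forall fun ξ hξ => ?_)
    rw [ev_lam hξ, ev_lam hξ, ev_lam hξ, mem_lam]
    exact ⟨i, hi, by rw [ev_lam hi]⟩

/-- By normality, a function that is almost everywhere regressive is almost everywhere equal to a
constant ordinal below κ. -/
theorem apply_id (S : RamseyUltrapower κ W U p) : p (lam (fun ξ => ξ) (ordSet κ)) = ordSet κ := by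
  have hid := (isFunTo_id (κ := κ) (W := W)).isUltFun
  ext x
  constructor
  · intro hx
    obtain ⟨g, hg, h, rfl⟩ := (S.collapse _ hid x).1 hx
    have : Fact (g ∈ W) := ⟨hg.1⟩
    obtain ⟨i, hi, h1⟩ := S.ultra.ae_regressive (fun ξ i => ev g ξ = i)
      (S.ultra.ae_mono h _ fun ξ hξ h => by
        rw [ev_lam hξ] at h
        exact ⟨_, h, rfl⟩)
    have hiV : i ∈ V_ κ.ord := ordSet_subset_V hi
    rwa [S.collapse.eq_of_ae S.ultra hg (isFunTo_const hiV).isUltFun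
      ((IsMUltrafilter.ae_congr fun ξ hξ => by rw [ev_lam hξ]).2 h1), S.apply_const hiV]
  · intro hx
    have hxV : x ∈ V_ κ.ord := ordSet_subset_V hx
    rw [← S.apply_const hxV]
    refine S.collapse.mem_of_ae (isFunTo_const hxV).isUltFun hid
      ((IsMUltrafilter.ae_congr fun ξ hξ => ?_).1 (S.ultra.ae_mem S.model hx))
    rw [ev_lam hξ, ev_lam hξ]

theorem isModel (S : RamseyUltrapower κ W U p) : IsModel κ (imageV κ p) where
  transitive := S.isTransitive
  card_eq := by
    refine le_antisymm ?_ ?_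
    · have h1 : imageV κ p ⊆ img p W := fun x hx => by
        obtain ⟨f, hf, rfl⟩ := S.mem_iff.1 hx
        exact mem_img.2 ⟨f, hf.1, rfl⟩
      exact ((ZFSet.card_mono h1).trans card_img_le).trans S.model.card_eq.le
    · have h2 := ZFSet.card_mono S.V_subset
      rwa [card_V S.inaccessible] at h2
  mem := S.mem_iff.2 ⟨_, isFunTo_id, S.apply_id.symm⟩
  models := S.modelsZFCMinus
  closed δ hδ s hs := by
    have hch : ∀ i, ∃ f, i ∈ δ.toZFSet → IsFunTo κ W (V_ κ.ord) f ∧ ev s i = p f := fun i => by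
      by_cases hi : i ∈ δ.toZFSet
      · obtain ⟨f, hf⟩ := S.mem_iff.1 (IsFunc.ev_mem hs hi)
        exact ⟨f, fun _ => hf⟩
      · exact ⟨∅, fun h => absurd h hi⟩
    choose f hf using hch
    obtain ⟨F, hF, _, h1⟩ := S.apply_lam (ordSet_subset_V (toZFSet_mem_ordSet.2 hδ))
      fun i hi => (hf i hi).1
    refine S.mem_iff.2 ⟨F, hF, ?_⟩
    rw [h1, IsFunc.eq_lam hs]
    exact lam_congr fun i hi => (hf i hi).2

end RamseyUltrapower


/-! ### The ultrafilter over the image of V_κ -/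

theorem ae_mem_iff {κ : Cardinal.{u}} {U a : ZFSet.{u}} (ha : a ⊆ ordSet κ) :
    AE κ U (fun ξ => ξ ∈ a) ↔ a ∈ U := by
  have : ZFSet.sep (fun ξ => ξ ∈ a) (ordSet κ) = a := by
    ext ξ
    rw [ZFSet.mem_sep]
    exact ⟨fun h => h.2, fun h => ⟨ha h, h⟩⟩
  rw [AE, this]

/-- A weakly amenable ultrafilter measures sequences of length `κ`. -/
theorem IsWeaklyAmenable.sep_mem {κ : Cardinal.{u}} {W U : ZFSet.{u}} [hW : IsTransModel W]
    [hκW : Fact (ordSet κ ∈ W)] (hA : IsWeaklyAmenable κ W U) (hU : IsMUltrafilter κ W U)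
    (h : IsModel κ W) (f : ZFSet.{u} → ZFSet.{u})
    [hf : Tm (fun w : Option Empty → W => f (w none))] (hfκ : ∀ i ∈ ordSet κ, f i ⊆ ordSet κ) :
    ZFSet.sep (fun i => f i ∈ U) (ordSet κ) ∈ W := by
  -- Weak amenability concerns sets of size `κ` in `W`, whereas `f` may repeat values. The least
  -- element of `g i` is `i`, so `g` is injective; and `g i` agrees with `f i` above `i`, so the two
  -- are in `U` together.
  let g : ZFSet.{u} → ZFSet.{u} := fun i => insert i (f i \ insert i i)
  have hgT : Tm (fun w : Option Empty → W => g (w none)) := by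
    simp only [g]; infer_instance
  have hg : ∀ i j, j ∈ g i ↔ j = i ∨ (j ∈ f i ∧ j ≠ i ∧ j ∉ i) := fun i j => by
    simp only [g, ZFSet.mem_insert_iff, ZFSet.mem_sdiff, not_or, ne_eq]
  have hgκ : ∀ i ∈ ordSet κ, g i ⊆ ordSet κ := by
    intro i hi j hj
    rcases (hg i j).1 hj with rfl | hj
    · exact hi
    · exact hfκ i hi hj.1
  have hinj : ∀ i ∈ ordSet κ, ∀ j ∈ ordSet κ, g i = g j → i = j := by
    intro i hi j hj he
    by_contra hne
    have h1 : i ∉ j := (((hg j i).1 (he ▸ (hg i i).2 (Or.inl rfl))).resolve_left hne).2.2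
    have h2 : j ∉ i :=
      (((hg i j).1 (he ▸ (hg j j).2 (Or.inl rfl))).resolve_left (Ne.symm hne)).2.2
    rcases (isOrdinal_of_mem_ordSet hi).mem_trichotomous (isOrdinal_of_mem_ordSet hj) with h | h | h
    · exact h1 h
    · exact hne h
    · exact h2 h
  have hX : img g (ordSet κ) ∈ W := mem_of_tm (W := W) (img g (ordSet κ))
  have hl : lam g (ordSet κ) ∈ W := mem_of_tm (W := W) (lam g (ordSet κ))
  have hs : HasSizeIn κ W (img g (ordSet κ)) := by
    refine ⟨hX, _, hl, isFunc_lam fun i hi => mem_img.2 ⟨i, hi, rfl⟩, fun y hy => ?_⟩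
    obtain ⟨i, hi, rfl⟩ := mem_img.1 hy
    refine ⟨i, pair_mem_lam.2 ⟨hi, rfl⟩, fun j hj => ?_⟩
    obtain ⟨hj, he⟩ := pair_mem_lam.1 hj
    exact hinj j hj i hi he.symm
  have : Fact (img g (ordSet κ) ∩ U ∈ W) := ⟨hA _ hs⟩
  have h1 : ZFSet.sep (fun i => g i ∈ img g (ordSet κ) ∩ U) (ordSet κ) ∈ W :=
    mem_of_tm (W := W) (ZFSet.sep (fun i => g i ∈ img g (ordSet κ) ∩ U) (ordSet κ))
  convert h1 using 1
  ext i
  rw [ZFSet.mem_sep, ZFSet.mem_sep]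
  refine and_congr_right fun hi => ?_
  have hmem : g i ∈ img g (ordSet κ) := mem_img.2 ⟨i, hi, rfl⟩
  rw [ZFSet.mem_inter, and_iff_right hmem, ← ae_mem_iff (hfκ i hi), ← ae_mem_iff (hgκ i hi)]
  have : Fact (i ∈ W) := ⟨hW.transitive _ hκW.out hi⟩
  have hfi : Fact (f i ∈ W) := ⟨hf.mem fun o => o.elim ⟨i, this.out⟩ fun e => e.elim⟩
  have hgi : Fact (g i ∈ W) := ⟨hgT.mem fun o => o.elim ⟨i, this.out⟩ fun e => e.elim⟩
  have key : ∀ ξ, i ∈ ξ → (ξ ∈ g i ↔ ξ ∈ f i) := by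
    intro ξ hξ
    rw [hg]
    constructor
    · rintro (rfl | h)
      · exact absurd hξ (ZFSet.mem_irrefl _)
      · exact h.1
    · intro h
      exact Or.inr ⟨h, fun he => ZFSet.mem_irrefl _ (he ▸ hξ), fun h' => ZFSet.mem_asymm h' hξ⟩
  have hm := hU.ae_mem h hi
  exact ⟨fun h => hU.ae_mono₂ hm h _ fun ξ _ h1 h2 => (key ξ h1).2 h2,
    fun h => hU.ae_mono₂ hm h _ fun ξ _ h1 h2 => (key ξ h1).1 h2⟩

/-- A κ-sequence of subsets of κ is coded by the set of pairs (i, j) with j in the i-th set. This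
code is a subset of V_κ, and `W'` rebuilds the sequence from it. -/
theorem func_mem_of_subset_mem {κ : Cardinal.{u}} (hi : κ.IsInaccessible) {W W' : ZFSet.{u}}
    [hW : IsTransModel W] [hW' : IsTransModel W'] [hκW : Fact (ordSet κ ∈ W)]
    [hκW' : Fact (ordSet κ ∈ W')] (hs : ∀ B ⊆ V_ κ.ord, B ∈ W → B ∈ W') {f b : ZFSet.{u}}
    (hf : f ∈ W) (hfb : ZFSet.IsFunc (ordSet κ) b f) (hb : ∀ i ∈ ordSet κ, ev f i ⊆ ordSet κ) :
    f ∈ W' := by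
  have : Fact (f ∈ W) := ⟨hf⟩
  have h1 : (⋃₀ img (fun i => img (fun j => ZFSet.pair i j) (ev f i)) (ordSet κ) : ZFSet.{u}) ∈ W :=
    mem_of_tm (W := W) (⋃₀ img (fun i => img (fun j => ZFSet.pair i j) (ev f i)) (ordSet κ))
  have hmem : ∀ z, z ∈ (⋃₀ img (fun i => img (fun j => ZFSet.pair i j) (ev f i)) (ordSet κ) :
      ZFSet.{u}) ↔ ∃ i ∈ ordSet κ, ∃ j ∈ ev f i, z = ZFSet.pair i j := by
    intro z
    rw [ZFSet.mem_sUnion]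
    constructor
    · rintro ⟨y, hy, hz⟩
      obtain ⟨i, hi, rfl⟩ := mem_img.1 hy
      exact ⟨i, hi, mem_img.1 hz⟩
    · rintro ⟨i, hi, hz⟩
      exact ⟨_, mem_img.2 ⟨i, hi, rfl⟩, mem_img.2 hz⟩
  have : Fact ((⋃₀ img (fun i => img (fun j => ZFSet.pair i j) (ev f i)) (ordSet κ) : ZFSet.{u}) ∈
      W') := ⟨hs _ (fun z hz => by
    obtain ⟨i, hi', j, hj, rfl⟩ := (hmem z).1 hz
    exact pair_mem_V hi (ordSet_subset_V hi') (ordSet_subset_V (hb i hi' hj))) h1⟩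
  have h2 : lam (fun i => ZFSet.sep (fun j => ZFSet.pair i j ∈
      (⋃₀ img (fun i => img (fun j => ZFSet.pair i j) (ev f i)) (ordSet κ) : ZFSet.{u}))
        (ordSet κ)) (ordSet κ) ∈ W' := mem_of_tm (W := W') _
  convert h2 using 1
  rw [IsFunc.eq_lam hfb]
  refine lam_congr fun i hi => ?_
  ext j
  rw [← IsFunc.eq_lam hfb, ZFSet.mem_sep, hmem]
  constructor
  · exact fun hj => ⟨hb i hi hj, i, hi, j, hj, rfl⟩
  · rintro ⟨_, i', _, j', hj, he⟩
    obtain ⟨rfl, rfl⟩ := ZFSet.pair_injective he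
    exact hj

namespace RamseyUltrapower

variable {κ : Cardinal.{u}} {W U : ZFSet.{u}} {p : ZFSet.{u} → ZFSet.{u}}

theorem exists_enum_V (S : RamseyUltrapower κ W U p) : ∃ e ∈ W, IsFunTo κ W (V_ κ.ord) e ∧
    ∀ x ∈ V_ κ.ord, ∃ i ∈ ordSet κ, ev e i = x := by
  obtain ⟨_, e, heW, he, h⟩ := S.model.hasSizeIn_V S.inaccessible
  refine ⟨e, heW, ⟨heW, he⟩, fun x hx => ?_⟩
  obtain ⟨i, hi, -⟩ := h x hx
  obtain ⟨hi, h⟩ := (IsFunc.pair_mem_iff he).1 hi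
  exact ⟨i, hi, h.symm⟩

theorem card_lt_of_mem (S : RamseyUltrapower κ W U p) {ξ : ZFSet.{u}} (hξ : ξ ∈ ordSet κ) :
    ξ.card < κ := card_lt_of_mem_V S.inaccessible (ordSet_subset_V hξ)

variable [hW : IsTransModel W] [hκW : Fact (ordSet κ ∈ W)] [hV : Fact (V_ κ.ord ∈ W)]

/-- Let e enumerate V_κ in `W`. Then `B` is the class of ξ ↦ B ∩ e[ξ]: each element of `B` belongs
to this set once ξ exceeds its index, and a function choosing elements of these sets has regressive
indices, hence is almost everywhere constant. -/
theorem subset_V_mem (S : RamseyUltrapower κ W U p) {B : ZFSet.{u}} (hB : B ⊆ V_ κ.ord)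
    (hBW : B ∈ W) : B ∈ imageV κ p := by
  obtain ⟨e, heW, he, hs⟩ := S.exists_enum_V
  have : Fact (e ∈ W) := ⟨heW⟩
  have : Fact (B ∈ W) := ⟨hBW⟩
  have hF : IsFunTo κ W (V_ κ.ord) (lam (fun ξ => B ∩ img (ev e) ξ) (ordSet κ)) := by
    refine isFunTo_lam _ fun ξ hξ => mem_V_of_card_lt S.inaccessible
      (fun x hx => hB (ZFSet.mem_inter.1 hx).1) ?_
    exact ((ZFSet.card_mono fun x hx => (ZFSet.mem_inter.1 hx).2).trans card_img_le).trans_lt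
      (S.card_lt_of_mem hξ)
  refine S.mem_iff.2 ⟨_, hF, ?_⟩
  ext x
  constructor
  · intro hx
    obtain ⟨i, hi, rfl⟩ := hs x (hB hx)
    rw [← S.apply_const (hB hx)]
    refine S.collapse.mem_of_ae (isFunTo_const (hB hx)).isUltFun hF.isUltFun ?_
    have : Fact (i ∈ W) := ⟨hW.transitive _ hκW.out hi⟩
    have : Fact (ev e i ∈ W) := ⟨hW.transitive _ hBW hx⟩
    refine (IsMUltrafilter.ae_congr fun ξ hξ => by rw [ev_lam hξ, ev_lam hξ]).2
      (S.ultra.ae_mono (S.ultra.ae_mem S.model hi) (fun ξ => ev e i ∈ B ∩ img (ev e) ξ)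
        fun ξ _ h => ?_)
    exact ZFSet.mem_inter.2 ⟨hx, mem_img.2 ⟨i, h, rfl⟩⟩
  · intro hx
    obtain ⟨g, hg, h, rfl⟩ := (S.collapse _ hF.isUltFun x).1 hx
    have : Fact (g ∈ W) := ⟨hg.1⟩
    obtain ⟨i, hi, h1⟩ := S.ultra.ae_regressive (fun ξ i => ev g ξ = ev e i ∧ ev e i ∈ B)
      (S.ultra.ae_mono h _ fun ξ hξ h => by
        rw [ev_lam hξ, ZFSet.mem_inter, mem_img] at h
        obtain ⟨h1, i, hi, h2⟩ := h
        exact ⟨i, hi, h2, h2 ▸ h1⟩)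
    have : Fact (i ∈ W) := ⟨hW.transitive _ hκW.out hi⟩
    obtain ⟨_, _, _, hB'⟩ := S.ultra.ae_exists h1
    rwa [S.collapse.eq_of_ae S.ultra hg (isFunTo_const (hB hB')).isUltFun
      (S.ultra.ae_mono ((IsMUltrafilter.ae_congr (Q := fun ξ => ev g ξ = ev (lam (fun _ => ev e i)
        (ordSet κ)) ξ ∧ ev e i ∈ B) fun ξ hξ => by rw [ev_lam hξ]).1 h1) _ fun ξ _ h => h.1),
      S.apply_const (hB hB')]

/-- If `B` is the class of F, then x ∈ V_κ belongs to `B` exactly when {ξ | x ∈ F(ξ)} is in `U`.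
Along an enumeration of V_κ these sets form a κ-sequence in `W`, which weak amenability measures. -/
theorem mem_of_subset_V (S : RamseyUltrapower κ W U p) {B : ZFSet.{u}} (hB : B ⊆ V_ κ.ord)
    (hBM : B ∈ imageV κ p) : B ∈ W := by
  obtain ⟨e, heW, he, hs⟩ := S.exists_enum_V
  have : Fact (e ∈ W) := ⟨heW⟩
  obtain ⟨F, hF, rfl⟩ := S.mem_iff.1 hBM
  have : Fact (F ∈ W) := ⟨hF.1⟩
  have : Fact (ZFSet.sep (fun i => ZFSet.sep (fun ξ => ev e i ∈ ev F ξ) (ordSet κ) ∈ U)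
      (ordSet κ) ∈ W) := ⟨S.amenable.sep_mem S.ultra S.model
        (fun i => ZFSet.sep (fun ξ => ev e i ∈ ev F ξ) (ordSet κ))
        fun i _ ξ hξ => (ZFSet.mem_sep.1 hξ).1⟩
  have key : ∀ x ∈ V_ κ.ord, x ∈ p F ↔ AE κ U (fun ξ => x ∈ ev F ξ) := by
    intro x hx
    conv_lhs => rw [← S.apply_const hx]
    rw [S.collapse.mem_iff S.ultra (isFunTo_const hx).isUltFun hF.isUltFun]
    exact IsMUltrafilter.ae_congr fun ξ hξ => by rw [ev_lam hξ]
  have h1 : img (ev e) (ZFSet.sep (fun i => ZFSet.sep (fun ξ => ev e i ∈ ev F ξ) (ordSet κ) ∈ U)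
      (ordSet κ)) ∈ W := mem_of_tm (W := W) _
  convert h1 using 1
  ext x
  rw [mem_img]
  constructor
  · intro hx
    obtain ⟨i, hi, rfl⟩ := hs x (hB hx)
    exact ⟨i, ZFSet.mem_sep.2 ⟨hi, (key _ (hB hx)).1 hx⟩, rfl⟩
  · rintro ⟨i, hi, rfl⟩
    obtain ⟨hi, h⟩ := ZFSet.mem_sep.1 hi
    exact (key _ (he.ev_mem hi)).2 h

theorem isMUltrafilter_image (S : RamseyUltrapower κ W U p) : IsMUltrafilter κ (imageV κ p) U where
  subset B hB := ⟨S.subset_V_mem (fun x hx => ordSet_subset_V ((S.ultra.subset B hB).2 hx))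
    (S.ultra.subset B hB).1, (S.ultra.subset B hB).2⟩
  univ_mem := S.ultra.univ_mem
  empty_notMem := S.ultra.empty_notMem
  superset B hB C hC hBC hCκ := S.ultra.superset B hB C
    (S.mem_of_subset_V (fun x hx => ordSet_subset_V (hCκ hx)) hC) hBC hCκ
  inter := S.ultra.inter
  ultra B hB hBκ := S.ultra.ultra B
    (S.mem_of_subset_V (fun x hx => ordSet_subset_V (hBκ hx)) hB) hBκ
  tail := S.ultra.tail
  normal f hf hfU := by
    have := S.isModel.isTransModel
    have : Fact (ordSet κ ∈ imageV κ p) := ⟨S.isModel.mem⟩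
    exact S.ultra.normal f (func_mem_of_subset_mem S.inaccessible
      (fun B hB => S.mem_of_subset_V hB) hf hfU
      fun i hi => (S.ultra.subset _ (IsFunc.ev_mem hfU hi)).2) hfU

theorem isWeaklyAmenable_image (S : RamseyUltrapower κ W U p) :
    IsWeaklyAmenable κ (imageV κ p) U := by
  rintro X ⟨-, f, hf, hfX, hs⟩
  have := S.isModel.isTransModel
  have : Fact (ordSet κ ∈ imageV κ p) := ⟨S.isModel.mem⟩
  have : Fact (f ∈ imageV κ p) := ⟨hf⟩
  -- Elements of `X` need not be subsets of `κ`. Those that are not are replaced by `∅`, which is no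
  -- more a member of `U` than they are, so that only subsets of `κ` have to be coded.
  let g : ZFSet.{u} → ZFSet.{u} := fun i => ⋃₀ ZFSet.sep (fun x => x ⊆ ordSet κ) {ev f i}
  have hg1 : ∀ i, ev f i ⊆ ordSet κ → g i = ev f i := fun i hi => by
    have : ZFSet.sep (fun x => x ⊆ ordSet κ) {ev f i} = {ev f i} := by
      ext x
      rw [ZFSet.mem_sep, ZFSet.mem_singleton]
      exact ⟨fun h => h.1, fun h => ⟨h, h ▸ hi⟩⟩
    simp only [g, this, ZFSet.sUnion_singleton]
  have hg2 : ∀ i, ¬ ev f i ⊆ ordSet κ → g i = ∅ := fun i hi => by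
    have : ZFSet.sep (fun x => x ⊆ ordSet κ) {ev f i} = ∅ := by
      rw [ZFSet.eq_empty]
      rintro x hx
      rw [ZFSet.mem_sep, ZFSet.mem_singleton] at hx
      exact hi (hx.1 ▸ hx.2)
    simp only [g, this, ZFSet.sUnion_empty]
  have hgκ : ∀ i, g i ⊆ ordSet κ := fun i => by
    by_cases hi : ev f i ⊆ ordSet κ
    · rwa [hg1 i hi]
    · rw [hg2 i hi]
      exact ZFSet.empty_subset _
  have hgU : ∀ i, g i ∈ U ↔ ev f i ∈ U := fun i => by
    by_cases hi : ev f i ⊆ ordSet κ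
    · rw [hg1 i hi]
    · rw [hg2 i hi]
      exact ⟨fun h => absurd h S.ultra.empty_notMem, fun h => absurd (S.ultra.subset _ h).2 hi⟩
  have hgM : lam g (ordSet κ) ∈ imageV κ p := by
    have : Tm (fun w : Option Empty → imageV κ p => g (w none)) := by
      simp only [g]; infer_instance
    exact mem_of_tm (W := imageV κ p) _
  have hgW : Fact (lam g (ordSet κ) ∈ W) := ⟨func_mem_of_subset_mem S.inaccessible
    (fun B hB => S.mem_of_subset_V hB) hgM (isFunc_lam (b := (ordSet κ).powerset)
      fun i _ => ZFSet.mem_powerset.2 (hgκ i)) fun i hi => by rw [ev_lam hi]; exact hgκ i⟩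
  have h1 := S.amenable.sep_mem S.ultra S.model (fun i => ev (lam g (ordSet κ)) i)
    (fun i hi => by rw [ev_lam hi]; exact hgκ i)
  have h2 : Fact (ZFSet.sep (fun i => ev (lam g (ordSet κ)) i ∈ U) (ordSet κ) ∈ imageV κ p) :=
    ⟨S.subset_V_mem (fun i hi => ordSet_subset_V (ZFSet.mem_sep.1 hi).1) h1⟩
  have h3 : img (ev f) (ZFSet.sep (fun i => ev (lam g (ordSet κ)) i ∈ U) (ordSet κ)) ∈
      imageV κ p := mem_of_tm (W := imageV κ p) _
  convert h3 using 1
  ext x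
  rw [ZFSet.mem_inter, mem_img]
  constructor
  · rintro ⟨hx, hxU⟩
    obtain ⟨i, hi, -⟩ := hs x hx
    obtain ⟨hi', rfl⟩ := (IsFunc.pair_mem_iff hfX).1 hi
    refine ⟨i, ZFSet.mem_sep.2 ⟨hi', ?_⟩, rfl⟩
    rw [ev_lam hi']
    exact (hgU i).2 hxU
  · rintro ⟨i, hi, rfl⟩
    obtain ⟨hi, h⟩ := ZFSet.mem_sep.1 hi
    rw [ev_lam hi] at h
    exact ⟨IsFunc.ev_mem hfX hi, (hgU i).1 h⟩

end RamseyUltrapower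


/-! ### The Tarski–Vaught criterion -/

/-- Every formula with parameters in `X` that has a solution in `M` has one in `X`. -/
def TarskiVaught (X M : ZFSet.{u}) : Prop :=
  ∀ (n : ℕ) (φ : setLang.BoundedFormula Empty (n + 1)) (a : Fin n → ZFSet.{u}), (∀ i, a i ∈ X) →
    (∃ x ∈ M, Sat M φ Empty.elim (Fin.snoc (α := fun _ => ZFSet.{u}) a x)) →
    ∃ x ∈ X, Sat M φ Empty.elim (Fin.snoc (α := fun _ => ZFSet.{u}) a x)

theorem realize_default_iff {M : ZFSet.{u}} {n : ℕ} (φ : setLang.BoundedFormula Empty n)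
    (b : Fin n → M) : φ.Realize default b ↔ Sat M φ Empty.elim (fun i => b i) := by
  rw [realize_iff_sat]
  exact iff_of_eq (congrArg (fun a => Sat M φ a _) (Subsingleton.elim _ _))

/-- The inclusion map, as an embedding of structures. -/
def inclusion {X M : ZFSet.{u}} (h : X ⊆ M) : X ↪[setLang] M where
  toFun x := ⟨x, h x.2⟩
  inj' x y hxy := by
    rw [Subtype.mk.injEq] at hxy
    exact Subtype.ext hxy
  map_fun' f := nomatch f
  map_rel' r x := by cases r; rfl

theorem TarskiVaught.realize_iff {X M : ZFSet.{u}} (h : TarskiVaught X M) (hs : X ⊆ M) {n : ℕ}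
    (φ : setLang.Formula (Fin n)) (x : Fin n → X) :
    φ.Realize (inclusion hs ∘ x) ↔ φ.Realize x := by
  refine (inclusion hs).isElementary_of_exists (fun n φ x a ha => ?_) φ x
  have he : ∀ y : M, (fun i => ((Fin.snoc (inclusion hs ∘ x) y : Fin (n + 1) → M) i : ZFSet.{u})) =
      Fin.snoc (α := fun _ => ZFSet.{u}) (fun i => (x i : ZFSet.{u})) (y : ZFSet.{u}) :=
    fun y => snoc_coe _ _
  rw [realize_default_iff, he] at ha
  obtain ⟨b, hb, hb'⟩ := h n φ (fun i => x i) (fun i => (x i).2) ⟨a, a.2, ha⟩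
  refine ⟨⟨b, hb⟩, ?_⟩
  rw [realize_default_iff, he]
  exact hb'

theorem TarskiVaught.isElementarySubmodel_of_subset {X Y M : ZFSet.{u}} (hX : TarskiVaught X M)
    (hY : TarskiVaught Y M) (hXY : X ⊆ Y) (hYM : Y ⊆ M) : IsElementarySubmodel X Y :=
  ⟨⟨inclusion hXY, fun _ φ x => (hY.realize_iff hYM φ (inclusion hXY ∘ x)).symm.trans
    (hX.realize_iff (fun _ hx => hYM (hXY hx)) φ x)⟩, fun _ => rfl⟩

theorem TarskiVaught.isElementarySubmodel {X M : ZFSet.{u}} (hX : TarskiVaught X M)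
    (hXM : X ⊆ M) : IsElementarySubmodel X M :=
  ⟨⟨inclusion hXM, fun _ φ x => hX.realize_iff hXM φ x⟩, fun _ => rfl⟩

instance : Countable setLang.Symbols := by
  have h1 : IsEmpty (Σ l, setLang.Functions l) := ⟨fun f => f.2.elim⟩
  have h2 : Subsingleton (Σ l, setLang.Relations l) := ⟨by
    rintro ⟨l, r⟩ ⟨l', r'⟩
    change SetRel l at r
    change SetRel l' at r'
    cases r
    cases r'
    rfl⟩
  exact inferInstanceAs (Countable ((Σ l, setLang.Functions l) ⊕ (Σ l, setLang.Relations l)))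

theorem exists_enum_formula : ∃ q : ℕ → (Σ n, setLang.BoundedFormula Empty (n + 1)),
    Function.Surjective q := by
  have : Countable (Σ n, setLang.BoundedFormula Empty (n + 1)) :=
    Function.Injective.countable (β := Σ n, setLang.BoundedFormula Empty n)
      (f := fun q => ⟨q.1 + 1, q.2⟩) (by
        rintro ⟨n, φ⟩ ⟨m, ψ⟩ h
        obtain rfl : n = m := by simpa using congrArg Sigma.fst h
        simpa using h)
  have : Nonempty (Σ n, setLang.BoundedFormula Empty (n + 1)) := ⟨⟨0, ⊥⟩⟩
  exact exists_surjective_nat _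

/-! ### Closing off a subset of `V_κ` -/

theorem exists_subset_img_of_card_le {a b : ZFSet.{u}} (h : a.card ≤ b.card) :
    ∃ f : ZFSet.{u} → ZFSet.{u}, a ⊆ img f b ∧ ∀ x, f x = ∅ ∨ f x ∈ a := by
  classical
  have h1 : Cardinal.mk a ≤ Cardinal.mk b := by
    rw [ZFSet.cardinalMk_coe_sort, ZFSet.cardinalMk_coe_sort, Cardinal.lift_le]
    exact h
  obtain ⟨e⟩ := h1
  let f : ZFSet.{u} → ZFSet.{u} := fun x => if hx : ∃ y : a, (e y : ZFSet.{u}) = x then hx.choose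
    else ∅
  refine ⟨f, fun y hy => mem_img.2 ⟨e ⟨y, hy⟩, (e ⟨y, hy⟩).2, ?_⟩, fun x => ?_⟩
  · have hx : ∃ z : a, (e z : ZFSet.{u}) = e ⟨y, hy⟩ := ⟨_, rfl⟩
    have := e.injective (Subtype.ext hx.choose_spec)
    simp only [f, dif_pos hx, this]
  · by_cases hx : ∃ y : a, (e y : ZFSet.{u}) = x
    · simp only [f, dif_pos hx]
      exact Or.inr hx.choose.2
    · exact Or.inl (dif_neg hx)

theorem card_sUnion_img_le {l : Cardinal.{u}} (hl : Cardinal.aleph0 ≤ l) {a : ZFSet.{u}}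
    {f : ZFSet.{u} → ZFSet.{u}} (ha : a.card ≤ l) (hf : ∀ x ∈ a, (f x).card ≤ l) :
    (⋃₀ img f a : ZFSet.{u}).card ≤ l := by
  have h1 : (⋃₀ img f a : ZFSet.{u}) = ZFSet.iUnion (fun x : a => f x) := by
    ext z
    simp [ZFSet.mem_sUnion, mem_img]
  have h2 := ZFSet.lift_card_iUnion_le_sum_card (f := fun x : a => f x)
  rw [← h1] at h2
  rw [← Cardinal.lift_le.{u + 1}]
  refine h2.trans ((Cardinal.sum_le_sum (fun x : a => (f x).card) (fun _ => l)
    fun x => hf x.1 x.2).trans ?_)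
  rw [Cardinal.sum_const, ZFSet.cardinalMk_coe_sort, Cardinal.lift_lift, Cardinal.lift_umax.{u, u+1},
    Cardinal.lift_umax.{u, u+1}, ← Cardinal.lift_mul, Cardinal.lift_le]
  exact Cardinal.mul_le_of_le hl ha le_rfl

/-- The instance of the Tarski–Vaught criterion for one formula, with the parameters coded as a
sequence. -/
def TarskiVaughtFor (V y : ZFSet.{u}) (q : Σ n, setLang.BoundedFormula Empty (n + 1)) : Prop :=
  ∀ a ∈ V, (∀ i ∈ (q.1 : Ordinal.{u}).toZFSet, ev a i ∈ y) →
    (∃ x ∈ V, Sat V q.2 Empty.elim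
      (Fin.snoc (α := fun _ => ZFSet.{u}) (fun i => ev a ((i : ℕ) : Ordinal.{u}).toZFSet) x)) →
    ∃ x ∈ y, Sat V q.2 Empty.elim
      (Fin.snoc (α := fun _ => ZFSet.{u}) (fun i => ev a ((i : ℕ) : Ordinal.{u}).toZFSet) x)

/-- The hull is a union of ξ stages, each adding to `g` all sequences of length less than ξ from the
union of the earlier stages and the Skolem values at elements of that union. By `hQ` there are at
most |ξ| such sequences over a set of size |ξ|; by `hb`, which is regularity of ξ, each short
sequence from the union already comes from stages below some bound. -/
theorem exists_hull {κ : Cardinal.{u}} (hi : κ.IsInaccessible) {ξ e g : ZFSet.{u}}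
    (hξ : ξ ∈ ordSet κ) (hω : Ordinal.omega0.toZFSet ∈ ξ)
    (hQ : ∀ η ∈ ξ, ∀ s, ZFSet.IsFunc η ξ s → ∃ i ∈ ξ, ev e i = s)
    (hb : ∀ η ∈ ξ, ∀ s, ZFSet.IsFunc η ξ s → ∃ β ∈ ξ, ∀ i ∈ η, ev s i ∈ β)
    (hg : g ⊆ V_ κ.ord) (hgc : g.card ≤ ξ.card) :
    ∃ y ∈ V_ κ.ord, g ⊆ y ∧ y.card ≤ ξ.card ∧ (∀ η ∈ ξ, ∀ s, ZFSet.IsFunc η y s → s ∈ y) ∧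
      ∀ q, TarskiVaughtFor (V_ κ.ord) y q := by
  classical
  obtain ⟨q, hq⟩ := exists_enum_formula
  have hξt : ξ.IsTransitive := (isOrdinal_of_mem_ordSet hξ).isTransitive
  have hωs : Ordinal.omega0.toZFSet ⊆ ξ := hξt _ hω
  have hξV : ξ ∈ V_ κ.ord := ordSet_subset_V hξ
  have hl : Cardinal.aleph0 ≤ ξ.card := by
    have := ZFSet.card_mono hωs
    rwa [Ordinal.card_toZFSet, Ordinal.card_omega0] at this
  have hnat : ∀ n : ℕ, (n : Ordinal.{u}).toZFSet ∈ Ordinal.omega0.toZFSet := fun n =>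
    Ordinal.toZFSet_mem_toZFSet_iff.2 (Ordinal.natCast_lt_omega0 n)
  -- `dec` reads a natural number off its von Neumann numeral; its values at other sets are
  -- irrelevant.
  let dec : ZFSet.{u} → ℕ := Function.invFun (fun n : ℕ => (n : Ordinal.{u}).toZFSet)
  have hdec : ∀ n : ℕ, dec (n : Ordinal.{u}).toZFSet = n := fun n =>
    Function.leftInverse_invFun (fun m n hmn => by
      simpa using Ordinal.toZFSet_injective hmn) n
  let Sol : (Σ n, setLang.BoundedFormula Empty (n + 1)) → ZFSet.{u} → ZFSet.{u} → Prop :=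
    fun q a x => x ∈ V_ κ.ord ∧ Sat (V_ κ.ord) q.2 Empty.elim
      (Fin.snoc (α := fun _ => ZFSet.{u}) (fun i => ev a ((i : ℕ) : Ordinal.{u}).toZFSet) x)
  let sk : (Σ n, setLang.BoundedFormula Empty (n + 1)) → ZFSet.{u} → ZFSet.{u} := fun q a =>
    if h : ∃ x, Sol q a x then h.choose else ∅
  have hsk : ∀ q a, (∃ x, Sol q a x) → Sol q a (sk q a) := fun q a h => by
    simp only [sk, dif_pos h]
    exact h.choose_spec
  have hskV : ∀ q a, sk q a ∈ V_ κ.ord := fun q a => by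
    by_cases h : ∃ x, Sol q a x
    · exact (hsk q a h).1
    · simp only [sk, dif_neg h]
      exact empty_mem_V hi
  let seqs : ZFSet.{u} → ZFSet.{u} := fun z =>
    ZFSet.sep (fun s => ∃ η ∈ ξ, ZFSet.IsFunc η z s) (V_ κ.ord)
  let skz : ZFSet.{u} → ZFSet.{u} := fun z =>
    ⋃₀ img (fun n => img (sk (q (dec n))) z) Ordinal.omega0.toZFSet
  let H : ZFSet.{u} → ZFSet.{u} := fun z => g ∪ (seqs z ∪ skz z)
  have hseqs : ∀ z, z.card ≤ ξ.card → (seqs z).card ≤ ξ.card := by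
    intro z hz
    obtain ⟨t, ht, -⟩ := exists_subset_img_of_card_le hz
    -- As `t` maps a superset of indices in `ξ` onto `z`, a sequence in `z` is `t` composed with a
    -- sequence of elements of `ξ`, and that one has an index `k` in `ξ`. So a pair from `ξ`
    -- determines the sequence.
    have h1 : seqs z ⊆ ⋃₀ img (fun η => img (fun k => lam (fun i => t (ev (ev e k) i)) η) ξ) ξ := by
      intro s hs
      obtain ⟨_, η, hη, hsf⟩ := ZFSet.mem_sep.1 hs
      have hch : ∀ i, ∃ j, i ∈ η → j ∈ ξ ∧ ev s i = t j := fun i => by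
        by_cases hi : i ∈ η
        · obtain ⟨j, hj, h⟩ := mem_img.1 (ht (IsFunc.ev_mem hsf hi))
          exact ⟨j, fun _ => ⟨hj, h⟩⟩
        · exact ⟨∅, fun h => absurd h hi⟩
      choose j hj using hch
      obtain ⟨k, hk, hke⟩ := hQ η hη (lam j η) (isFunc_lam fun i hi => (hj i hi).1)
      refine ZFSet.mem_sUnion.2 ⟨_, mem_img.2 ⟨η, hη, rfl⟩, mem_img.2 ⟨k, hk, ?_⟩⟩
      rw [IsFunc.eq_lam hsf]
      refine lam_congr fun i hi => ?_
      rw [hke, ev_lam hi, (hj i hi).2]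
    exact (ZFSet.card_mono h1).trans
      (card_sUnion_img_le hl le_rfl fun η _ => card_img_le)
  have hskz : ∀ z, z.card ≤ ξ.card → (skz z).card ≤ ξ.card := fun z hz =>
    card_sUnion_img_le hl (ZFSet.card_mono hωs) fun n _ => card_img_le.trans hz
  have hH : ∀ z, z.card ≤ ξ.card → (H z).card ≤ ξ.card := fun z hz =>
    ZFSet.card_union_le.trans (Cardinal.add_le_of_le hl hgc
      (ZFSet.card_union_le.trans (Cardinal.add_le_of_le hl (hseqs z hz) (hskz z hz))))
  have hHV : ∀ z, H z ⊆ V_ κ.ord := by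
    intro z x hx
    rcases ZFSet.mem_union.1 hx with hx | hx
    · exact hg hx
    rcases ZFSet.mem_union.1 hx with hx | hx
    · exact (ZFSet.mem_sep.1 hx).1
    · obtain ⟨w, hw, hx⟩ := ZFSet.mem_sUnion.1 hx
      obtain ⟨n, _, rfl⟩ := mem_img.1 hw
      obtain ⟨a, _, rfl⟩ := mem_img.1 hx
      exact hskV _ _
  let Y : ZFSet.{u} → ZFSet.{u} := ZFSet.mem_wf.fix fun α F =>
    H (⋃₀ ZFSet.range (fun β : α => F β β.2))
  have hY : ∀ α, Y α = H (⋃₀ img Y α) := fun α => ZFSet.mem_wf.fix_eq _ α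
  have hYc : ∀ α, α ∈ ξ → (Y α).card ≤ ξ.card := by
    intro α
    induction α using ZFSet.inductionOn with
    | _ α ih =>
      intro hα
      rw [hY]
      exact hH _ (card_sUnion_img_le hl (ZFSet.card_mono (hξt _ hα))
        fun β hβ => ih β hβ (hξt _ hα hβ))
  have hmem : ∀ x α, x ∈ (⋃₀ img Y α : ZFSet.{u}) ↔ ∃ β ∈ α, x ∈ Y β := by
    intro x α
    rw [ZFSet.mem_sUnion]
    constructor
    · rintro ⟨w, hw, hx⟩
      obtain ⟨β, hβ, rfl⟩ := mem_img.1 hw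
      exact ⟨β, hβ, hx⟩
    · rintro ⟨β, hβ, hx⟩
      exact ⟨_, mem_img.2 ⟨β, hβ, rfl⟩, hx⟩
  have hyc : (⋃₀ img Y ξ : ZFSet.{u}).card ≤ ξ.card := card_sUnion_img_le hl le_rfl hYc
  have hyV : (⋃₀ img Y ξ : ZFSet.{u}) ⊆ V_ κ.ord := fun x hx => by
    obtain ⟨β, _, hx⟩ := (hmem x ξ).1 hx
    rw [hY] at hx
    exact hHV _ hx
  have hseq : ∀ η ∈ ξ, ∀ s, ZFSet.IsFunc η (⋃₀ img Y ξ : ZFSet.{u}) s →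
      s ∈ (⋃₀ img Y ξ : ZFSet.{u}) := by
    intro η hη s hs
    have hch : ∀ i, ∃ α, i ∈ η → α ∈ ξ ∧ ev s i ∈ Y α := fun i => by
      by_cases hi : i ∈ η
      · obtain ⟨α, hα, h⟩ := (hmem _ ξ).1 (IsFunc.ev_mem hs hi)
        exact ⟨α, fun _ => ⟨hα, h⟩⟩
      · exact ⟨∅, fun h => absurd h hi⟩
    choose j hj using hch
    obtain ⟨β, hβ, h1⟩ := hb η hη (lam j η) (isFunc_lam fun i hi => (hj i hi).1)
    refine (hmem s ξ).2 ⟨β, hβ, ?_⟩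
    rw [hY]
    refine ZFSet.mem_union.2 (Or.inr (ZFSet.mem_union.2 (Or.inl (ZFSet.mem_sep.2 ⟨?_, η, hη, ?_⟩))))
    · rw [IsFunc.eq_lam hs]
      exact lam_mem_V hi (V_transitive _ hξV hη) fun i hi => hyV (IsFunc.ev_mem hs hi)
    · refine IsFunc.mono hs fun i hi => (hmem _ β).2 ⟨j i, ?_, (hj i hi).2⟩
      have := h1 i hi
      rwa [ev_lam hi] at this
  refine ⟨_, mem_V_of_card_lt hi hyV (hyc.trans_lt (card_lt_of_mem_V hi hξV)), ?_, hyc, hseq, ?_⟩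
  · intro x hx
    refine (hmem x ξ).2 ⟨_, hω, ?_⟩
    rw [hY]
    exact ZFSet.mem_union.2 (Or.inl hx)
  · intro r a _ har hex
    obtain ⟨m, rfl⟩ := hq r
    have hn := hωs (hnat (q m).1)
    -- The code `a` need not be in the hull, but its restriction to the relevant numeral is, being a
    -- finite sequence of elements of the hull. Hence Skolem functions of one argument suffice.
    have hs := hseq _ hn (lam (ev a) ((q m).1 : Ordinal.{u}).toZFSet) (isFunc_lam har)
    have he : (fun i : Fin (q m).1 => ev a ((i : ℕ) : Ordinal.{u}).toZFSet) =
        fun i : Fin (q m).1 => ev (lam (ev a) ((q m).1 : Ordinal.{u}).toZFSet)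
          ((i : ℕ) : Ordinal.{u}).toZFSet := by
      funext i
      rw [ev_lam (Ordinal.toZFSet_mem_toZFSet_iff.2 (by exact_mod_cast i.2))]
    rw [he] at hex ⊢
    have h2 := hsk (q m) _ hex
    refine ⟨_, ?_, h2.2⟩
    obtain ⟨α, hα, h3⟩ := (hmem _ ξ).1 hs
    -- Boundedness of the one-term sequence with value `α` supplies a later stage `β` in `ξ`, where
    -- the Skolem value is added.
    have h1ξ : (((1 : ℕ) : Ordinal.{u}).toZFSet) ∈ ξ := hωs (hnat 1)
    obtain ⟨β, hβ, h4⟩ := hb _ h1ξ (lam (fun _ => α) _) (isFunc_lam fun _ _ => hα)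
    have h0 : (((0 : ℕ) : Ordinal.{u}).toZFSet) ∈ (((1 : ℕ) : Ordinal.{u}).toZFSet) :=
      Ordinal.toZFSet_mem_toZFSet_iff.2 (by exact_mod_cast Nat.zero_lt_one)
    have h5 := h4 _ h0
    rw [ev_lam h0] at h5
    refine (hmem _ ξ).2 ⟨β, hβ, ?_⟩
    rw [hY]
    refine ZFSet.mem_union.2 (Or.inr (ZFSet.mem_union.2 (Or.inr ?_)))
    refine ZFSet.mem_sUnion.2 ⟨_, mem_img.2 ⟨(m : Ordinal.{u}).toZFSet, hnat m, rfl⟩, ?_⟩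
    rw [hdec]
    exact mem_img.2 ⟨_, (hmem _ β).2 ⟨α, h5, h3⟩, rfl⟩


/-! ### Elementary hulls in the ultrapower, computed pointwise -/

section Dfn

variable {W V : ZFSet.{u}} [hW : IsTransModel W] [hV : Fact (V ∈ W)]
  [hn : ∀ n : ℕ, Fact ((n : Ordinal.{u}).toZFSet ∈ W)]

instance Dfn.sat_snoc {β : Type} [Finite β] (q : Σ n, setLang.BoundedFormula Empty (n + 1))
    (s t : (β → W) → ZFSet.{u}) [hs : Tm s] [ht : Tm t] :
    Dfn (fun v => Sat V q.2 Empty.elim (Fin.snoc (α := fun _ => ZFSet.{u})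
      (fun i => ev (s v) ((i : ℕ) : Ordinal.{u}).toZFSet) (t v))) := by
  have h1 := dfn_sat (W := W) (V := V) q.2 (β := β) (fun i _ => i.elim)
    (fun i v => Fin.snoc (α := fun _ => ZFSet.{u})
      (fun i => ev (s v) ((i : ℕ) : Ordinal.{u}).toZFSet) (t v) i) (fun i => i.elim) (fun i => by
        refine Fin.lastCases ?_ (fun j => ?_) i
        · simpa only [Fin.snoc_last]
        · simp only [Fin.snoc_castSucc]; infer_instance)
  refine h1.congr fun v => iff_of_eq ?_
  exact congrArg (fun a => Sat V q.2 a _) (Subsingleton.elim _ _)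

instance Dfn.tarskiVaughtFor (q : Σ n, setLang.BoundedFormula Empty (n + 1)) :
    Dfn (fun w : Option Empty → W => TarskiVaughtFor V (w none) q) := by
  unfold TarskiVaughtFor
  infer_instance

end Dfn

/-- `X` is the image under `p` of a function `F` with `|F ξ| ≤ |ξ|` on a large set. -/
def IsSmall (κ : Cardinal.{u}) (W U : ZFSet.{u}) (p : ZFSet.{u} → ZFSet.{u}) (X : ZFSet.{u}) :
    Prop :=
  ∃ F, IsFunTo κ W (V_ κ.ord) F ∧ X = p F ∧
    AE κ U (fun ξ => ∃ t ∈ V_ κ.ord, ev F ξ ⊆ img (ev t) ξ)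

/-- The left side is a bounded statement with parameter V_κ, hence definable over `W`; this is why
`IsSmall` uses it in place of a comparison of cardinals. -/
theorem exists_subset_img_ev_iff {κ : Cardinal.{u}} (hi : κ.IsInaccessible) {a ξ : ZFSet.{u}}
    (hξ : ξ ∈ ordSet κ) (ha : a ⊆ V_ κ.ord) :
    (∃ t ∈ V_ κ.ord, a ⊆ img (ev t) ξ) ↔ a.card ≤ ξ.card := by
  constructor
  · rintro ⟨t, _, h⟩
    exact (ZFSet.card_mono h).trans card_img_le
  · intro h
    obtain ⟨f, hf, h1⟩ := exists_subset_img_of_card_le h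
    refine ⟨lam f ξ, lam_mem_V hi (ordSet_subset_V hξ) fun x _ => ?_, fun x hx => ?_⟩
    · rcases h1 x with h2 | h2
      · rw [h2]
        exact empty_mem_V hi
      · exact ha h2
    · obtain ⟨i, hi, rfl⟩ := mem_img.1 (hf hx)
      exact mem_img.2 ⟨i, hi, (ev_lam hi).symm⟩

namespace RamseyUltrapower

variable {κ : Cardinal.{u}} {W U : ZFSet.{u}} {p : ZFSet.{u} → ZFSet.{u}}

theorem fact_nat_mem (S : RamseyUltrapower κ W U p) (n : ℕ) :
    Fact ((n : Ordinal.{u}).toZFSet ∈ W) := by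
  refine ⟨S.model.toZFSet_mem (Cardinal.lt_ord.2 ?_)⟩
  rw [Ordinal.card_nat]
  exact (Cardinal.natCast_lt_aleph0 (n := n)).trans S.inaccessible.1

theorem omega_mem (S : RamseyUltrapower κ W U p) : Ordinal.omega0.toZFSet ∈ ordSet κ := by
  refine toZFSet_mem_ordSet.2 ?_
  rw [← Cardinal.ord_aleph0, Cardinal.ord_lt_ord]
  exact S.inaccessible.1

variable [hW : IsTransModel W] [hκW : Fact (ordSet κ ∈ W)] [hV : Fact (V_ κ.ord ∈ W)]

/-- Shorter sequences of ordinals below `ξ` are, for most `ξ`, fixed sequences. -/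
theorem ae_forall_func (S : RamseyUltrapower κ W U p) (R : ZFSet.{u} → ZFSet.{u} → Prop)
    [hR : Dfn (fun w : Option (Option Empty) → W => R (w none) (w (some none)))]
    (h : ∀ η ∈ ordSet κ, ∀ s, ZFSet.IsFunc η (ordSet κ) s → AE κ U (fun ξ => R ξ s)) :
    AE κ U (fun ξ => ∀ s ∈ V_ κ.ord, (∃ η ∈ ξ, ZFSet.IsFunc η ξ s) → R ξ s) := by
  have := hR.swap
  by_contra hne
  have h1 := (S.ultra.ae_not _).2 hne
  obtain ⟨k, hk, h2⟩ := exists_isFunTo_of_ae_exists S.ultra (empty_mem_V S.inaccessible)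
    (fun ξ s => (∃ η ∈ ξ, ZFSet.IsFunc η ξ s) ∧ ¬ R ξ s)
    ((IsMUltrafilter.ae_congr fun ξ _ => by push Not; rfl).1 h1)
  have : Fact (k ∈ W) := ⟨hk.1⟩
  -- The counterexample at `ξ` has its length and all its values below `ξ`. Normality fixes the
  -- length and then each value, and completeness combines these fewer than `κ` facts, so one fixed
  -- sequence is the counterexample almost everywhere.
  obtain ⟨η, hη, h3⟩ := S.ultra.ae_regressive (fun ξ η => ZFSet.IsFunc η ξ (ev k ξ))
    (S.ultra.ae_mono h2 _ fun ξ _ h => h.1)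
  have : Fact (η ∈ W) := ⟨hW.transitive _ hκW.out hη⟩
  have hηV : η ∈ V_ κ.ord := ordSet_subset_V hη
  have hηW : ∀ {i}, i ∈ η → i ∈ W := fun hi => hW.transitive _ (hW.transitive _ hκW.out hη) hi
  have hch : ∀ i, ∃ j, i ∈ η → j ∈ ordSet κ ∧ AE κ U (fun ξ => ev (ev k ξ) i = j) := fun i => by
    by_cases hi : i ∈ η
    · have : Fact (i ∈ W) := ⟨hηW hi⟩
      obtain ⟨j, hj, h⟩ := S.ultra.ae_regressive (fun ξ j => ev (ev k ξ) i = j)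
        (S.ultra.ae_mono h3 _ fun ξ _ h => ⟨_, IsFunc.ev_mem h hi, rfl⟩)
      exact ⟨j, fun _ => ⟨hj, h⟩⟩
    · exact ⟨∅, fun h => absurd h hi⟩
  choose j hj using hch
  have hs : ZFSet.IsFunc η (ordSet κ) (lam j η) := isFunc_lam fun i hi => (hj i hi).1
  have : Fact (lam j η ∈ W) := ⟨S.model.lam_mem_of_card_lt (fun i => hηW)
    (S.card_lt_of_mem hη) fun i hi => hW.transitive _ hκW.out (hj i hi).1⟩
  have h4 := S.ae_forall_mem hηV (fun ξ i => ev (ev k ξ) i = ev (lam j η) i) fun i hi => by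
    simp only [ev_lam hi]
    exact (hj i hi).2
  obtain ⟨ξ, _, ⟨⟨h5, h6⟩, h7⟩, h8⟩ := S.ultra.ae_exists
    (S.ultra.ae_and (S.ultra.ae_and (S.ultra.ae_and h3 h4) (h η hη _ hs)) h2)
  have : ev k ξ = lam j η := IsFunc.ext h5 hs h6
  rw [← this] at h7
  exact h8.2 h7

/-- A fixed short sequence has a fixed index, which lies below almost every ξ. This is the
hypothesis `hQ` of `exists_hull`. -/
theorem ae_exists_index (S : RamseyUltrapower κ W U p) {e : ZFSet.{u}} (he : e ∈ W)
    (hs : ∀ x ∈ V_ κ.ord, ∃ i ∈ ordSet κ, ev e i = x) :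
    AE κ U (fun ξ => ∀ s ∈ V_ κ.ord, (∃ η ∈ ξ, ZFSet.IsFunc η ξ s) → ∃ i ∈ ξ, ev e i = s) := by
  have : Fact (e ∈ W) := ⟨he⟩
  refine S.ae_forall_func _ fun η hη s hsf => ?_
  obtain ⟨i, hi, rfl⟩ := hs s (by
    rw [IsFunc.eq_lam hsf]
    exact lam_mem_V S.inaccessible (ordSet_subset_V hη) fun i hi =>
      ordSet_subset_V (IsFunc.ev_mem hsf hi))
  have : Fact (i ∈ W) := ⟨hW.transitive _ hκW.out hi⟩
  exact S.ultra.ae_mono (S.ultra.ae_mem S.model hi) _ fun ξ _ h => ⟨i, h, rfl⟩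

/-- Almost every ξ is regular, since a fixed short sequence is bounded in κ. Quantifying over ⋃₀ ⋃₀
s, which contains the arguments and values of s, keeps the length out of the relation between ξ and
s. -/
theorem ae_bounded (S : RamseyUltrapower κ W U p) :
    AE κ U (fun ξ => ∀ s ∈ V_ κ.ord, (∃ η ∈ ξ, ZFSet.IsFunc η ξ s) → ∃ β ∈ ξ,
      ∀ i ∈ (⋃₀ ⋃₀ s : ZFSet.{u}), ∀ j ∈ (⋃₀ ⋃₀ s : ZFSet.{u}), ZFSet.pair i j ∈ s → j ∈ β) := by
  refine S.ae_forall_func (fun ξ s => ∃ β ∈ ξ, ∀ i ∈ (⋃₀ ⋃₀ s : ZFSet.{u}),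
    ∀ j ∈ (⋃₀ ⋃₀ s : ZFSet.{u}), ZFSet.pair i j ∈ s → j ∈ β) fun η hη s hsf => ?_
  have hsV : s ∈ V_ κ.ord := by
    rw [IsFunc.eq_lam hsf]
    exact lam_mem_V S.inaccessible (ordSet_subset_V hη) fun i hi =>
      ordSet_subset_V (IsFunc.ev_mem hsf hi)
  have : Fact (s ∈ W) := ⟨hW.transitive _ hV.out hsV⟩
  obtain ⟨β, hβ, hb⟩ := S.ultra.bounded_of_card_lt S.model (x := img (ev s) η)
    (fun x hx => by
      obtain ⟨i, hi, rfl⟩ := mem_img.1 hx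
      exact IsFunc.ev_mem hsf hi)
    (card_img_le.trans_lt (S.card_lt_of_mem hη))
  refine S.ultra.ae_mono (S.ultra.ae_mem S.model hβ) _ fun ξ _ h => ⟨β, h, ?_⟩
  intro i _ j _ hij
  obtain ⟨hi, rfl⟩ := (IsFunc.pair_mem_iff hsf).1 hij
  exact hb _ (mem_img.2 ⟨i, hi, rfl⟩)

/-- The quantifier over formulas is external. Each formula defines a set in `W`, the `ω`-sequence of
these sets lies in `W` by closure, and their intersection is formed there. -/
theorem sep_tarskiVaught_mem (S : RamseyUltrapower κ W U p) :
    ZFSet.sep (fun y => ∀ q, TarskiVaughtFor (V_ κ.ord) y q) (V_ κ.ord) ∈ W := by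
  obtain ⟨q, hq⟩ := exists_enum_formula
  have hω := hW.transitive _ hκW.out S.omega_mem
  have : Fact (Ordinal.omega0.toZFSet ∈ W) := ⟨hω⟩
  have := S.fact_nat_mem
  let dec : ZFSet.{u} → ℕ := Function.invFun (fun n : ℕ => (n : Ordinal.{u}).toZFSet)
  have hdec : ∀ n : ℕ, dec (n : Ordinal.{u}).toZFSet = n := fun n =>
    Function.leftInverse_invFun (fun m n hmn => by
      simpa using Ordinal.toZFSet_injective hmn) n
  have hs : Fact (lam (fun n => ZFSet.sep (fun y => TarskiVaughtFor (V_ κ.ord) y (q (dec n)))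
      (V_ κ.ord)) Ordinal.omega0.toZFSet ∈ W) := by
    refine ⟨S.model.lam_mem (toZFSet_mem_ordSet.1 S.omega_mem) fun n _ => ?_⟩
    exact mem_of_tm (W := W) (ZFSet.sep (fun y => TarskiVaughtFor (V_ κ.ord) y (q (dec n)))
      (V_ κ.ord))
  have h1 := mem_of_tm (W := W) (ZFSet.sep (fun y => ∀ n ∈ Ordinal.omega0.toZFSet, y ∈ ev
    (lam (fun n => ZFSet.sep (fun y => TarskiVaughtFor (V_ κ.ord) y (q (dec n)))
      (V_ κ.ord)) Ordinal.omega0.toZFSet) n) (V_ κ.ord))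
  convert h1 using 1
  ext y
  rw [ZFSet.mem_sep, ZFSet.mem_sep]
  refine and_congr_right fun hy => ?_
  constructor
  · intro h n hn
    rw [ev_lam hn, ZFSet.mem_sep]
    exact ⟨hy, h _⟩
  · intro h r
    obtain ⟨n, rfl⟩ := hq r
    have hn : (n : Ordinal.{u}).toZFSet ∈ Ordinal.omega0.toZFSet :=
      Ordinal.toZFSet_mem_toZFSet_iff.2 (Ordinal.natCast_lt_omega0 n)
    have h2 := h _ hn
    rw [ev_lam hn, ZFSet.mem_sep, hdec] at h2
    exact h2.2

end RamseyUltrapower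


theorem ev_mem_V {κ : Cardinal.{u}} {f x : ZFSet.{u}} (hf : f ∈ V_ κ.ord) : ev f x ∈ V_ κ.ord :=
  sUnion_mem_V (ZFSet.mem_vonNeumann_of_subset (fun _ h => (ZFSet.mem_sep.1 h).1)
    (sUnion_mem_V (sUnion_mem_V hf)))

/-- Order `X` by least index under `f`; initial segments are indexed by elements of an ordinal below
`κ` and so have size less than `κ`. -/
theorem IsModel.hasSizeIn_of_subset_img {κ : Cardinal.{u}} {W : ZFSet.{u}} (h : IsModel κ W)
    {X f : ZFSet.{u}} (hX : X ∈ W) (hf : f ∈ W) (hXf : X ⊆ img (ev f) (ordSet κ))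
    (hc : κ ≤ X.card) : HasSizeIn κ W X := by
  have := h.isTransModel
  have : Fact (ordSet κ ∈ W) := ⟨h.mem⟩
  have : Fact (X ∈ W) := ⟨hX⟩
  have : Fact (f ∈ W) := ⟨hf⟩
  have hch : ∀ x, ∃ i, x ∈ X → i ∈ ordSet κ ∧ ev f i = x ∧
      ∀ j ∈ ordSet κ, ev f j = x → i = j ∨ i ∈ j := by
    intro x
    by_cases hx : x ∈ X
    · obtain ⟨i₀, hi₀, h0⟩ := mem_img.1 (hXf hx)
      obtain ⟨i, ⟨hi, hix⟩, hmin⟩ := ZFSet.mem_wf.has_min {i | i ∈ ordSet κ ∧ ev f i = x}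
        ⟨i₀, hi₀, h0.symm⟩
      refine ⟨i, fun _ => ⟨hi, hix, fun j hj hjx => ?_⟩⟩
      rcases (isOrdinal_of_mem_ordSet hi).mem_trichotomous (isOrdinal_of_mem_ordSet hj) with
        h1 | h1 | h1
      · exact Or.inr h1
      · exact Or.inl h1
      · exact absurd h1 (hmin j ⟨hj, hjx⟩)
    · exact ⟨∅, fun h => absurd h hx⟩
  choose idx hidx using hch
  -- The map `idx` was chosen outside `W`, so the comparison is expressed without it: some index of
  -- `x` precedes every index of `y`.
  set r := ZFSet.sep (fun q => ∃ x ∈ X, ∃ y ∈ X, q = ZFSet.pair x y ∧ ∃ i ∈ ordSet κ, ev f i = x ∧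
    ∀ j ∈ ordSet κ, ev f j = y → i ∈ j) (ZFSet.prod X X) with hr
  have hrW : r ∈ W := mem_of_tm _
  have hpair : ∀ x ∈ X, ∀ y ∈ X, (ZFSet.pair x y ∈ r ↔ idx x ∈ idx y) := by
    intro x hx y hy
    obtain ⟨hx1, hx2, hx3⟩ := hidx x hx
    obtain ⟨hy1, hy2, hy3⟩ := hidx y hy
    rw [hr, ZFSet.mem_sep, ZFSet.pair_mem_prod]
    constructor
    · rintro ⟨_, x', _, y', _, he, i, hi, hix, hij⟩
      obtain ⟨rfl, rfl⟩ := ZFSet.pair_inj.1 he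
      have h1 := hij _ hy1 hy2
      rcases hx3 i hi hix with h2 | h2
      · rwa [h2]
      · exact (isOrdinal_of_mem_ordSet hy1).mem_trans h2 h1
    · intro h1
      refine ⟨⟨hx, hy⟩, x, hx, y, hy, rfl, idx x, hx1, hx2, fun j hj hjy => ?_⟩
      rcases hy3 j hj hjy with h2 | h2
      · rwa [← h2]
      · exact (isOrdinal_of_mem_ordSet hj).mem_trans h1 h2
  refine h.hasSizeIn_of_wellOrder hX hrW hc ?_ ?_ ?_ ?_
  · intro x hx y hy z hz
    rw [hpair x hx y hy, hpair y hy z hz, hpair x hx z hz]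
    exact fun h1 h2 => (isOrdinal_of_mem_ordSet (hidx z hz).1).mem_trans h1 h2
  · intro x hx y hy
    rw [hpair x hx y hy, hpair y hy x hx]
    rcases (isOrdinal_of_mem_ordSet (hidx x hx).1).mem_trichotomous
      (isOrdinal_of_mem_ordSet (hidx y hy).1) with h1 | h1 | h1
    · exact Or.inl h1
    · exact Or.inr (Or.inl (by rw [← (hidx x hx).2.1, ← (hidx y hy).2.1, h1]))
    · exact Or.inr (Or.inr h1)
  · intro s hs hne
    obtain ⟨m, hm, hmin⟩ := (InvImage.wf idx ZFSet.mem_wf).has_min s hne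
    exact ⟨m, hm, fun x hx h1 => hmin x hx ((hpair x (hs x hx) m (hs m hm)).1 h1)⟩
  · intro x hx
    have h1 : (idx x).card < κ := by
      obtain ⟨a, ha, he⟩ := mem_ordSet.1 (hidx x hx).1
      rw [← he, Ordinal.card_toZFSet]
      exact Cardinal.lt_ord.1 ha
    refine lt_of_le_of_lt ((ZFSet.card_mono fun y hy => ?_).trans
      (card_img_le (f := ev f) (a := idx x))) h1
    obtain ⟨hy, hyx⟩ := ZFSet.mem_sep.1 hy
    exact mem_img.2 ⟨idx y, (hpair y hy x hx).1 hyx, (hidx y hy).2.1.symm⟩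

theorem aleph0_le_card_of_omega_mem {κ : Cardinal.{u}} {ξ : ZFSet.{u}} (hξ : ξ ∈ ordSet κ) (h : Ordinal.omega0.toZFSet ∈ ξ) :
    Cardinal.aleph0 ≤ ξ.card := by
  have := ZFSet.card_mono ((isOrdinal_of_mem_ordSet hξ).isTransitive _ h)
  rwa [Ordinal.card_toZFSet, Ordinal.card_omega0] at this

namespace RamseyUltrapower

variable {κ : Cardinal.{u}} {W U : ZFSet.{u}} {p : ZFSet.{u} → ZFSet.{u}}
  [hW : IsTransModel W] [hκW : Fact (ordSet κ ∈ W)]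

theorem ae_omega_mem (S : RamseyUltrapower κ W U p) :
    AE κ U (fun ξ => Ordinal.omega0.toZFSet ∈ ξ) := S.ultra.ae_mem S.model S.omega_mem

variable [hV : Fact (V_ κ.ord ∈ W)]

theorem isSmall_subset (S : RamseyUltrapower κ W U p) {X : ZFSet.{u}}
    (hX : IsSmall κ W U p X) : X ∈ imageV κ p ∧ X ⊆ imageV κ p := by
  obtain ⟨F, hF, rfl, _⟩ := hX
  have := S.mem_iff.2 ⟨F, hF, rfl⟩
  exact ⟨this, S.isTransitive _ this⟩

/-- If G represents `Z`, then `exists_hull` applies to G(ξ) for almost all ξ; a function F in `W`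
chooses such hulls, and the new set is its class. Elementarity passes through Łoś's theorem. Closure
under δ-sequences holds because δ < ξ for almost all ξ, so the values of a representing function are
short sequences in F(ξ). -/
theorem isSmall_hull (S : RamseyUltrapower κ W U p) {Z : ZFSet.{u}} (hZ : IsSmall κ W U p Z) :
    ∃ X, IsSmall κ W U p X ∧ Z ⊆ X ∧ TarskiVaught X (imageV κ p) ∧
      ∀ δ < κ.ord, ∀ s, ZFSet.IsFunc δ.toZFSet X s → s ∈ X := by
  obtain ⟨G, hG, rfl, hGs⟩ := hZ
  obtain ⟨e, heW, he, hes⟩ := S.exists_enum_V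
  have : Fact (G ∈ W) := ⟨hG.1⟩
  set E := ZFSet.sep (fun y => ∀ q, TarskiVaughtFor (V_ κ.ord) y q) (V_ κ.ord) with hE
  have : Fact (E ∈ W) := ⟨S.sep_tarskiVaught_mem⟩
  obtain ⟨F, hF, hFa⟩ := exists_isFunTo_of_ae_exists S.ultra (empty_mem_V S.inaccessible)
    (fun ξ y => ev G ξ ⊆ y ∧ (∃ t ∈ V_ κ.ord, y ⊆ img (ev t) ξ) ∧
      (∀ s ∈ V_ κ.ord, (∃ η ∈ ξ, ZFSet.IsFunc η y s) → s ∈ y) ∧ y ∈ E)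
    (S.ultra.ae_mono (S.ultra.ae_and (S.ultra.ae_and (S.ae_exists_index heW hes) S.ae_bounded)
      (S.ultra.ae_and S.ae_omega_mem hGs)) _ fun ξ hξ => by
      rintro ⟨⟨h1, h2⟩, h3, h4⟩
      have hGV : ev G ξ ⊆ V_ κ.ord := V_transitive _ (hG.ev_mem hξ)
      have hfV : ∀ η ∈ ξ, ∀ s, ZFSet.IsFunc η ξ s → s ∈ V_ κ.ord := fun η hη s hs => by
        rw [IsFunc.eq_lam hs]
        exact lam_mem_V S.inaccessible (V_transitive _ (ordSet_subset_V hξ) hη) fun i hi =>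
          V_transitive _ (ordSet_subset_V hξ) (IsFunc.ev_mem hs hi)
      obtain ⟨y, hy, hy1, hy2, hy3, hy4⟩ := exists_hull S.inaccessible hξ h3
        (fun η hη s hs => h1 s (hfV η hη s hs) ⟨η, hη, hs⟩)
        (fun η hη s hs => by
          obtain ⟨β, hβ, h5⟩ := h2 s (hfV η hη s hs) ⟨η, hη, hs⟩
          refine ⟨β, hβ, fun i hi => ?_⟩
          have h6 := (IsFunc.pair_mem_iff hs).2 ⟨hi, rfl⟩
          exact h5 _ (mem_sUnion_sUnion_of_pair h6).1 _ (mem_sUnion_sUnion_of_pair h6).2 h6)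
        hGV ((exists_subset_img_ev_iff S.inaccessible hξ hGV).1 h4)
      exact ⟨y, hy, hy1, (exists_subset_img_ev_iff S.inaccessible hξ (V_transitive _ hy)).2 hy2,
        fun s _ ⟨η, hη, hs⟩ => hy3 η hη s hs, ZFSet.mem_sep.2 ⟨hy, hy4⟩⟩)
  have : Fact (F ∈ W) := ⟨hF.1⟩
  have hFM := S.mem_iff.2 ⟨F, hF, rfl⟩
  have hFsub := S.isTransitive _ hFM
  have hrep : ∀ x ∈ p F, ∃ f, IsFunTo κ W (V_ κ.ord) f ∧ x = p f ∧
      AE κ U (fun ξ => ev f ξ ∈ ev F ξ) := fun x hx => by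
    obtain ⟨f, hf, rfl⟩ := S.mem_iff.1 (hFsub hx)
    exact ⟨f, hf, rfl, (S.collapse.mem_iff S.ultra hf.isUltFun hF.isUltFun).1 hx⟩
  refine ⟨p F, ⟨F, hF, rfl, S.ultra.ae_mono hFa _ fun ξ _ h => h.2.1⟩,
    S.collapse.subset_of_ae S.ultra hG.isUltFun hF.isUltFun
      (S.ultra.ae_mono hFa _ fun ξ _ h => h.1), ?_, ?_⟩
  · intro n φ a ha hex
    obtain ⟨x, hx, hsat⟩ := hex
    choose f hf hfa hfF using fun i => hrep _ (ha i)
    obtain ⟨k, hk, rfl⟩ := S.mem_iff.1 hx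
    have := S.fact_nat_mem
    have hsn : ∀ {n : ℕ} (b : Fin n → ZFSet.{u}) x (F : ZFSet.{u} → ZFSet.{u}),
        (fun i => F (Fin.snoc (α := fun _ => ZFSet.{u}) b x i)) =
          Fin.snoc (α := fun _ => ZFSet.{u}) (fun i => F (b i)) (F x) := by
      intro n b x F
      funext i
      refine Fin.lastCases ?_ (fun j => ?_) i <;> simp
    have hlos : ∀ k, IsFunTo κ W (V_ κ.ord) k → (Sat (imageV κ p) φ Empty.elim
        (Fin.snoc (α := fun _ => ZFSet.{u}) a (p k)) ↔ AE κ U (fun ξ => Sat (V_ κ.ord) φ Empty.elim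
          (Fin.snoc (α := fun _ => ZFSet.{u}) (fun i => ev (f i) ξ) (ev k ξ)))) := by
      intro k hk
      have h1 := S.collapse.sat_iff S.ultra (empty_mem_V S.inaccessible) φ Empty.elim
        (Fin.snoc (α := fun _ => ZFSet.{u}) f k) (fun i => i.elim) (fun i => by
          refine Fin.lastCases ?_ (fun j => ?_) i
          · simpa only [Fin.snoc_last]
          · simpa only [Fin.snoc_castSucc] using hf j)
      rw [hsn f k p] at h1
      have h2 : (fun i => p (f i)) = a := funext fun i => (hfa i).symm
      rw [h2] at h1
      have h3 : ∀ g : Empty → ZFSet.{u}, g = Empty.elim := fun g => Subsingleton.elim _ _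
      rw [h3 (fun i => p (Empty.elim i))] at h1
      refine h1.trans (iff_of_eq (congrArg (AE κ U) (funext fun ξ => ?_)))
      rw [hsn f k (fun x => ev x ξ), h3 (fun i => ev (Empty.elim i) ξ)]
    have hnV : (n : Ordinal.{u}).toZFSet ∈ V_ κ.ord :=
      V_transitive _ (ordSet_subset_V S.omega_mem)
        (Ordinal.toZFSet_mem_toZFSet_iff.2 (Ordinal.natCast_lt_omega0 n))
    let dec : ZFSet.{u} → ℕ := Function.invFun (fun n : ℕ => (n : Ordinal.{u}).toZFSet)
    have hdec : ∀ n : ℕ, dec (n : Ordinal.{u}).toZFSet = n := fun n =>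
      Function.leftInverse_invFun (fun m n hmn => by
        simpa using Ordinal.toZFSet_injective hmn) n
    -- `TarskiVaughtFor` expects its parameters as one coded sequence, so the `n` representatives
    -- are merged by `apply_lam` into a single function. The default `F` is never used at the
    -- numerals below `n`.
    let h : ZFSet.{u} → ZFSet.{u} := fun x => if hx : dec x < n then f ⟨dec x, hx⟩ else F
    have hh : ∀ i : Fin n, h ((i : ℕ) : Ordinal.{u}).toZFSet = f i := fun i => by
      have : dec ((i : ℕ) : Ordinal.{u}).toZFSet < n := by rw [hdec]; exact i.2
      simp only [h, dif_pos this]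
      exact congrArg f (Fin.ext (hdec i))
    have hnat : ∀ x ∈ (n : Ordinal.{u}).toZFSet, ∃ i : Fin n, x = ((i : ℕ) : Ordinal.{u}).toZFSet :=
      fun x hx => by
        obtain ⟨b, hb, rfl⟩ := Ordinal.mem_toZFSet_iff.1 hx
        obtain ⟨m, rfl⟩ := Ordinal.lt_omega0.1 (hb.trans (Ordinal.natCast_lt_omega0 n))
        exact ⟨⟨m, by exact_mod_cast hb⟩, rfl⟩
    have hin : ∀ i : Fin n, ((i : ℕ) : Ordinal.{u}).toZFSet ∈ (n : Ordinal.{u}).toZFSet := fun i =>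
      Ordinal.toZFSet_mem_toZFSet_iff.2 (by exact_mod_cast i.2)
    obtain ⟨σ, hσ, hσe, -⟩ := S.apply_lam hnV (h := h) fun x hx => by
      obtain ⟨i, rfl⟩ := hnat x hx
      rw [hh]
      exact hf i
    have : Fact (σ ∈ W) := ⟨hσ.1⟩
    have hσi : ∀ ξ ∈ ordSet κ, ∀ i : Fin n,
        ev (ev σ ξ) ((i : ℕ) : Ordinal.{u}).toZFSet = ev (f i) ξ := fun ξ hξ i => by
      rw [hσe ξ hξ, ev_lam (hin i), hh]
    have h1 := S.ae_forall_mem hnV (fun ξ i => ev (ev σ ξ) i ∈ ev F ξ) fun x hx => by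
      obtain ⟨i, rfl⟩ := hnat x hx
      exact (IsMUltrafilter.ae_congr fun ξ hξ => by rw [hσi ξ hξ i]).2 (hfF i)
    obtain ⟨l, hl, hl'⟩ := exists_isFunTo_of_ae_exists S.ultra (empty_mem_V S.inaccessible)
      (fun ξ y => y ∈ ev F ξ ∧ Sat (V_ κ.ord) (⟨n, φ⟩ : Σ n, setLang.BoundedFormula Empty (n + 1)).2
        Empty.elim (Fin.snoc (α := fun _ => ZFSet.{u})
          (fun i => ev (ev σ ξ) ((i : ℕ) : Ordinal.{u}).toZFSet) y))
      (S.ultra.ae_mono (S.ultra.ae_and (S.ultra.ae_and hFa h1) ((hlos k hk).1 hsat)) _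
        fun ξ hξ => by
          rintro ⟨⟨⟨_, _, _, hE'⟩, h2⟩, h3⟩
          have h4 := (ZFSet.mem_sep.1 hE').2 ⟨n, φ⟩ (ev σ ξ) (hσ.ev_mem hξ) h2
          simp only [hσi ξ hξ] at h4 ⊢
          obtain ⟨y, hy, h5⟩ := h4 ⟨_, hk.ev_mem hξ, h3⟩
          exact ⟨y, V_transitive _ (hF.ev_mem hξ) hy, hy, h5⟩)
    have : Fact (l ∈ W) := ⟨hl.1⟩
    refine ⟨p l, S.collapse.mem_of_ae hl.isUltFun hF.isUltFun
      (S.ultra.ae_mono hl' _ fun ξ _ h => h.1), (hlos l hl).2 ?_⟩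
    exact (IsMUltrafilter.ae_congr fun ξ hξ => by simp only [hσi ξ hξ]).1
      (S.ultra.ae_mono hl' (fun ξ => Sat (V_ κ.ord)
        (⟨n, φ⟩ : Σ n, setLang.BoundedFormula Empty (n + 1)).2
        Empty.elim (Fin.snoc (α := fun _ => ZFSet.{u})
          (fun i => ev (ev σ ξ) ((i : ℕ) : Ordinal.{u}).toZFSet) (ev l ξ))) fun ξ _ h => h.2)
  · intro δ hδ s hs
    have hδκ := toZFSet_mem_ordSet.2 hδ
    have hδV : δ.toZFSet ∈ V_ κ.ord := ordSet_subset_V hδκ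
    have : Fact (δ.toZFSet ∈ W) := ⟨hW.transitive _ hκW.out hδκ⟩
    have hch : ∀ i, ∃ f, i ∈ δ.toZFSet → IsFunTo κ W (V_ κ.ord) f ∧ ev s i = p f ∧
        AE κ U (fun ξ => ev f ξ ∈ ev F ξ) := fun i => by
      by_cases hi : i ∈ δ.toZFSet
      · obtain ⟨f, hf⟩ := hrep _ (IsFunc.ev_mem hs hi)
        exact ⟨f, fun _ => hf⟩
      · exact ⟨∅, fun h => absurd h hi⟩
    choose f hf using hch
    obtain ⟨σ, hσ, hσe, hσp⟩ := S.apply_lam hδV fun i hi => (hf i hi).1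
    have : Fact (σ ∈ W) := ⟨hσ.1⟩
    have h1 := S.ae_forall_mem hδV (fun ξ i => ev (ev σ ξ) i ∈ ev F ξ) fun i hi =>
      (IsMUltrafilter.ae_congr fun ξ hξ => by rw [hσe ξ hξ, ev_lam hi]).2 (hf i hi).2.2
    have h2 : s = p σ := by
      rw [hσp, IsFunc.eq_lam hs]
      exact lam_congr fun i hi => (hf i hi).2.1
    rw [h2]
    refine S.collapse.mem_of_ae hσ.isUltFun hF.isUltFun
      (S.ultra.ae_mono (S.ultra.ae_and (S.ultra.ae_and hFa h1) (S.ultra.ae_mem S.model hδκ)) _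
        fun ξ hξ => ?_)
    rintro ⟨⟨⟨_, _, h3, _⟩, h4⟩, h5⟩
    refine h3 _ (hσ.ev_mem hξ) ⟨_, h5, ?_⟩
    rw [hσe ξ hξ] at h4 ⊢
    exact isFunc_lam fun i hi => by
      have := h4 i hi
      rwa [ev_lam hi] at this

end RamseyUltrapower


/-! ### Small sets and the special chain -/

namespace RamseyUltrapower

variable {κ : Cardinal.{u}} {W U : ZFSet.{u}} {p : ZFSet.{u} → ZFSet.{u}}
  [hW : IsTransModel W] [hκW : Fact (ordSet κ ∈ W)] [hV : Fact (V_ κ.ord ∈ W)]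

theorem isSmall_ordSet (S : RamseyUltrapower κ W U p) : IsSmall κ W U p (ordSet κ) :=
  ⟨_, isFunTo_id, S.apply_id.symm, S.ultra.ae_of_forall fun ξ hξ => by
    rw [ev_lam hξ]
    exact (exists_subset_img_ev_iff S.inaccessible hξ
      (V_transitive _ (ordSet_subset_V hξ))).2 le_rfl⟩

theorem isSmall_singleton (S : RamseyUltrapower κ W U p) {x : ZFSet.{u}}
    (hx : x ∈ imageV κ p) : IsSmall κ W U p {x} := by
  obtain ⟨f, hf, rfl⟩ := S.mem_iff.1 hx
  have : Fact (f ∈ W) := ⟨hf.1⟩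
  have hl : IsFunTo κ W (V_ κ.ord) (lam (fun ξ => {ev f ξ, ev f ξ}) (ordSet κ)) :=
    isFunTo_lam _ fun ξ hξ => insert_singleton_mem_V S.inaccessible (hf.ev_mem hξ) (hf.ev_mem hξ)
  have : Fact (lam (fun ξ => {ev f ξ, ev f ξ}) (ordSet κ) ∈ W) := ⟨hl.1⟩
  refine ⟨_, hl, ?_, S.ultra.ae_mono S.ae_omega_mem _ fun ξ hξ h => ?_⟩
  · rw [S.apply_upair hf.isUltFun hf.isUltFun, ZFSet.pair_eq_singleton]
  · refine (exists_subset_img_ev_iff S.inaccessible hξ (V_transitive _ (hl.ev_mem hξ))).2 ?_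
    rw [ev_lam hξ, ZFSet.pair_eq_singleton, ZFSet.card_singleton]
    exact Cardinal.one_le_aleph0.trans (aleph0_le_card_of_omega_mem hξ h)

/-- The union is represented pointwise. For almost all ξ, |ξ| is infinite and at least |a|, so a
union of |a| sets of size at most |ξ| again has size at most |ξ|. -/
theorem isSmall_sUnion (S : RamseyUltrapower κ W U p) {a : ZFSet.{u}} (ha : a ∈ V_ κ.ord)
    {X : ZFSet.{u} → ZFSet.{u}} (hX : ∀ i ∈ a, IsSmall κ W U p (X i)) :
    IsSmall κ W U p (⋃₀ img X a : ZFSet.{u}) := by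
  have haW : ∀ {y}, y ∈ a → y ∈ W := fun hy =>
    hW.transitive _ (hW.transitive _ hV.out ha) hy
  have : Fact (a ∈ W) := ⟨hW.transitive _ hV.out ha⟩
  choose! h hh hX hhs using hX
  have hac := card_lt_of_mem_V S.inaccessible ha
  have : Fact (lam h a ∈ W) := ⟨S.model.lam_mem_of_card_lt (fun y => haW) hac
    fun i hi => (hh i hi).1⟩
  have hF : IsFunTo κ W (V_ κ.ord)
      (lam (fun ξ => ⋃₀ img (fun i => ev (ev (lam h a) i) ξ) a) (ordSet κ)) :=
    isFunTo_lam _ fun ξ hξ => sUnion_mem_V (img_mem_V S.inaccessible ha fun i hi => by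
      rw [ev_lam hi]
      exact (hh i hi).ev_mem hξ)
  have : Fact (lam (fun ξ => ⋃₀ img (fun i => ev (ev (lam h a) i) ξ) a) (ordSet κ) ∈ W) := ⟨hF.1⟩
  have hmem : ∀ (f : ZFSet.{u} → ZFSet.{u}) x, x ∈ (⋃₀ img f a : ZFSet.{u}) ↔
      ∃ i ∈ a, x ∈ f i := by
    intro f x
    rw [ZFSet.mem_sUnion]
    constructor
    · rintro ⟨w, hw, hx⟩
      obtain ⟨i, hi, rfl⟩ := mem_img.1 hw
      exact ⟨i, hi, hx⟩
    · rintro ⟨i, hi, hx⟩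
      exact ⟨_, mem_img.2 ⟨i, hi, rfl⟩, hx⟩
  refine ⟨_, hF, ?_, ?_⟩
  · ext x
    rw [hmem]
    constructor
    · rintro ⟨i, hi, hx⟩
      rw [hX i hi] at hx
      refine S.collapse.subset_of_ae S.ultra (hh i hi).isUltFun hF.isUltFun
        (S.ultra.ae_of_forall fun ξ hξ => ?_) hx
      rw [ev_lam hξ]
      intro y hy
      refine (hmem _ _).2 ⟨i, hi, ?_⟩
      rwa [ev_lam hi]
    · intro hx
      obtain ⟨g, hg, h1, rfl⟩ := (S.collapse _ hF.isUltFun x).1 hx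
      have : Fact (g ∈ W) := ⟨hg.1⟩
      obtain ⟨i, hi, h2⟩ := S.ae_exists_mem ha (fun ξ i => ev g ξ ∈ ev (ev (lam h a) i) ξ)
        (S.ultra.ae_mono h1 _ fun ξ hξ h2 => by
          rw [ev_lam hξ] at h2
          exact (hmem _ _).1 h2)
      refine ⟨i, hi, ?_⟩
      rw [hX i hi]
      rw [ev_lam hi] at h2
      exact S.collapse.mem_of_ae hg (hh i hi).isUltFun h2
  · have hc : a.card.ord.toZFSet ∈ ordSet κ :=
      toZFSet_mem_ordSet.2 (Cardinal.ord_lt_ord.2 hac)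
    have h1 := S.ae_forall_mem ha
      (fun ξ i => ∃ t ∈ V_ κ.ord, ev (ev (lam h a) i) ξ ⊆ img (ev t) ξ) fun i hi => by
        rw [ev_lam hi]
        exact hhs i hi
    refine S.ultra.ae_mono (S.ultra.ae_and (S.ultra.ae_and S.ae_omega_mem h1)
      (S.ultra.ae_mem S.model hc)) _ fun ξ hξ h2 => ?_
    obtain ⟨⟨h2, h3⟩, h4⟩ := h2
    refine (exists_subset_img_ev_iff S.inaccessible hξ (V_transitive _ (hF.ev_mem hξ))).2 ?_
    rw [ev_lam hξ]
    have h5 := ZFSet.card_mono ((isOrdinal_of_mem_ordSet hξ).isTransitive _ h4)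
    rw [Ordinal.card_toZFSet, Cardinal.card_ord] at h5
    refine card_sUnion_img_le (aleph0_le_card_of_omega_mem hξ h2) h5 fun i hi => ?_
    have h6 := h3 i hi
    refine (exists_subset_img_ev_iff S.inaccessible hξ (V_transitive _ ?_)).1 h6
    rw [ev_lam hi]
    exact (hh i hi).ev_mem hξ

theorem isSmall_union (S : RamseyUltrapower κ W U p) {X Y : ZFSet.{u}}
    (hX : IsSmall κ W U p X) (hY : IsSmall κ W U p Y) : IsSmall κ W U p (X ∪ Y) := by
  classical
  have h0 := empty_mem_V S.inaccessible
  have h1 := insert_singleton_mem_V S.inaccessible h0 h0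
  have h2 := insert_singleton_mem_V S.inaccessible h0 h1
  have h3 := S.isSmall_sUnion (X := fun i => if i = ∅ then X else Y) h2 fun i _ => by
    by_cases hi : i = ∅
    · simpa only [if_pos hi]
    · simpa only [if_neg hi]
  have hne : ({∅, ∅} : ZFSet.{u}) ≠ ∅ := fun h => by
    rw [ZFSet.eq_empty] at h
    exact h ∅ (ZFSet.mem_pair.2 (Or.inl rfl))
  convert h3 using 1
  ext x
  rw [ZFSet.mem_union, ZFSet.mem_sUnion]
  constructor
  · rintro (hx | hx)
    · exact ⟨X, mem_img.2 ⟨∅, ZFSet.mem_pair.2 (Or.inl rfl), (if_pos rfl).symm⟩, hx⟩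
    · exact ⟨Y, mem_img.2 ⟨_, ZFSet.mem_pair.2 (Or.inr rfl), (if_neg hne).symm⟩, hx⟩
  · rintro ⟨w, hw, hx⟩
    obtain ⟨i, _, rfl⟩ := mem_img.1 hw
    by_cases hi : i = ∅
    · rw [if_pos hi] at hx
      exact Or.inl hx
    · rw [if_neg hi] at hx
      exact Or.inr hx

/-- Choose in `W` functions T(ξ) with F(ξ) ⊆ T(ξ)[ξ]. Restricted to ξ, they represent a function in
the image whose domain is the class of the identity, that is κ, and whose range covers `X`. The
inclusion of κ gives the lower bound on the size. -/
theorem hasSizeIn_of_isSmall (S : RamseyUltrapower κ W U p) {X : ZFSet.{u}}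
    (hX : IsSmall κ W U p X) (hκX : ordSet κ ⊆ X) : HasSizeIn κ (imageV κ p) X := by
  have hsub := S.isSmall_subset hX
  have hc : κ ≤ X.card := by
    have := ZFSet.card_mono hκX
    rwa [Ordinal.card_toZFSet, Cardinal.card_ord] at this
  obtain ⟨F, hF, rfl, hFs⟩ := hX
  have : Fact (F ∈ W) := ⟨hF.1⟩
  obtain ⟨T, hT, hTa⟩ := exists_isFunTo_of_ae_exists S.ultra (empty_mem_V S.inaccessible)
    (fun ξ t => ev F ξ ⊆ img (ev t) ξ) hFs
  have : Fact (T ∈ W) := ⟨hT.1⟩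
  have hH : IsFunTo κ W (V_ κ.ord) (lam (fun ξ => lam (fun i => ev (ev T ξ) i) ξ) (ordSet κ)) :=
    isFunTo_lam _ fun ξ hξ => lam_mem_V S.inaccessible (ordSet_subset_V hξ) fun i _ =>
      ev_mem_V (hT.ev_mem hξ)
  let t : ZFSet.{u} → ZFSet.{u} := fun i => lam (fun ξ => ev (ev T ξ) i) (ordSet κ)
  have ht : ∀ i ∈ ordSet κ, IsUltFun κ W (t i) := fun i hi => by
    have : Fact (i ∈ W) := ⟨hW.transitive _ hκW.out hi⟩
    exact isUltFun_lam _
  have hpair : ∀ i ∈ ordSet κ, IsUltFun κ W (lam (fun ξ =>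
      ZFSet.pair (ev (lam (fun _ => i) (ordSet κ)) ξ) (ev (t i) ξ)) (ordSet κ)) ∧
      p (lam (fun ξ => ZFSet.pair (ev (lam (fun _ => i) (ordSet κ)) ξ) (ev (t i) ξ)) (ordSet κ)) =
        ZFSet.pair i (p (t i)) := by
    intro i hi
    have hiV : i ∈ V_ κ.ord := ordSet_subset_V hi
    have hc := isFunTo_const (W := W) hiV
    have : Fact (lam (fun _ => i) (ordSet κ) ∈ W) := ⟨hc.1⟩
    have : Fact (t i ∈ W) := ⟨(ht i hi).1⟩
    refine ⟨isUltFun_lam _, ?_⟩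
    rw [S.apply_pair hc.isUltFun (ht i hi), S.apply_const hiV]
  have hHp : p (lam (fun ξ => lam (fun i => ev (ev T ξ) i) ξ) (ordSet κ)) =
      lam (fun i => p (t i)) (ordSet κ) := by
    ext z
    rw [mem_lam]
    constructor
    · intro hz
      obtain ⟨g, hg, h1, rfl⟩ := (S.collapse _ hH.isUltFun z).1 hz
      have : Fact (g ∈ W) := ⟨hg.1⟩
      obtain ⟨i, hi, h2⟩ := S.ultra.ae_regressive
        (fun ξ i => ev g ξ = ZFSet.pair i (ev (ev T ξ) i))
        (S.ultra.ae_mono h1 _ fun ξ hξ h => by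
          rw [ev_lam hξ] at h
          exact mem_lam.1 h)
      refine ⟨i, hi, ?_⟩
      rw [← (hpair i hi).2]
      refine S.collapse.eq_of_ae S.ultra hg (hpair i hi).1
        ((IsMUltrafilter.ae_congr fun ξ hξ => ?_).1 h2)
      rw [ev_lam hξ, ev_lam hξ, ev_lam hξ]
    · rintro ⟨i, hi, rfl⟩
      rw [← (hpair i hi).2]
      have : Fact (i ∈ W) := ⟨hW.transitive _ hκW.out hi⟩
      refine S.collapse.mem_of_ae (hpair i hi).1 hH.isUltFun
        ((IsMUltrafilter.ae_congr fun ξ hξ => ?_).2 (S.ultra.ae_mem S.model hi))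
      rw [ev_lam hξ, ev_lam hξ, ev_lam hξ, ev_lam hξ, pair_mem_lam, and_iff_left rfl]
  refine S.isModel.hasSizeIn_of_subset_img hsub.1 (S.mem_iff.2 ⟨_, hH, rfl⟩) ?_ hc
  intro x hx
  obtain ⟨g, hg, h1, rfl⟩ := (S.collapse _ hF.isUltFun x).1 hx
  have : Fact (g ∈ W) := ⟨hg.1⟩
  obtain ⟨i, hi, h2⟩ := S.ultra.ae_regressive (fun ξ i => ev g ξ = ev (ev T ξ) i)
    (S.ultra.ae_mono₂ h1 hTa _ fun ξ _ h1 h2 => mem_img.1 (h2 h1))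
  refine mem_img.2 ⟨i, hi, ?_⟩
  rw [hHp, ev_lam hi]
  exact S.collapse.eq_of_ae S.ultra hg (ht i hi)
    ((IsMUltrafilter.ae_congr fun ξ hξ => by rw [ev_lam hξ]).1 h2)

/-- The ultrapower of `V_κ` is `κ`-special. -/
theorem isSpecial (S : RamseyUltrapower κ W U p) : IsSpecial κ κ.ord (imageV κ p) := by
  classical
  refine ⟨S.isModel.toIsWeakModel, ?_⟩
  obtain ⟨m, hm, hm'⟩ := exists_eq_img_ord (imageV κ p)
  rw [S.isModel.card_eq] at hm hm'
  have hlim := S.model.isSuccLimit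
  let Good : ZFSet.{u} → ZFSet.{u} → Prop := fun Z X => IsSmall κ W U p X ∧ Z ⊆ X ∧
    TarskiVaught X (imageV κ p) ∧ ∀ δ < κ.ord, ∀ s, ZFSet.IsFunc δ.toZFSet X s → s ∈ X
  let K : ZFSet.{u} → ZFSet.{u} := fun Z => if h : ∃ X, Good Z X then h.choose else ∅
  have hK : ∀ Z, IsSmall κ W U p Z → Good Z (K Z) := fun Z hZ => by
    have h : ∃ X, Good Z X := S.isSmall_hull hZ
    simp only [K, dif_pos h]
    exact h.choose_spec
  -- Stage `α` is a hull of `κ`, the `α`-th element of the model and all earlier stages. The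
  -- recursion is external: only smallness of each stage, not membership of the sequence in the
  -- model, is needed.
  let Y : ZFSet.{u} → ZFSet.{u} := ZFSet.mem_wf.fix fun α F =>
    K (ordSet κ ∪ ({m α} ∪ ⋃₀ ZFSet.range (fun β : α => F β β.2)))
  have hY : ∀ α, Y α = K (ordSet κ ∪ ({m α} ∪ ⋃₀ img Y α)) := fun α => ZFSet.mem_wf.fix_eq _ α
  have hYg : ∀ α, α ∈ ordSet κ → Good (ordSet κ ∪ ({m α} ∪ ⋃₀ img Y α)) (Y α) := by
    intro α
    induction α using ZFSet.inductionOn with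
    | _ α ih =>
      intro hα
      rw [hY]
      exact hK _ (S.isSmall_union S.isSmall_ordSet (S.isSmall_union (S.isSmall_singleton (hm' α hα))
        (S.isSmall_sUnion (ordSet_subset_V hα) fun β hβ =>
          (ih β hβ (ordSet_transitive _ hα hβ)).1)))
  have hYκ : ∀ α ∈ ordSet κ, ordSet κ ⊆ Y α := fun α hα x hx =>
    (hYg α hα).2.1 (ZFSet.mem_union.2 (Or.inl hx))
  have hYm : ∀ α ∈ ordSet κ, m α ∈ Y α := fun α hα =>
    (hYg α hα).2.1 (ZFSet.mem_union.2 (Or.inr (ZFSet.mem_union.2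
      (Or.inl (ZFSet.mem_singleton.2 rfl)))))
  have hYmono : ∀ α ∈ ordSet κ, ∀ β ∈ α, Y β ⊆ Y α := fun α hα β hβ x hx =>
    (hYg α hα).2.1 (ZFSet.mem_union.2 (Or.inr (ZFSet.mem_union.2 (Or.inr
      (ZFSet.mem_sUnion.2 ⟨_, mem_img.2 ⟨β, hβ, rfl⟩, hx⟩)))))
  have hYmono' : ∀ a b : Ordinal.{u}, a ≤ b → b < κ.ord → Y a.toZFSet ⊆ Y b.toZFSet := by
    intro a b hab hb
    rcases hab.eq_or_lt with rfl | hab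
    · exact subset_rfl
    · exact hYmono _ (toZFSet_mem_ordSet.2 hb) _ (Ordinal.toZFSet_mem_toZFSet_iff.2 hab)
  have h0 : (0 : Ordinal.{u}) < κ.ord := hlim.bot_lt
  -- The index is shifted by one: unions over earlier stages make the chain continuous, and the term
  -- with index `ξ + 1` is `Y` at `ξ`, which is closed under short sequences. Adding `Y` at `0`
  -- makes the term with index `0` an elementary submodel containing `κ`.
  let X : Ordinal.{u} → ZFSet.{u} := fun ξ => Y (0 : Ordinal.{u}).toZFSet ∪ ⋃₀ img Y ξ.toZFSet
  have hX : ∀ ξ x, x ∈ X ξ ↔ ∃ η, (η < ξ ∨ η = 0) ∧ x ∈ Y η.toZFSet := by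
    intro ξ x
    rw [ZFSet.mem_union, ZFSet.mem_sUnion]
    constructor
    · rintro (hx | ⟨w, hw, hx⟩)
      · exact ⟨0, Or.inr rfl, hx⟩
      · obtain ⟨i, hi, rfl⟩ := mem_img.1 hw
        obtain ⟨η, hη, rfl⟩ := Ordinal.mem_toZFSet_iff.1 hi
        exact ⟨η, Or.inl hη, hx⟩
    · rintro ⟨η, hη | rfl, hx⟩
      · exact Or.inr ⟨_, mem_img.2 ⟨_, Ordinal.toZFSet_mem_toZFSet_iff.2 hη, rfl⟩, hx⟩
      · exact Or.inl hx
  have hlt : ∀ {ξ η : Ordinal.{u}}, ξ < κ.ord → (η < ξ ∨ η = 0) → η < κ.ord := fun hξ hη =>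
    hη.elim (fun h => h.trans hξ) (fun h => h ▸ h0)
  have hXs : ∀ ξ < κ.ord, IsSmall κ W U p (X ξ) := fun ξ hξ =>
    S.isSmall_union (hYg _ (toZFSet_mem_ordSet.2 h0)).1
      (S.isSmall_sUnion (ordSet_subset_V (toZFSet_mem_ordSet.2 hξ)) fun i hi =>
        (hYg i (ordSet_transitive _ (toZFSet_mem_ordSet.2 hξ) hi)).1)
  have hXM : ∀ ξ < κ.ord, X ξ ⊆ imageV κ p := fun ξ hξ => (S.isSmall_subset (hXs ξ hξ)).2
  have hXT : ∀ ξ < κ.ord, TarskiVaught (X ξ) (imageV κ p) := by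
    intro ξ hξ n φ a ha hex
    choose η hη haη using fun i => (hX ξ _).1 (ha i)
    -- The finitely many parameters already occur in one stage, which is elementary in the model.
    have : ∃ b, (b < ξ ∨ b = 0) ∧ ∀ i, a i ∈ Y b.toZFSet := by
      rcases isEmpty_or_nonempty (Fin n) with hn | hn
      · exact ⟨0, Or.inr rfl, fun i => hn.elim i⟩
      · obtain ⟨i₀, hi₀⟩ := Finite.exists_max η
        exact ⟨η i₀, hη i₀, fun i => hYmono' _ _ (hi₀ i) (hlt hξ (hη i₀)) (haη i)⟩
    obtain ⟨b, hb, hab⟩ := this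
    obtain ⟨x, hx, h1⟩ :=
      (hYg _ (toZFSet_mem_ordSet.2 (hlt hξ hb))).2.2.1 n φ a hab hex
    exact ⟨x, (hX ξ x).2 ⟨b, hb, hx⟩, h1⟩
  have hXmono : ∀ ξ η, ξ ≤ η → X ξ ⊆ X η := fun ξ η h x hx => by
    obtain ⟨b, hb, hx⟩ := (hX ξ x).1 hx
    exact (hX η x).2 ⟨b, hb.imp_left fun h' => h'.trans_le h, hx⟩
  refine ⟨X, fun ξ hξ => (hXT ξ hξ).isElementarySubmodel (hXM ξ hξ), fun ξ η h hη =>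
    (hXT ξ (h.trans_lt hη)).isElementarySubmodel_of_subset (hXT η hη) (hXmono ξ η h) (hXM η hη),
    fun l hl hll x => ⟨fun hx => ?_, fun ⟨ξ, hξ, hx⟩ => hXmono ξ l hξ.le hx⟩, fun x => ⟨fun hx => ?_,
    fun ⟨ξ, hξ, hx⟩ => hXM ξ hξ hx⟩, fun ξ hξ => ?_, fun ξ hξ δ hδ s _ hs => ?_⟩
  · obtain ⟨b, hb, hx⟩ := (hX l x).1 hx
    rcases hb with hb | rfl
    · exact ⟨b + 1, hll.add_one_lt hb, (hX _ x).2 ⟨b, Or.inl (lt_add_one b), hx⟩⟩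
    · exact ⟨0, hll.bot_lt, (hX _ x).2 ⟨0, Or.inr rfl, hx⟩⟩
  · rw [hm] at hx
    obtain ⟨i, hi, rfl⟩ := mem_img.1 hx
    obtain ⟨ξ, hξ, rfl⟩ := mem_ordSet.1 hi
    exact ⟨ξ + 1, hlim.add_one_lt hξ, (hX _ _).2 ⟨ξ, Or.inl (lt_add_one ξ), hYm _ hi⟩⟩
  · exact S.hasSizeIn_of_isSmall (hXs ξ hξ) fun x hx =>
      (hX ξ x).2 ⟨0, Or.inr rfl, hYκ _ (toZFSet_mem_ordSet.2 h0) hx⟩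
  · have hξ' : ξ < κ.ord := (lt_add_one ξ).trans hξ
    have he : X (ξ + 1) = Y ξ.toZFSet := by
      ext x
      rw [hX]
      constructor
      · rintro ⟨b, hb, hx⟩
        refine hYmono' b ξ ?_ hξ' hx
        rcases hb with hb | rfl
        · exact Order.lt_add_one_iff.1 hb
        · exact bot_le
      · exact fun hx => ⟨ξ, Or.inl (lt_add_one ξ), hx⟩
    rw [he] at hs ⊢
    exact (hYg _ (toZFSet_mem_ordSet.2 hξ')).2.2.2 δ hδ s hs

end RamseyUltrapower


/-! ### Ranks in the ultrapower -/

/-- The comparison of ranks below `κ`, as a definable relation over `W`. -/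
def RankLe (κ : Cardinal.{u}) (W x y : ZFSet.{u}) : Prop :=
  ∃ a ∈ ordSet κ, ∃ b ∈ ordSet κ, RankRel W x a ∧ RankRel W y b ∧ a ⊆ b

theorem IsModel.rankLe_iff {κ : Cardinal.{u}} {W : ZFSet.{u}} (h : IsModel κ W)
    (hi : κ.IsInaccessible) {x y : ZFSet.{u}} (hx : x ∈ V_ κ.ord) (hy : y ∈ V_ κ.ord) :
    RankLe κ W x y ↔ x.rank ≤ y.rank := by
  constructor
  · rintro ⟨a, _, b, _, ha, hb, hab⟩
    rw [ha.eq, hb.eq] at hab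
    simpa only [Ordinal.rank_toZFSet] using ZFSet.rank_mono hab
  · intro hxy
    refine ⟨_, rank_mem_ordSet.2 hx, _, rank_mem_ordSet.2 hy, (h.rankRel_iff hi hx).2 rfl,
      (h.rankRel_iff hi hy).2 rfl, ?_⟩
    intro z hz
    obtain ⟨c, hc, rfl⟩ := Ordinal.mem_toZFSet_iff.1 hz
    exact Ordinal.toZFSet_mem_toZFSet_iff.2 (hc.trans_le hxy)

instance Dfn.rankLe {κ : Cardinal.{u}} {W : ZFSet.{u}} [IsTransModel W] [Fact (ordSet κ ∈ W)]
    {β : Type} [Finite β] (s t : (β → W) → ZFSet.{u}) [hs : Tm s] [ht : Tm t] :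
    Dfn (fun v => RankLe κ W (s v) (t v)) := by
  have := hs.weaken (β := Option (Option β)) (fun i => some (some i))
  have := ht.weaken (β := Option (Option β)) (fun i => some (some i))
  unfold RankLe
  infer_instance

namespace RamseyUltrapower

variable {κ : Cardinal.{u}} {W U : ZFSet.{u}} {p : ZFSet.{u} → ZFSet.{u}}
  [hW : IsTransModel W] [hκW : Fact (ordSet κ ∈ W)] [hV : Fact (V_ κ.ord ∈ W)]

theorem mem_apply_iff (S : RamseyUltrapower κ W U p) {f : ZFSet.{u}}
    (hf : IsFunTo κ W (V_ κ.ord) f) (x : ZFSet.{u}) : x ∈ p f ↔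
      ∃ g, IsFunTo κ W (V_ κ.ord) g ∧ AE κ U (fun ξ => ev g ξ ∈ ev f ξ) ∧ x = p g := by
  constructor
  · intro hx
    obtain ⟨g, hg, rfl⟩ := S.mem_iff.1 (S.isTransitive _ (S.mem_iff.2 ⟨f, hf, rfl⟩) hx)
    exact ⟨g, hg, (S.collapse.mem_iff S.ultra hg.isUltFun hf.isUltFun).1 hx, rfl⟩
  · rintro ⟨g, hg, h, rfl⟩
    exact S.collapse.mem_of_ae hg.isUltFun hf.isUltFun h

/-- By induction on the class of `g`: if h represents one of its elements, a function k in `W`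
chooses elements of f(ξ) whose rank is at least that of h(ξ), and the induction hypothesis compares
h with k. -/
theorem rank_le (S : RamseyUltrapower κ W U p) : ∀ {g f : ZFSet.{u}},
    IsFunTo κ W (V_ κ.ord) g → IsFunTo κ W (V_ κ.ord) f →
    AE κ U (fun ξ => (ev g ξ).rank ≤ (ev f ξ).rank) → (p g).rank ≤ (p f).rank := by
  have key : ∀ x g f, x = p g → IsFunTo κ W (V_ κ.ord) g → IsFunTo κ W (V_ κ.ord) f →
      AE κ U (fun ξ => (ev g ξ).rank ≤ (ev f ξ).rank) → (p g).rank ≤ (p f).rank := by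
    intro x
    induction x using ZFSet.inductionOn with
    | _ x ih =>
      rintro g f rfl hg hf hgf
      rw [ZFSet.rank_le_iff]
      intro y hy
      obtain ⟨h, hh, hhg, rfl⟩ := (S.mem_apply_iff hg y).1 hy
      have : Fact (h ∈ W) := ⟨hh.1⟩
      have : Fact (f ∈ W) := ⟨hf.1⟩
      obtain ⟨k, hk, hk'⟩ := exists_isFunTo_of_ae_exists S.ultra (empty_mem_V S.inaccessible)
        (fun ξ z => z ∈ ev f ξ ∧ RankLe κ W (ev h ξ) z)
        (S.ultra.ae_mono₂ hhg hgf _ fun ξ hξ h1 h2 => by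
          have h3 := (ZFSet.rank_lt_of_mem h1).trans_le h2
          rw [ZFSet.lt_rank_iff] at h3
          obtain ⟨z, hz, h4⟩ := h3
          have hzV := V_transitive _ (hf.ev_mem hξ) hz
          exact ⟨z, hzV, hz,
            (S.model.rankLe_iff S.inaccessible (hh.ev_mem hξ) hzV).2 h4⟩)
      have : Fact (k ∈ W) := ⟨hk.1⟩
      have h1 : p k ∈ p f := S.collapse.mem_of_ae hk.isUltFun hf.isUltFun
        (S.ultra.ae_mono hk' _ fun ξ _ h => h.1)
      refine lt_of_le_of_lt (ih _ hy h k rfl hh hk ?_) (ZFSet.rank_lt_of_mem h1)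
      exact (IsMUltrafilter.ae_congr fun ξ hξ =>
        S.model.rankLe_iff S.inaccessible (hh.ev_mem hξ) (hk.ev_mem hξ)).1
          (S.ultra.ae_mono hk' _ fun ξ _ h => h.2)
  intro g f hg hf h
  exact key _ g f rfl hg hf h

/-- An element of the image has rank below j(κ) because the pointwise rank of its representative is
a function into κ. Conversely, by induction an element of N of rank below j(κ) is a subset of the
image, and bounding its rank by the class of a function into κ lets its representative be truncated
to values in V_κ. -/
theorem imageV_eq (S : RamseyUltrapower κ W U p) {N : ZFSet.{u}} (hN : N.IsTransitive)
    (hpN : ∀ x, x ∈ N ↔ ∃ f, IsUltFun κ W f ∧ p f = x) :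
    imageV κ p = V_ (p (lam (fun _ => ordSet κ) (ordSet κ))).rank ∩ N := by
  have hcκ : IsUltFun κ W (lam (fun _ => ordSet κ) (ordSet κ)) := isUltFun_lam _
  have hcV : IsUltFun κ W (lam (fun _ => V_ κ.ord) (ordSet κ)) := isUltFun_lam _
  have hMN : imageV κ p ∈ N := (hpN _).2 ⟨_, hcV, rfl⟩
  have hle : ∀ {f g}, IsFunTo κ W (V_ κ.ord) f → IsFunTo κ W (V_ κ.ord) g →
      (AE κ U (fun ξ => (ev f ξ).rank ≤ (ev g ξ).rank) ↔
        AE κ U (fun ξ => RankLe κ W (ev f ξ) (ev g ξ))) := fun hf hg =>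
    IsMUltrafilter.ae_congr fun ξ hξ =>
      (S.model.rankLe_iff S.inaccessible (hf.ev_mem hξ) (hg.ev_mem hξ)).symm
  ext x
  rw [ZFSet.mem_inter, ZFSet.mem_vonNeumann]
  constructor
  · intro hx
    refine ⟨?_, hN _ hMN hx⟩
    obtain ⟨f, hf, rfl⟩ := S.mem_iff.1 hx
    have : Fact (f ∈ W) := ⟨hf.1⟩
    obtain ⟨r, hr, hr'⟩ := exists_isFunTo_of_ae_exists S.ultra (empty_mem_V S.inaccessible)
      (fun ξ a => a ∈ ordSet κ ∧ RankRel W (ev f ξ) a)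
      (S.ultra.ae_of_forall fun ξ hξ => ⟨_, ordSet_subset_V (rank_mem_ordSet.2 (hf.ev_mem hξ)),
        rank_mem_ordSet.2 (hf.ev_mem hξ),
        (S.model.rankRel_iff S.inaccessible (hf.ev_mem hξ)).2 rfl⟩)
    have : Fact (r ∈ W) := ⟨hr.1⟩
    have h1 : p r ∈ p (lam (fun _ => ordSet κ) (ordSet κ)) :=
      S.collapse.mem_of_ae hr.isUltFun hcκ ((IsMUltrafilter.ae_congr fun ξ hξ => by
        rw [ev_lam hξ]).1 (S.ultra.ae_mono hr' (fun ξ => ev r ξ ∈ ordSet κ) fun ξ _ h => h.1))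
    refine lt_of_le_of_lt (S.rank_le hf hr ((hle hf hr).2 ?_)) (ZFSet.rank_lt_of_mem h1)
    refine S.ultra.ae_mono hr' _ fun ξ hξ h => ?_
    rw [S.model.rankLe_iff S.inaccessible (hf.ev_mem hξ) (hr.ev_mem hξ), h.2.eq,
      Ordinal.rank_toZFSet]
  · induction x using ZFSet.inductionOn with
    | _ x ih =>
      rintro ⟨hx, hxN⟩
      have hsub : x ⊆ imageV κ p := fun y hy =>
        ih y hy ⟨(ZFSet.rank_lt_of_mem hy).trans hx, hN _ hxN hy⟩
      rw [ZFSet.lt_rank_iff] at hx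
      obtain ⟨z, hz, hxz⟩ := hx
      obtain ⟨F, hF, rfl⟩ := (hpN x).1 hxN
      obtain ⟨g', hg', hgκ, rfl⟩ := (S.collapse _ hcκ z).1 hz
      have : Fact (g' ∈ W) := ⟨hg'.1⟩
      have hgκ' : AE κ U (fun ξ => ev g' ξ ∈ V_ κ.ord) := S.ultra.ae_mono hgκ _ fun ξ hξ h => by
        rw [ev_lam hξ] at h
        exact ordSet_subset_V h
      obtain ⟨g, hg, hgg⟩ := hg'.exists_isFunTo S.ultra (empty_mem_V S.inaccessible) hgκ'
      rw [← S.collapse.eq_of_ae S.ultra hg.isUltFun hg' hgg] at hxz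
      have : Fact (F ∈ W) := ⟨hF.1⟩
      have : Fact (g ∈ W) := ⟨hg.1⟩
      -- Only the elements of `ev F ξ` of rank at most that of `ev g ξ` are kept, so the values lie
      -- in V_κ. No element of `p F` is lost, since all of them have rank below that of `p g`.
      have hF' : IsFunTo κ W (V_ κ.ord) (lam (fun ξ => ZFSet.sep
          (fun y => y ∈ ev F ξ ∧ RankLe κ W y (ev g ξ)) (V_ κ.ord)) (ordSet κ)) := by
        refine isFunTo_lam _ fun ξ hξ => ?_
        rw [ZFSet.mem_vonNeumann]
        refine lt_of_le_of_lt (ZFSet.rank_le_iff.2 fun y hy => ?_)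
          ((Cardinal.isSuccLimit_ord S.inaccessible.1.le).succ_lt
            (ZFSet.mem_vonNeumann.1 (hg.ev_mem hξ)))
        obtain ⟨hyV, _, hy⟩ := ZFSet.mem_sep.1 hy
        exact Order.lt_succ_iff.2
          ((S.model.rankLe_iff S.inaccessible hyV (hg.ev_mem hξ)).1 hy)
      refine S.mem_iff.2 ⟨_, hF', subset_antisymm (fun y hy => ?_)
        (S.collapse.subset_of_ae S.ultra hF'.isUltFun hF (S.ultra.ae_of_forall fun ξ hξ => ?_))⟩
      · obtain ⟨h, hh, rfl⟩ := S.mem_iff.1 (hsub hy)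
        have : Fact (h ∈ W) := ⟨hh.1⟩
        have h1 := (S.collapse.mem_iff S.ultra hh.isUltFun hF).1 hy
        have h2 : AE κ U (fun ξ => RankLe κ W (ev h ξ) (ev g ξ)) := by
          by_contra hne
          have h3 := (S.ultra.ae_not _).2 hne
          have h4 := S.rank_le hg hh ((hle hg hh).2 (S.ultra.ae_mono h3 _ fun ξ hξ h => by
            rw [S.model.rankLe_iff S.inaccessible (hh.ev_mem hξ) (hg.ev_mem hξ), not_le] at h
            rw [S.model.rankLe_iff S.inaccessible (hg.ev_mem hξ) (hh.ev_mem hξ)]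
            exact h.le))
          exact absurd ((ZFSet.rank_lt_of_mem hy).trans_le hxz) h4.not_gt
        refine S.collapse.mem_of_ae hh.isUltFun hF'.isUltFun
          ((IsMUltrafilter.ae_congr fun ξ hξ => ?_).1 (S.ultra.ae_and h1 h2))
        rw [ev_lam hξ, ZFSet.mem_sep, and_iff_right (hh.ev_mem hξ)]
      · rw [ev_lam hξ]
        exact fun y hy => (ZFSet.mem_sep.1 hy).2.1

end RamseyUltrapower

/-- Functions from κ to V_κ are subsets of V_κ, so both models have the same ones. The class of such
a function is determined recursively by the classes of such functions and by `U` alone. -/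
theorem imageV_congr {κ : Cardinal.{u}} {W W' U : ZFSet.{u}} {p p' : ZFSet.{u} → ZFSet.{u}}
    [hW : IsTransModel W] [hκW : Fact (ordSet κ ∈ W)] [hV : Fact (V_ κ.ord ∈ W)]
    [hW' : IsTransModel W'] [hκW' : Fact (ordSet κ ∈ W')] [hV' : Fact (V_ κ.ord ∈ W')]
    (S : RamseyUltrapower κ W U p) (S' : RamseyUltrapower κ W' U p')
    (h : ∀ B ⊆ V_ κ.ord, B ∈ W ↔ B ∈ W') : imageV κ p' = imageV κ p := by
  have hfun : ∀ f, IsFunTo κ W (V_ κ.ord) f ↔ IsFunTo κ W' (V_ κ.ord) f := fun f =>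
    and_congr_left fun hf => h f fun z hz => by
      obtain ⟨x, hx, y, hy, rfl⟩ := ZFSet.mem_prod.1 (hf.1 hz)
      exact pair_mem_V S.inaccessible (ordSet_subset_V hx) hy
  have key : ∀ x f, x = p f → IsFunTo κ W (V_ κ.ord) f → p' f = p f := by
    intro x
    induction x using ZFSet.inductionOn with
    | _ x ih =>
      rintro f rfl hf
      ext y
      rw [S.mem_apply_iff hf, S'.mem_apply_iff ((hfun f).1 hf)]
      constructor
      · rintro ⟨g, hg, hgf, rfl⟩
        have hg' := (hfun g).2 hg
        exact ⟨g, hg', hgf, ih _ ((S.mem_apply_iff hf _).2 ⟨g, hg', hgf, rfl⟩) g rfl hg'⟩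
      · rintro ⟨g, hg, hgf, rfl⟩
        exact ⟨g, (hfun g).1 hg, hgf,
          (ih _ ((S.mem_apply_iff hf _).2 ⟨g, hg, hgf, rfl⟩) g rfl hg).symm⟩
  ext x
  rw [S.mem_iff, S'.mem_iff]
  constructor
  · rintro ⟨f, hf, rfl⟩
    exact ⟨f, (hfun f).2 hf, key _ f rfl ((hfun f).2 hf)⟩
  · rintro ⟨f, hf, rfl⟩
    exact ⟨f, (hfun f).1 hf, (key _ f rfl hf).symm⟩


theorem IsStronglyRamsey.exists_isSpecial {κ : Cardinal.{u}} (hκ : IsStronglyRamsey κ)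
    (A : ZFSet.{u}) (hA : A ⊆ ordSet κ) :
    ∃ M : ZFSet.{u}, A ∈ M ∧ IsModel κ M ∧ IsSpecial κ κ.ord M ∧
      ∃ U : ZFSet.{u}, IsMUltrafilter κ M U ∧ IsWeaklyAmenable κ M U ∧
        ∃ (N : ZFSet.{u}) (j : ZFSet.{u} → ZFSet.{u}),
          IsUltrapowerMap κ M U N j ∧
          M = vonNeumannIn N (j (ordSet κ)) ∧
          ModelsZFC M ∧ M ∈ N := by
  have hi := hκ.isInaccessible
  obtain ⟨W, hAW, hW, U, hU, hWA⟩ := hκ A hA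
  have := hW.isTransModel
  have : Fact (ordSet κ ∈ W) := ⟨hW.mem⟩
  have : Fact (V_ κ.ord ∈ W) := ⟨hW.V_mem hi⟩
  obtain ⟨p, hp⟩ := hU.exists_collapse hW
  have S : RamseyUltrapower κ W U p := ⟨hi, hW, hU, hWA, hp⟩
  have hM := S.isModel
  have hU' := S.isMUltrafilter_image
  have := hM.isTransModel
  have : Fact (ordSet κ ∈ imageV κ p) := ⟨hM.mem⟩
  have : Fact (V_ κ.ord ∈ imageV κ p) := ⟨hM.V_mem hi⟩
  obtain ⟨p', hp'⟩ := hU'.exists_collapse hM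
  have S' : RamseyUltrapower κ (imageV κ p) U p' :=
    ⟨hi, hM, hU', S.isWeaklyAmenable_image, hp'⟩
  -- The construction applied to the new model in place of `W` returns the same set, so the new
  -- model is the image of V_κ under its own ultrapower map.
  have he : imageV κ p' = imageV κ p := imageV_congr S S' fun B hB =>
    ⟨S.subset_V_mem hB, S.mem_of_subset_V hB⟩
  obtain ⟨N, hN, hN'⟩ := hp'.exists_ultrapowerMap hU'
  refine ⟨imageV κ p, S.subset_V_mem (fun x hx => ordSet_subset_V (hA hx)) hAW, hM, S.isSpecial, U,
    hU', S.isWeaklyAmenable_image, N, _, hN, ?_, S.modelsZFC, ?_⟩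
  · exact he.symm.trans (S'.imageV_eq hN.1 hN')
  · exact (hN' _).2 ⟨_, isUltFun_lam _, he⟩

end StrongRamsey

theorem mainTheorem5 (κ : Cardinal.{u}) (hκ : StrongRamsey.IsStronglyRamsey κ)
    (A : ZFSet.{u}) (hA : A ⊆ StrongRamsey.ordSet κ) :
    ∃ M : ZFSet.{u}, A ∈ M ∧ StrongRamsey.IsModel κ M ∧ StrongRamsey.IsSpecial κ κ.ord M ∧
      ∃ U : ZFSet.{u}, StrongRamsey.IsMUltrafilter κ M U ∧ StrongRamsey.IsWeaklyAmenable κ M U ∧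
        ∃ (N : ZFSet.{u}) (j : ZFSet.{u} → ZFSet.{u}),
          StrongRamsey.IsUltrapowerMap κ M U N j ∧
          M = StrongRamsey.vonNeumannIn N (j (StrongRamsey.ordSet κ)) ∧
          StrongRamsey.ModelsZFC M ∧ M ∈ N :=
  hκ.exists_isSpecial A hA
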